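/- **Setting.** Let $\mathcal S$ be a finite state space with a crucial state $s^1$, let $\gamma\in[0,1)$, and let the actions be $\mathfrak c$ (control, available in every state) and $\mathfrak t$ (treatment, available only in $s^1$). In state $s$ under an available action $a$ the next state is drawn from $P(\cdot\mid s,a)$ and an independent reward from $\mathcal N(r(s,a),\sigma^2(s,a))$, $0\le\sigma^2(s,a)<\infty$. The unknown parameter is $\theta=(P,r)$; $\gamma$ and $\sigma^2$ are fixed. The control policy $\pi^{\mathfrak c}$ always plays $\mathfrak c$, the treatment policy $\pi^{\mathfrak t}$ plays $\mathfrak t$ in $s^1$ and $\mathfrak c$ elsewhere, and $\pi^{1/2}=\tfrac12\pi^{\mathfrak t}+\tfrac12\pi^{\mathfrak c}$. For $a\in\{\mathfrak t,\mathfrak c\}$ let $\mathbf P^a$, $\sigma_a^2(s)$, $\mathbf V^a$ be the transition matrix, reward variances and $\gamma$-discounted value function of $\pi^a$; put $\rho^a_{s'}(s)=\sum_{i\ge0}\gamma^i\,\mathbb P^{\pi^a}(s_i=s\mid s_0=s')$, $\boldsymbol\rho^a(s)=(\rho^a_{s'}(s))_{s'\in\mathcal S}$, and $\Sigma_{p^a(s)}=\mathrm{Diag}(p)-pp^\top$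 with $p$ the row of $\mathbf P^a$ at $s$. The estimand is the vector $\boldsymbol\Delta=\mathbf V^{\mathfrak t}-\mathbf V^{\mathfrak c}$. Let $\mu$ be a stationary distribution, positive in every state, of the chain under $\pi^{1/2}$ at the true parameter $\theta$, and let $$\begin{aligned}\Sigma_{\mathrm{IS}}={}&\sum_{a\in\{\mathfrak t,\mathfrak c\}}2(I-\gamma\mathbf P^a)^{-1}D^a(I-\gamma\mathbf P^a)^{-\top}+\sum_{s\ne s^1}\frac1{\mu(s)}M_s\,\Sigma_{p^{\mathfrak c}(s)}M_s^\top\\&+\sum_{s\ne s^1}\frac{\sigma^2_{\mathfrak c}(s)}{\mu(s)}\big(\boldsymbol\rho^{\mathfrak t}(s)-\boldsymbol\rho^{\mathfrak c}(s)\big)\big(\boldsymbol\rho^{\mathfrak t}(s)-\boldsymbol\rho^{\mathfrak c}(s)\big)^\top,\end{aligned}$$ where $D^a$ has the single non-zero entry $\big(\sigma_a^2(s^1)+\gamma^2\mathbf V^{a\top}\Sigma_{p^a(s^1)}\mathbf V^a\big)/\mu(s^1)$ at $(s^1,s^1)$, and $M_s=\gamma\boldsymbol\rho^{\mathfrak t}(s)\mathbf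 V^{\mathfrak t\top}-\gamma\boldsymbol\rho^{\mathfrak c}(s)\mathbf V^{\mathfrak c\top}$. **Theorem.** Run $\pi^{1/2}$ for $T\ge1$ steps from the initial distribution $\mu$ and observe the states, actions and rewards. 1. Let $\widehat{\boldsymbol\Delta}$ be a square-integrable estimator based on this trajectory, with covariance matrix $\Sigma$ at $\theta$. Suppose that it is unbiased in one of the following two senses: (a) with the initial distribution $\mu$ held fixed, $\mathbb E_{\theta'}\widehat{\boldsymbol\Delta}$ exists and equals $\boldsymbol\Delta(\theta')+o(\|\theta'-\theta\|)$ as $\theta'\to\theta$ among all single-state treatment models (in particular, this holds if $\mathbb E_{\theta'}\widehat{\boldsymbol\Delta}=\boldsymbol\Delta(\theta')$ for all $\theta'$ near $\theta$); (b) $\mathbb E_{\theta'}\widehat{\boldsymbol\Delta}=\boldsymbol\Delta(\theta')$ for every single-state treatment model $\theta'$ whose chain under $\pi^{1/2}$ is uniformly ergodic with positive stationary distribution and is started from that distribution. Then $\Sigma_{\mathrm{IS}}\preceq T\Sigma$ in the Loewner order. 2. Hence the information-sharing estimator is asymptotically efficient even when the single-state structure is known: if the chain under $\pi^{1/2}$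 at $\theta$ is uniformly ergodic, then $\Sigma_{\mathrm{IS}}$ is positive semidefinite and $\sqrt T(\widehat{\boldsymbol\Delta}^{\mathrm{IS}}-\boldsymbol\Delta)\to\mathcal N(\mathbf 0,\Sigma_{\mathrm{IS}})$ in distribution as $T\to\infty$. Here $\widehat{\boldsymbol\Delta}^{\mathrm{IS}}=\widehat{\mathbf V}^{\mathfrak t}_{\mathrm{IS}}-\widehat{\mathbf V}^{\mathfrak c}_{\mathrm{IS}}$ and $\widehat{\mathbf V}^a_{\mathrm{IS}}=(I-\gamma\widehat{\mathbf P}^a)^{-1}\widehat{\mathbf r}^a$, where $\widehat{\mathbf P}^a,\widehat{\mathbf r}^a$ are the empirical transition frequencies and mean rewards of all samples $(s_i,a_i,s_{i+1},r_i)$ with $s_i\ne s^1$ or $(s_i,a_i)=(s^1,a)$, with $\max(N(s),1)$ as denominator, $N(s)$ being the number of those samples with $s_i=s$. -/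

import Mathlib

open MeasureTheory ProbabilityTheory Filter Topology Matrix
open scoped NNReal BoundedContinuousFunction

noncomputable section

namespace SST

/-- The two actions: `c` (control) and `t` (treatment). -/
inductive Arm where
  | c : Arm
  | t : Arm
  deriving DecidableEq

instance : Fintype Arm := ⟨{Arm.c, Arm.t}, fun a => by cases a <;> simp⟩

instance : MeasurableSpace Arm := ⊤

/-- The unknown parameters of the decision process on the state space `S`: the transition
probabilities `θ.1 s a s' = P(s' | s, a)` and the mean rewards `θ.2 s a = r(s, a)`. -/
abbrev Param (S : Type*) := (S → Arm → S → ℝ) × (S → Arm → ℝ)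

section Model

variable {S : Type*} [Fintype S] [DecidableEq S]

/-- The treatment action can be taken only in the crucial state `s₁`. -/
def Available (s₁ s : S) (a : Arm) : Prop := a = Arm.c ∨ s = s₁

/-- The parameters of all single-state treatment models with crucial state `s₁`: for each
available state-action pair, `P(· | s, a)` is a probability vector. The values of `P` and `r` at
pairs that are not available are irrelevant: no policy below uses them. -/
def models (s₁ : S) : Set (Param S) :=
  {θ | ∀ s a, Available s₁ s a → (∀ s', 0 ≤ θ.1 s a s') ∧ ∑ s', θ.1 s a s' = 1}

/-- The control policy: `c` in all states. -/
def piC : S → Arm → ℝ := fun _ a => if a = Arm.c then 1 else 0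

/-- The treatment policy: `t` in the crucial state and `c` in all the other states. -/
def piT (s₁ : S) : S → Arm → ℝ := fun s a =>
  if s = s₁ then (if a = Arm.t then 1 else 0) else (if a = Arm.c then 1 else 0)

/-- The experimental policy `π^{1/2}`. -/
def piHalf (s₁ : S) : S → Arm → ℝ := fun s a => (1 / 2) * piT s₁ s a + (1 / 2) * piC s a

/-- The transition matrix of the Markov chain of states under a policy. -/
def transMat (π : S → Arm → ℝ) (θ : Param S) : Matrix S S ℝ :=
  Matrix.of fun s s' => ∑ a, π s a * θ.1 s a s'

/-- The mean reward in each state under a policy. -/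
def meanReward (π : S → Arm → ℝ) (θ : Param S) : S → ℝ := fun s => ∑ a, π s a * θ.2 s a

/-- The value function `V^π(s) = E[∑ i, γ ^ i r(s_i, a_i) | s_0 = s]`; the law of `s_i` given
`s_0 = s` is the row `s` of the `i`-th power of the transition matrix. -/
def value (γ : ℝ) (π : S → Arm → ℝ) (θ : Param S) : S → ℝ := fun s =>
  ∑' i : ℕ, γ ^ i * ((transMat π θ ^ i) *ᵥ meanReward π θ) s

/-- The average treatment effect `Δ = V^t - V^c`, as a vector indexed by the initial state. -/
def ate (s₁ : S) (γ : ℝ) (θ : Param S) : S → ℝ := value γ (piT s₁) θ - value γ piC θ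

/-- The discounted state-visitation measure: `visit γ π θ s s' = ρ^π_{s'}(s)` is the discounted
sum of the probabilities to be in `s` when the chain starts in `s'`. So `visit γ π θ s` is the
vector `(ρ^π_{s'}(s))_{s'}`. -/
def visit (γ : ℝ) (π : S → Arm → ℝ) (θ : Param S) (s : S) : S → ℝ := fun s' =>
  ∑' i : ℕ, γ ^ i * (transMat π θ ^ i) s' s

/-- `μ` is a stationary distribution of the transition matrix `P`. -/
def IsStationary (P : Matrix S S ℝ) (μ : S → ℝ) : Prop :=
  (∀ s, 0 ≤ μ s) ∧ ∑ s, μ s = 1 ∧ μ ᵥ* P = μ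

/-- The chain with transition matrix `P` is uniformly ergodic with stationary distribution `μ`:
the total variation distance of `P ^ k (s, ·)` and `μ` decays geometrically, uniformly in `s`. -/
def UniformlyErgodic (P : Matrix S S ℝ) (μ : S → ℝ) : Prop :=
  IsStationary P μ ∧ ∃ C lam : ℝ, 0 ≤ C ∧ 0 ≤ lam ∧ lam < 1 ∧
    ∀ (k : ℕ) (s : S), (1 / 2) * ∑ s', |(P ^ k) s s' - μ s'| ≤ C * lam ^ k

/-! ### The asymptotic covariance matrix of information sharing -/

/-- The variance of the reward in each state under a policy. -/
def rewardVar (π : S → Arm → ℝ) (v : S → Arm → ℝ≥0) : S → ℝ := fun s => ∑ a, π s a * (v s a : ℝ)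

/-- The covariance matrix `Diag(p) - p pᵀ`, where `p` is the row `s` of the transition matrix. -/
def transCov (π : S → Arm → ℝ) (θ : Param S) (s : S) : Matrix S S ℝ :=
  Matrix.diagonal (transMat π θ s) - Matrix.vecMulVec (transMat π θ s) (transMat π θ s)

/-- The contribution of the crucial state under the arm with policy `π`:
`2 (I - γ P^π)⁻¹ D (I - γ P^π)⁻ᵀ`, where the only non-zero entry of `D` is the one at `(s₁, s₁)`,
`(σ_π²(s₁) + ‖γ V^π‖²) / μ(s₁)` with the semi-norm of the matrix `transCov π θ s₁`. -/
def crucialTerm (s₁ : S) (γ : ℝ) (v : S → Arm → ℝ≥0) (θ : Param S) (μ : S → ℝ)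
    (π : S → Arm → ℝ) : Matrix S S ℝ :=
  (2 : ℝ) • ((1 - γ • transMat π θ)⁻¹ *
    Matrix.single s₁ s₁ (rewardVar π v s₁ / μ s₁ +
      ((γ • value γ π θ) ⬝ᵥ (transCov π θ s₁ *ᵥ (γ • value γ π θ))) / μ s₁) *
    ((1 - γ • transMat π θ)⁻¹)ᵀ)

/-- The matrix `γ ρ^t(s) V^tᵀ - γ ρ^c(s) V^cᵀ`. -/
def crossMat (s₁ : S) (γ : ℝ) (θ : Param S) (s : S) : Matrix S S ℝ :=
  γ • Matrix.vecMulVec (visit γ (piT s₁) θ s) (value γ (piT s₁) θ) -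
    γ • Matrix.vecMulVec (visit γ piC θ s) (value γ piC θ)

/-- The asymptotic covariance matrix `Σ_IS`. -/
def sigmaIS (s₁ : S) (γ : ℝ) (v : S → Arm → ℝ≥0) (θ : Param S) (μ : S → ℝ) : Matrix S S ℝ :=
  crucialTerm s₁ γ v θ μ (piT s₁) + crucialTerm s₁ γ v θ μ piC +
    ∑ s ∈ Finset.univ.filter (fun s => s ≠ s₁),
      (1 / μ s) • (crossMat s₁ γ θ s * transCov piC θ s * (crossMat s₁ γ θ s)ᵀ) +
    ∑ s ∈ Finset.univ.filter (fun s => s ≠ s₁),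
      (rewardVar piC v s / μ s) •
        Matrix.vecMulVec (visit γ (piT s₁) θ s - visit γ piC θ s)
          (visit γ (piT s₁) θ s - visit γ piC θ s)

/-! ### Trajectories -/

/-- A trajectory of length `T`: the states at the times `0, …, T`, and the actions and the rewards
at the times `0, …, T - 1`. -/
abbrev Traj (S : Type*) (T : ℕ) := (Fin (T + 1) → S) × (Fin T → Arm) × (Fin T → ℝ)

/-- The law of the trajectory: the first state has distribution `ν`, the actions follow the policy
`π`, the states follow `P`, and, given the states and the actions, the rewards are independent
Gaussian variables with mean `r(s_i, a_i)` and variance `v(s_i, a_i)`. -/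
def trajLaw [MeasurableSpace S] (π : S → Arm → ℝ) (v : S → Arm → ℝ≥0) (ν : S → ℝ) (T : ℕ)
    (θ : Param S) : Measure (Traj S T) :=
  ∑ s : Fin (T + 1) → S, ∑ a : Fin T → Arm,
    ENNReal.ofReal (ν (s 0) *
      ∏ i : Fin T, π (s i.castSucc) (a i) * θ.1 (s i.castSucc) (a i) (s i.succ)) •
    (Measure.pi fun i : Fin T =>
      gaussianReal (θ.2 (s i.castSucc) (a i)) (v (s i.castSucc) (a i))).map
        (fun y => ((s, a, y) : Traj S T))

/-- The expectation of an estimator of the vector of treatment effects. -/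
def estMean [MeasurableSpace S] {T : ℕ} (L : Measure (Traj S T)) (est : Traj S T → S → ℝ) :
    S → ℝ := fun s => ∫ τ, est τ s ∂L

/-- The covariance matrix of an estimator. -/
def estCov [MeasurableSpace S] {T : ℕ} (L : Measure (Traj S T)) (est : Traj S T → S → ℝ) :
    Matrix S S ℝ := Matrix.of fun s s' => cov[fun τ => est τ s, fun τ => est τ s'; L]

/-- Unbiasedness in the sense of the Cramér-Rao bound, at the parameter `θ`, with the initial
distribution `ν` held fixed: near `θ` the expectation exists and differs from the treatment effect
by `o(‖θ' - θ‖)`, where `θ'` runs through all single-state treatment models. In particular there is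
no bias at `θ` itself. -/
def LocallyUnbiased [MeasurableSpace S] (s₁ : S) (γ : ℝ) (v : S → Arm → ℝ≥0) (ν : S → ℝ) (T : ℕ)
    (θ : Param S) (est : Traj S T → S → ℝ) : Prop :=
  (∀ᶠ θ' in 𝓝[models s₁] θ, ∀ s,
    Integrable (fun τ => est τ s) (trajLaw (piHalf s₁) v ν T θ')) ∧
  (fun θ' => estMean (trajLaw (piHalf s₁) v ν T θ') est - ate s₁ γ θ')
    =o[𝓝[models s₁] θ] (fun θ' => θ' - θ)

/-- Unbiasedness in all single-state treatment models for which the experimental policy is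
uniformly ergodic, where each model is started from its own stationary distribution. -/
def GloballyUnbiased [MeasurableSpace S] (s₁ : S) (γ : ℝ) (v : S → Arm → ℝ≥0) (T : ℕ)
    (est : Traj S T → S → ℝ) : Prop :=
  ∀ θ' ∈ models s₁, ∀ μ' : S → ℝ,
    UniformlyErgodic (transMat (piHalf s₁) θ') μ' → (∀ s, 0 < μ' s) →
    (∀ s, Integrable (fun τ => est τ s) (trajLaw (piHalf s₁) v μ' T θ')) ∧
      estMean (trajLaw (piHalf s₁) v μ' T θ') est = ate s₁ γ θ'

/-! ### The information-sharing estimator -/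

/-- The times whose samples are used for the arm `a`: those spent in a non-crucial state, and those
spent in the crucial state at which the action was `a`. -/
def sharedData (s₁ : S) (a : Arm) {T : ℕ} (τ : Traj S T) : Finset (Fin T) :=
  Finset.univ.filter fun i => τ.1 i.castSucc ≠ s₁ ∨ (τ.1 i.castSucc = s₁ ∧ τ.2.1 i = a)

/-- The number of visits to `s` in the data set of the arm `a`. -/
def visits (s₁ : S) (a : Arm) {T : ℕ} (τ : Traj S T) (s : S) : ℕ :=
  ((sharedData s₁ a τ).filter fun i => τ.1 i.castSucc = s).card

/-- The empirical transition matrix of the data set of the arm `a`. -/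
def empTrans (s₁ : S) (a : Arm) {T : ℕ} (τ : Traj S T) : Matrix S S ℝ := Matrix.of fun s s' =>
  (((sharedData s₁ a τ).filter fun i => τ.1 i.castSucc = s ∧ τ.1 i.succ = s').card : ℝ) /
    ((max (visits s₁ a τ s) 1 : ℕ) : ℝ)

/-- The empirical mean rewards of the data set of the arm `a`. -/
def empReward (s₁ : S) (a : Arm) {T : ℕ} (τ : Traj S T) : S → ℝ := fun s =>
  (∑ i ∈ (sharedData s₁ a τ).filter (fun i => τ.1 i.castSucc = s), τ.2.2 i) /
    ((max (visits s₁ a τ s) 1 : ℕ) : ℝ)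

/-- The plug-in estimator of the value function of the arm `a`. -/
def valueHat (s₁ : S) (γ : ℝ) (a : Arm) {T : ℕ} (τ : Traj S T) : S → ℝ :=
  (1 - γ • empTrans s₁ a τ)⁻¹ *ᵥ empReward s₁ a τ

/-- The information-sharing estimator of the average treatment effect. -/
def ateIS (s₁ : S) (γ : ℝ) {T : ℕ} (τ : Traj S T) : S → ℝ :=
  valueHat s₁ γ Arm.t τ - valueHat s₁ γ Arm.c τ

end Model

end SST

end

/-!
Both parts rest on one function of a transition and its reward. For a vector `u`, the influence
function of `u · Δ` at the sample `(s, a, s', y)` is the sum over the arms `b`, with sign `+` for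
treatment and `-` for control, of
`1{the sample belongs to the data set of b} * (u (I - γ P^b)⁻¹)(s) / (rate of visits to s there)`
times the temporal difference error `y + γ V^b(s') - V^b(s)`. It has conditional mean zero given
`(s, a)`, it has the form `c (y - r(s, a)) + g(s, a, s')` with `c = inflCoef` and `g = inflMean`,
and `dotProduct_sigmaIS` says that its stationary variance is `uᵀ Σ_IS u`.

*Lower bound.* On the path of models `perturb`, which starts at `θ` with the influence function as
its score, the derivative of `u · Δ` is this same variance (`tendsto_ate_perturb`,
`sum_condVar_infl`): the path is least favourable. The Chapman-Robbins inequality along the path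
needs no regularity of the estimator, only the second moment of the likelihood ratio, which is
computed from a power of a transfer matrix (`tendsto_trajRatio_sq`). In the limit it gives
`uᵀ Σ_IS u ≤ T Var(u · est)`, the bound for the estimators that are locally unbiased
(`dotProduct_sigmaIS_le`). The path keeps the zeros of the transition probabilities and the means
of the rewards without noise, so degenerate models need no separate treatment.

Estimators that are unbiased in all ergodic models, each one started from its stationary
distribution, reduce to this case: they exist only if there is a single state, because models that
hardly ever visit the crucial state carry almost no information on the treatment reward
(`GloballyUnbiased.subsingleton`), and with a single state the initial distribution does not depend
on the parameter.

*Attainment.* On the event that all states have been visited, the estimation error is an explicit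
linear function of the sums of temporal difference errors, whose coefficients depend continuously on
the empirical transition frequencies (`valueHat_sub`). Characteristic functions of sums along the
trajectory are powers of perturbed transition matrices, and the Poisson equation turns the
first-order change of their row sums into the limit of these powers (`tendsto_pow_transfer`). This
yields the law of large numbers for the frequencies and the central limit theorem for the sums of
the influence functions; the remainder tends to zero in probability
(`tendstoZeroInProb_remainder`).
-/

set_option linter.unusedSectionVars false

noncomputable section

namespace SST

/-! ### The law of trajectories and transfer matrices -/

instance : MeasurableSingletonClass Arm := ⟨fun _ => trivial⟩

section Trajectories

variable {S : Type*} [Fintype S] [DecidableEq S]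

/-- The probability of the states `s` and the actions `a` of a trajectory. -/
def pathWeight (π : S → Arm → ℝ) (ν : S → ℝ) (θ : Param S) {T : ℕ} (s : Fin (T + 1) → S)
    (a : Fin T → Arm) : ℝ :=
  ν (s 0) * ∏ i : Fin T, π (s i.castSucc) (a i) * θ.1 (s i.castSucc) (a i) (s i.succ)

/-- The law of the rewards given the states `s` and the actions `a` of a trajectory. -/
def rewardLaw (v : S → Arm → ℝ≥0) (θ : Param S) {T : ℕ} (s : Fin (T + 1) → S)
    (a : Fin T → Arm) : Measure (Fin T → ℝ) :=
  Measure.pi fun i : Fin T => gaussianReal (θ.2 (s i.castSucc) (a i)) (v (s i.castSucc) (a i))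

instance (v : S → Arm → ℝ≥0) (θ : Param S) {T : ℕ} (s : Fin (T + 1) → S) (a : Fin T → Arm) :
    IsProbabilityMeasure (rewardLaw v θ s a) := by
  unfold rewardLaw; infer_instance

variable [MeasurableSpace S] [MeasurableSingletonClass S]

lemma measurableEmbedding_path {T : ℕ} (s : Fin (T + 1) → S) (a : Fin T → Arm) :
    MeasurableEmbedding fun y : Fin T → ℝ => ((s, a, y) : Traj S T) :=
  (measurableEmbedding_prodMk_left s).comp (measurableEmbedding_prodMk_left a)

lemma trajLaw_eq (π : S → Arm → ℝ) (v : S → Arm → ℝ≥0) (ν : S → ℝ) (T : ℕ) (θ : Param S) :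
    trajLaw π v ν T θ = ∑ s : Fin (T + 1) → S, ∑ a : Fin T → Arm,
      ENNReal.ofReal (pathWeight π ν θ s a) •
        (rewardLaw v θ s a).map (fun y => ((s, a, y) : Traj S T)) := rfl

lemma integrable_trajLaw_iff {E : Type*} [NormedAddCommGroup E] {π : S → Arm → ℝ}
    {v : S → Arm → ℝ≥0} {ν : S → ℝ} {T : ℕ} {θ : Param S} {f : Traj S T → E} :
    Integrable f (trajLaw π v ν T θ) ↔
      ∀ s a, 0 < pathWeight π ν θ s a → Integrable (fun y => f (s, a, y)) (rewardLaw v θ s a) := by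
  rw [trajLaw_eq]
  simp only [integrable_finsetSum_measure, Finset.mem_univ, true_imp_iff]
  refine forall_congr' fun s => forall_congr' fun a => ?_
  rcases le_or_gt (pathWeight π ν θ s a) 0 with h | h
  · simp [ENNReal.ofReal_of_nonpos h, not_lt.2 h]
  · rw [integrable_smul_measure (by simpa using h) ENNReal.ofReal_ne_top,
      (measurableEmbedding_path s a).integrable_map_iff]
    simp [h, Function.comp_def]

/-- Integration over trajectories: sum over the states and actions, integrate over the rewards. -/
lemma integral_trajLaw {E : Type*} [NormedAddCommGroup E] [NormedSpace ℝ E] {π : S → Arm → ℝ}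
    {v : S → Arm → ℝ≥0} {ν : S → ℝ} {T : ℕ} {θ : Param S} {f : Traj S T → E}
    (hw : ∀ (s : Fin (T + 1) → S) a, 0 ≤ pathWeight π ν θ s a)
    (hf : Integrable f (trajLaw π v ν T θ)) :
    ∫ τ, f τ ∂(trajLaw π v ν T θ) =
      ∑ s, ∑ a, pathWeight π ν θ s a • ∫ y, f (s, a, y) ∂(rewardLaw v θ s a) := by
  rw [trajLaw_eq] at hf ⊢
  simp only [integrable_finsetSum_measure, Finset.mem_univ, true_imp_iff] at hf
  rw [integral_finsetSum_measure (fun s _ => integrable_finsetSum_measure.2 fun a _ => hf s a)]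
  refine Finset.sum_congr rfl fun s _ => ?_
  rw [integral_finsetSum_measure (fun a _ => hf s a)]
  refine Finset.sum_congr rfl fun a _ => ?_
  rw [integral_smul_measure, ENNReal.toReal_ofReal (hw s a),
    (measurableEmbedding_path s a).integral_map]

end Trajectories

section Transfer

variable {S : Type*} [Fintype S] [DecidableEq S]

/-- Summing the products of matrix entries along all paths gives a power of the matrix. -/
lemma sum_path_prod {R : Type*} [CommRing R] (A : Matrix S S R) (T : ℕ) (ν : S → R) :
    ∑ s : Fin (T + 1) → S, ν (s 0) * ∏ i : Fin T, A (s i.castSucc) (s i.succ) =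
      ν ⬝ᵥ ((A ^ T) *ᵥ 1) := by
  induction T generalizing ν with
  | zero =>
    simp only [Finset.univ_eq_empty, Finset.prod_empty, mul_one, pow_zero, one_mulVec,
      dotProduct_one]
    exact Fintype.sum_equiv (Equiv.funUnique (Fin 1) S) _ _ fun s => rfl
  | succ T ih =>
    rw [← (Fin.consEquiv fun _ => S).sum_comp, Fintype.sum_prod_type, Finset.sum_comm]
    have h : ∀ s : Fin (T + 1) → S, ∑ x, ν ((Fin.consEquiv fun _ => S) (x, s) 0) *
        ∏ i : Fin (T + 1), A ((Fin.consEquiv fun _ => S) (x, s) i.castSucc)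
          ((Fin.consEquiv fun _ => S) (x, s) i.succ) =
        (ν ᵥ* A) (s 0) * ∏ i : Fin T, A (s i.castSucc) (s i.succ) := by
      intro s
      rw [Matrix.vecMul, dotProduct, Finset.sum_mul]
      refine Finset.sum_congr rfl fun x _ => ?_
      rw [Fin.prod_univ_succ]
      simp [Fin.consEquiv, mul_assoc]
    rw [Finset.sum_congr rfl fun s _ => h s, ih, pow_succ', ← dotProduct_mulVec, mulVec_mulVec]

/-- The transfer matrix of a function `φ` of a transition and its reward: the entry at `(s, s')`
is the expectation of `φ` on the event that the next state is `s'`, given the state `s`. -/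
def transferMat {𝕜 : Type*} [RCLike 𝕜] (π : S → Arm → ℝ) (v : S → Arm → ℝ≥0) (θ : Param S)
    (φ : S → Arm → S → ℝ → 𝕜) : Matrix S S 𝕜 :=
  Matrix.of fun s s' => ∑ a, ((π s a * θ.1 s a s' : ℝ) : 𝕜) *
    ∫ y, φ s a s' y ∂(gaussianReal (θ.2 s a) (v s a))

variable [MeasurableSpace S] [MeasurableSingletonClass S]

lemma integrable_prod_trajLaw {𝕜 : Type*} [RCLike 𝕜] {π : S → Arm → ℝ} {v : S → Arm → ℝ≥0}
    {ν : S → ℝ} {T : ℕ} {θ : Param S} {φ : S → Arm → S → ℝ → 𝕜}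
    (hφ : ∀ s a s', Integrable (φ s a s') (gaussianReal (θ.2 s a) (v s a))) :
    Integrable (fun τ : Traj S T => ∏ i : Fin T,
      φ (τ.1 i.castSucc) (τ.2.1 i) (τ.1 i.succ) (τ.2.2 i)) (trajLaw π v ν T θ) :=
  integrable_trajLaw_iff.2 fun s a _ =>
    Integrable.fintype_prod (f := fun i => φ (s i.castSucc) (a i) (s i.succ)) fun _ => hφ _ _ _

/-- The expectation of a product over the time steps is given by powers of the transfer matrix. -/
lemma integral_prod_trajLaw {𝕜 : Type*} [RCLike 𝕜] {π : S → Arm → ℝ} {v : S → Arm → ℝ≥0}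
    {ν : S → ℝ} {T : ℕ} {θ : Param S} {φ : S → Arm → S → ℝ → 𝕜}
    (hw : ∀ (s : Fin (T + 1) → S) a, 0 ≤ pathWeight π ν θ s a)
    (hφ : ∀ s a s', Integrable (φ s a s') (gaussianReal (θ.2 s a) (v s a))) :
    ∫ τ, ∏ i : Fin T, φ (τ.1 i.castSucc) (τ.2.1 i) (τ.1 i.succ) (τ.2.2 i) ∂(trajLaw π v ν T θ) =
      (fun s => (ν s : 𝕜)) ⬝ᵥ ((transferMat π v θ φ ^ T) *ᵥ 1) := by
  rw [integral_trajLaw hw (integrable_prod_trajLaw hφ), ← sum_path_prod]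
  refine Finset.sum_congr rfl fun s _ => ?_
  have h1 : ∀ a : Fin T → Arm, ∫ y, ∏ i : Fin T, φ (s i.castSucc) (a i) (s i.succ) (y i)
      ∂(rewardLaw v θ s a) = ∏ i : Fin T, ∫ y, φ (s i.castSucc) (a i) (s i.succ) y
        ∂(gaussianReal (θ.2 (s i.castSucc) (a i)) (v (s i.castSucc) (a i))) := fun a =>
    integral_fintype_prod_eq_prod (𝕜 := 𝕜)
      fun (i : Fin T) => φ (s i.castSucc) (a i) (s i.succ)
  simp only [h1, transferMat, Matrix.of_apply]
  rw [Finset.prod_univ_sum, Finset.mul_sum, Fintype.piFinset_univ]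
  refine Finset.sum_congr rfl fun a _ => ?_
  rw [Finset.prod_mul_distrib, RCLike.real_smul_eq_coe_mul, pathWeight]
  push_cast
  ring

end Transfer

section Models

variable {S : Type*} [Fintype S] [DecidableEq S]

lemma piHalf_nonneg (s₁ s : S) (a : Arm) : 0 ≤ piHalf s₁ s a := by
  unfold piHalf piT piC; split_ifs <;> norm_num

lemma available_of_piHalf_ne_zero {s₁ s : S} {a : Arm} (h : piHalf s₁ s a ≠ 0) :
    Available s₁ s a := by
  cases a <;> by_cases hs : s = s₁ <;> simp_all [piHalf, piT, piC, Available]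

lemma piHalf_ne_zero_of_available {s₁ s : S} {a : Arm} (h : Available s₁ s a) :
    piHalf s₁ s a ≠ 0 := by
  rcases h with rfl | rfl
  · by_cases hs : s = s₁ <;> simp [piHalf, piT, piC, hs]
  · cases a <;> simp [piHalf, piT, piC]

lemma sum_arm {R : Type*} [AddCommMonoid R] (f : Arm → R) : ∑ a, f a = f Arm.c + f Arm.t := by
  rw [show (Finset.univ : Finset Arm) = {Arm.c, Arm.t} from rfl, Finset.sum_pair (by simp)]

lemma sum_piHalf (s₁ s : S) : ∑ a, piHalf s₁ s a = 1 := by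
  rw [sum_arm]
  by_cases hs : s = s₁ <;> simp [piHalf, piT, piC, hs] <;> norm_num

lemma pathWeight_nonneg {s₁ : S} {θ : Param S} (hθ : θ ∈ models s₁) {ν : S → ℝ}
    (hν : ∀ s, 0 ≤ ν s) {T : ℕ} (s : Fin (T + 1) → S) (a : Fin T → Arm) :
    0 ≤ pathWeight (piHalf s₁) ν θ s a := by
  refine mul_nonneg (hν _) (Finset.prod_nonneg fun i _ => ?_)
  by_cases h : piHalf s₁ (s i.castSucc) (a i) = 0
  · simp [h]
  · exact mul_nonneg (piHalf_nonneg _ _ _) ((hθ _ _ (available_of_piHalf_ne_zero h)).1 _)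

/-- The policy of an arm. -/
def armPolicy (s₁ : S) : Arm → S → Arm → ℝ
  | Arm.c => piC
  | Arm.t => piT s₁

/-- A policy that plays available actions only. -/
structure IsPolicy (s₁ : S) (π : S → Arm → ℝ) : Prop where
  nonneg : ∀ s a, 0 ≤ π s a
  sum_eq_one : ∀ s, ∑ a, π s a = 1
  available : ∀ s a, π s a ≠ 0 → Available s₁ s a

lemma isPolicy_piHalf (s₁ : S) : IsPolicy s₁ (piHalf s₁) :=
  ⟨piHalf_nonneg s₁, sum_piHalf s₁, fun _ _ => available_of_piHalf_ne_zero⟩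

lemma isPolicy_armPolicy (s₁ : S) (b : Arm) : IsPolicy s₁ (armPolicy s₁ b) := by
  refine ⟨fun s a => ?_, fun s => ?_, fun s a h => ?_⟩
  · cases b <;> simp only [armPolicy, piT, piC] <;> split_ifs <;> norm_num
  · rw [sum_arm]
    cases b <;> by_cases hs : s = s₁ <;> simp [armPolicy, piT, piC, hs]
  · cases b <;> cases a <;> by_cases hs : s = s₁ <;> simp_all [armPolicy, piT, piC, Available]

lemma transMat_nonneg {s₁ : S} {θ : Param S} (hθ : θ ∈ models s₁) {π : S → Arm → ℝ}
    (hπ : IsPolicy s₁ π) (s s' : S) : 0 ≤ transMat π θ s s' := by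
  rw [transMat, Matrix.of_apply]
  refine Finset.sum_nonneg fun a _ => ?_
  by_cases h : π s a = 0
  · simp [h]
  · exact mul_nonneg (hπ.nonneg _ _) ((hθ _ _ (hπ.available _ _ h)).1 _)

lemma sum_transMat {s₁ : S} {θ : Param S} (hθ : θ ∈ models s₁) {π : S → Arm → ℝ}
    (hπ : IsPolicy s₁ π) (s : S) : ∑ s', transMat π θ s s' = 1 := by
  simp only [transMat, Matrix.of_apply]
  rw [Finset.sum_comm, ← hπ.sum_eq_one s]
  refine Finset.sum_congr rfl fun a _ => ?_
  rw [← Finset.mul_sum]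
  by_cases h : π s a = 0
  · simp [h]
  · rw [(hθ _ _ (hπ.available _ _ h)).2, mul_one]

lemma transMat_mulVec_one {s₁ : S} {θ : Param S} (hθ : θ ∈ models s₁) {π : S → Arm → ℝ}
    (hπ : IsPolicy s₁ π) : transMat π θ *ᵥ 1 = 1 := by
  ext s; simp [mulVec, dotProduct, sum_transMat hθ hπ]

lemma pow_mulVec_one {R : Type*} [CommRing R] {P : Matrix S S R} (h : P *ᵥ 1 = 1) (k : ℕ) :
    (P ^ k) *ᵥ 1 = 1 := by
  induction k with
  | zero => simp
  | succ k ih => rw [pow_succ, ← mulVec_mulVec, h, ih]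

variable [MeasurableSpace S] [MeasurableSingletonClass S]

lemma isProbabilityMeasure_trajLaw {s₁ : S} {θ : Param S} (hθ : θ ∈ models s₁)
    (v : S → Arm → ℝ≥0) {ν : S → ℝ} (hν : ∀ s, 0 ≤ ν s) (hν1 : ∑ s, ν s = 1) (T : ℕ) :
    IsProbabilityMeasure (trajLaw (piHalf s₁) v ν T θ) := by
  have hw := pathWeight_nonneg hθ hν (T := T)
  have h := integral_prod_trajLaw (v := v) (φ := fun _ _ _ _ => (1 : ℝ)) hw (by simp)
  have hA : transferMat (piHalf s₁) v θ (fun _ _ _ _ => (1 : ℝ)) = transMat (piHalf s₁) θ := by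
    ext s s'; simp [transferMat, transMat]
  rw [hA, pow_mulVec_one (transMat_mulVec_one hθ (isPolicy_piHalf s₁))] at h
  simp only [Finset.prod_const_one, integral_const, smul_eq_mul, mul_one, dotProduct_one,
    RCLike.ofReal_real_eq_id, id, hν1] at h
  refine ⟨?_⟩
  rw [Measure.real, ENNReal.toReal_eq_one_iff] at h
  exact h

end Models

/-! ### Resolvents, the Poisson equation and powers of perturbed matrices -/

section Resolvent

variable {S : Type*} [Fintype S] [DecidableEq S]

/-- The resolvent of a discounted substochastic matrix exists. -/
lemma isUnit_one_sub_smul {γ : ℝ} (hγ₀ : 0 ≤ γ) (hγ₁ : γ < 1) {P : Matrix S S ℝ}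
    (h0 : ∀ s s', 0 ≤ P s s') (h1 : ∀ s, ∑ s', P s s' ≤ 1) :
    IsUnit (1 - γ • P).det := by
  rw [isUnit_iff_ne_zero]
  refine det_ne_zero_of_sum_row_lt_diag fun k => ?_
  have hk : P k k ≤ 1 := (Finset.single_le_sum (fun i _ => h0 k i) (Finset.mem_univ k)).trans (h1 k)
  have hd : 0 < 1 - γ * P k k := by nlinarith [h0 k k]
  have hs : ∑ j ∈ Finset.univ.erase k, ‖(1 - γ • P) k j‖ =
      γ * ∑ j ∈ Finset.univ.erase k, P k j := by
    rw [Finset.mul_sum]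
    refine Finset.sum_congr rfl fun j hj => ?_
    rw [Matrix.sub_apply, Matrix.smul_apply, Matrix.one_apply_ne (Finset.ne_of_mem_erase hj).symm,
      zero_sub, norm_neg, smul_eq_mul, Real.norm_of_nonneg (mul_nonneg hγ₀ (h0 _ _))]
  rw [hs, Matrix.sub_apply, Matrix.smul_apply, Matrix.one_apply_eq, smul_eq_mul,
    Real.norm_of_nonneg hd.le]
  have := h1 k
  rw [← Finset.add_sum_erase _ _ (Finset.mem_univ k)] at this
  nlinarith

open scoped Matrix.Norms.Operator in
/-- The Neumann series of the resolvent. -/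
lemma hasSum_resolvent {γ : ℝ} (hγ₀ : 0 ≤ γ) (hγ₁ : γ < 1) {P : Matrix S S ℝ}
    (h0 : ∀ s s', 0 ≤ P s s') (h1 : ∀ s, ∑ s', P s s' ≤ 1) :
    HasSum (fun i : ℕ => γ ^ i • P ^ i) (1 - γ • P)⁻¹ := by
  have hn : ‖γ • P‖ < 1 := by
    refine lt_of_le_of_lt ?_ hγ₁
    rw [norm_smul, Real.norm_of_nonneg hγ₀]
    refine mul_le_of_le_one_right hγ₀ ?_
    rw [linfty_opNorm_def, ← NNReal.coe_one, NNReal.coe_le_coe]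
    refine Finset.sup_le fun i _ => ?_
    rw [← NNReal.coe_le_coe]
    push_cast
    simpa only [coe_nnnorm, Real.norm_of_nonneg (h0 _ _)] using h1 i
  have := hasSum_geom_series_inverse (γ • P) hn
  rw [← Matrix.nonsing_inv_eq_ringInverse] at this
  simp only [smul_pow] at this
  exact this

end Resolvent

section Value

variable {S : Type*} [Fintype S] [DecidableEq S] {s₁ : S} {γ : ℝ} (hγ₀ : 0 ≤ γ) (hγ₁ : γ < 1)
  {θ : Param S} (hθ : θ ∈ models s₁) {π : S → Arm → ℝ} (hπ : IsPolicy s₁ π)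

include hγ₀ hγ₁ hθ hπ

lemma isUnit_resolvent : IsUnit (1 - γ • transMat π θ).det :=
  isUnit_one_sub_smul hγ₀ hγ₁ (transMat_nonneg hθ hπ) fun s => (sum_transMat hθ hπ s).le

lemma value_hasSum (s : S) :
    HasSum (fun i : ℕ => γ ^ i * ((transMat π θ ^ i) *ᵥ meanReward π θ) s)
      (((1 - γ • transMat π θ)⁻¹ *ᵥ meanReward π θ) s) := by
  have h := hasSum_resolvent hγ₀ hγ₁ (transMat_nonneg hθ hπ) fun s => (sum_transMat hθ hπ s).le
  simp only [mulVec, dotProduct, Finset.mul_sum]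
  refine hasSum_sum fun s' _ => ?_
  have h2 : HasSum (fun i : ℕ => (γ ^ i • transMat π θ ^ i) s s') ((1 - γ • transMat π θ)⁻¹ s s') :=
    Pi.hasSum.1 (Pi.hasSum.1 h s) s'
  simpa [mul_assoc] using h2.mul_right (meanReward π θ s')

lemma value_eq : value γ π θ = (1 - γ • transMat π θ)⁻¹ *ᵥ meanReward π θ := by
  ext s; exact (value_hasSum hγ₀ hγ₁ hθ hπ s).tsum_eq

lemma visit_eq (s s' : S) : visit γ π θ s s' = (1 - γ • transMat π θ)⁻¹ s' s := by
  have h := hasSum_resolvent hγ₀ hγ₁ (transMat_nonneg hθ hπ) fun s => (sum_transMat hθ hπ s).le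
  exact (Pi.hasSum.1 (Pi.hasSum.1 h s') s).tsum_eq

/-- The Bellman equation. -/
lemma bellman : value γ π θ = meanReward π θ + γ • (transMat π θ *ᵥ value γ π θ) := by
  have h : (1 - γ • transMat π θ) *ᵥ value γ π θ = meanReward π θ := by
    rw [value_eq hγ₀ hγ₁ hθ hπ, mulVec_mulVec,
      Matrix.mul_nonsing_inv _ (isUnit_resolvent hγ₀ hγ₁ hθ hπ), one_mulVec]
  rw [sub_mulVec, one_mulVec, smul_mulVec] at h
  rw [← h]; abel

end Value

section Limits

variable {S : Type*} [Fintype S] [DecidableEq S]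

/-- A matrix whose rows have `ℓ¹` norm at most one does not increase the supremum norm. -/
lemma norm_mulVec_le {A : Matrix S S ℂ} (hA : ∀ s, ∑ s', ‖A s s'‖ ≤ 1) (x : S → ℂ) :
    ‖A *ᵥ x‖ ≤ ‖x‖ := by
  refine (pi_norm_le_iff_of_nonneg (norm_nonneg x)).2 fun s => ?_
  calc ‖∑ s', A s s' * x s'‖ ≤ ∑ s', ‖A s s'‖ * ‖x‖ := by
        refine (norm_sum_le _ _).trans (Finset.sum_le_sum fun s' _ => ?_)
        rw [norm_mul]
        exact mul_le_mul_of_nonneg_left (norm_le_pi_norm x s') (norm_nonneg _)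
    _ = (∑ s', ‖A s s'‖) * ‖x‖ := by rw [Finset.sum_mul]
    _ ≤ 1 * ‖x‖ := mul_le_mul_of_nonneg_right (hA s) (norm_nonneg x)
    _ = ‖x‖ := one_mul _

lemma norm_pow_mulVec_le {A : Matrix S S ℂ} (hA : ∀ s, ∑ s', ‖A s s'‖ ≤ 1) (k : ℕ) (x : S → ℂ) :
    ‖(A ^ k) *ᵥ x‖ ≤ ‖x‖ := by
  induction k with
  | zero => simp
  | succ k ih =>
    rw [pow_succ', ← mulVec_mulVec]
    exact (norm_mulVec_le hA _).trans ih

/-- The Poisson equation of an ergodic chain: a vector with mean zero under the stationary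
distribution is of the form `h - P h`. -/
lemma exists_poisson {P : Matrix S S ℝ} {μ : S → ℝ} (hμ1 : ∑ s, μ s = 1)
    (hμP : μ ᵥ* P = μ)
    (hlim : ∀ s s', Tendsto (fun k => (P ^ k) s s') atTop (𝓝 (μ s'))) (b : S → ℝ) :
    ∃ h : S → ℝ, b = (fun _ => μ ⬝ᵥ b) + h - P *ᵥ h := by
  -- `1 - P + 1 μᵀ` is injective, hence surjective.
  set B : Matrix S S ℝ := 1 - P + Matrix.vecMulVec 1 μ with hB
  have hBx : ∀ x, B *ᵥ x = x - P *ᵥ x + fun _ => μ ⬝ᵥ x := by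
    intro x
    rw [hB, add_mulVec, sub_mulVec, one_mulVec, vecMulVec_mulVec]
    ext s; simp
  have hμB : ∀ x, μ ⬝ᵥ (B *ᵥ x) = μ ⬝ᵥ x := by
    intro x
    rw [hBx, dotProduct_add, dotProduct_sub, dotProduct_mulVec, hμP, sub_self, zero_add]
    simp [dotProduct, ← Finset.sum_mul, hμ1]
  have hinj : Function.Injective B.mulVec := by
    refine (injective_iff_map_eq_zero B.mulVecLin).2 fun x hx => ?_
    rw [mulVecLin_apply] at hx
    have h0 : μ ⬝ᵥ x = 0 := by rw [← hμB, hx, dotProduct_zero]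
    have hPx : P *ᵥ x = x := by
      rw [hBx, h0] at hx
      ext s; have := congrFun hx s; simp at this; linarith
    have hk : ∀ k, (P ^ k) *ᵥ x = x := by
      intro k
      induction k with
      | zero => simp
      | succ k ih => rw [pow_succ, ← mulVec_mulVec, hPx, ih]
    ext s
    have hl : Tendsto (fun k => ((P ^ k) *ᵥ x) s) atTop (𝓝 (μ ⬝ᵥ x)) :=
      tendsto_finsetSum _ fun s' _ => (hlim s s').mul_const _
    simp only [hk, h0] at hl
    exact tendsto_nhds_unique tendsto_const_nhds hl
  obtain ⟨h, hh⟩ := LinearMap.surjective_of_injective (f := B.mulVecLin) hinj b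
  rw [mulVecLin_apply] at hh
  refine ⟨h, ?_⟩
  rw [← hh, hμB, hBx]
  ext s; simp; ring

lemma exists_poisson_complex {P : Matrix S S ℝ} {μ : S → ℝ}
    (hμ1 : ∑ s, μ s = 1) (hμP : μ ᵥ* P = μ)
    (hlim : ∀ s s', Tendsto (fun k => (P ^ k) s s') atTop (𝓝 (μ s'))) (b : S → ℂ) :
    ∃ h : S → ℂ, ∀ s, b s = (∑ s', μ s' * b s') + h s - ∑ s', P s s' * h s' := by
  obtain ⟨x, hx⟩ := exists_poisson hμ1 hμP hlim fun s => (b s).re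
  obtain ⟨y, hy⟩ := exists_poisson hμ1 hμP hlim fun s => (b s).im
  refine ⟨fun s => ⟨x s, y s⟩, fun s => Complex.ext ?_ ?_⟩
  · simpa [mulVec, dotProduct] using congrFun hx s
  · simpa [mulVec, dotProduct] using congrFun hy s

/-- The perturbation argument behind the limit theorems for ergodic chains: if the matrices `A n`
are contractions that converge to the transition matrix `P`, and `n (A n 1 - 1) → b`, then
`μᵀ (A n) ^ n 1 → exp (μ b)`. With a solution `h` of the Poisson equation for `b - μ b`, the
vector `1 + h / n` is an eigenvector of `A n` with the eigenvalue `1 + μ b / n`, up to an error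
that is `o(1 / n)`. -/
lemma tendsto_pow_transfer {P : Matrix S S ℝ} {μ : S → ℝ}
    (hμ1 : ∑ s, μ s = 1) (hμP : μ ᵥ* P = μ)
    (hlim : ∀ s s', Tendsto (fun k => (P ^ k) s s') atTop (𝓝 (μ s')))
    {A : ℕ → Matrix S S ℂ} (hA : ∀ n s, ∑ s', ‖A n s s'‖ ≤ 1)
    (hAP : ∀ s s', Tendsto (fun n => A n s s') atTop (𝓝 (P s s' : ℂ))) {b : S → ℂ}
    (hb : ∀ s, Tendsto (fun n : ℕ => (n : ℂ) * (∑ s', A n s s' - 1)) atTop (𝓝 (b s))) :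
    Tendsto (fun n : ℕ => (fun s => (μ s : ℂ)) ⬝ᵥ ((A n ^ n) *ᵥ 1)) atTop
      (𝓝 (Complex.exp (∑ s, μ s * b s))) := by
  obtain ⟨h, hh⟩ := exists_poisson_complex hμ1 hμP hlim b
  set m : ℂ := ∑ s, μ s * b s with hm
  set f : ℕ → S → ℂ := fun n s => 1 + h s / n with hf
  set lam : ℕ → ℂ := fun n => 1 + m / n with hlam
  -- the defect of the approximate eigenvector, multiplied by `n`
  have hdef : Tendsto (fun n : ℕ => ‖(n : ℂ) • (A n *ᵥ f n - lam n • f n)‖) atTop (𝓝 0) := by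
    rw [← norm_zero (E := S → ℂ)]
    refine Tendsto.norm (tendsto_pi_nhds.2 fun s => ?_)
    have hinv : Tendsto (fun n : ℕ => (n : ℂ)⁻¹) atTop (𝓝 0) := by
      simpa using tendsto_inv_atTop_nhds_zero_nat (𝕜 := ℂ)
    have h1 : Tendsto (fun n : ℕ => (n : ℂ) * (∑ s', A n s s' - 1) + ∑ s', A n s s' * h s' -
        h s - m - m * h s * (n : ℂ)⁻¹) atTop
        (𝓝 (b s + ∑ s', (P s s' : ℂ) * h s' - h s - m - m * h s * 0)) :=
      ((((hb s).add (tendsto_finsetSum _ fun s' _ => (hAP s s').mul_const _)).sub_const _).sub_const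
        _).sub (hinv.const_mul _)
    have h0 : b s + ∑ s', (P s s' : ℂ) * h s' - h s - m - m * h s * 0 = 0 := by rw [hh s]; ring
    rw [h0] at h1
    refine h1.congr' ?_
    filter_upwards [eventually_ne_atTop 0] with n hn
    have hn' : (n : ℂ) ≠ 0 := Nat.cast_ne_zero.2 hn
    simp only [Pi.smul_apply, Pi.sub_apply, smul_eq_mul, mulVec, dotProduct, hf, hlam, mul_add,
      mul_one, Finset.sum_add_distrib]
    have h2 : ∑ x, A n s x * (h x / n) = (∑ x, A n s x * h x) / n := by
      rw [Finset.sum_div]; exact Finset.sum_congr rfl fun x _ => by ring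
    rw [h2]
    field_simp
    ring
  have hlamk : ∀ n k : ℕ, k ≤ n → ‖lam n ^ k‖ ≤ Real.exp ‖m‖ := by
    intro n k hk
    have h1 : ‖lam n‖ ≤ 1 + ‖m‖ / n := by
      refine (norm_add_le _ _).trans ?_
      simp
    rcases Nat.eq_zero_or_pos n with rfl | hn
    · obtain rfl : k = 0 := by omega
      simp
    have hn' : (0 : ℝ) < n := Nat.cast_pos.2 hn
    calc ‖lam n ^ k‖ ≤ (1 + ‖m‖ / n) ^ k := by
          rw [norm_pow]; exact pow_le_pow_left₀ (norm_nonneg _) h1 k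
      _ ≤ (1 + ‖m‖ / n) ^ n := pow_le_pow_right₀ (by have := norm_nonneg m; simp; positivity) hk
      _ ≤ (Real.exp (‖m‖ / n)) ^ n := by
          refine pow_le_pow_left₀ (by positivity) ?_ n
          linarith [Real.add_one_le_exp (‖m‖ / n)]
      _ = Real.exp ‖m‖ := by rw [← Real.exp_nat_mul, mul_div_cancel₀ _ hn'.ne']
  have htel : ∀ n k : ℕ, k ≤ n → ‖(A n ^ k) *ᵥ f n - lam n ^ k • f n‖ ≤
      k * (Real.exp ‖m‖ * ‖A n *ᵥ f n - lam n • f n‖) := by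
    intro n k
    induction k with
    | zero => simp
    | succ k ih =>
      intro hk
      have e : (A n ^ (k + 1)) *ᵥ f n - lam n ^ (k + 1) • f n =
          A n *ᵥ ((A n ^ k) *ᵥ f n - lam n ^ k • f n) +
            lam n ^ k • (A n *ᵥ f n - lam n • f n) := by
        rw [pow_succ', ← mulVec_mulVec, mulVec_sub, mulVec_smul, smul_sub, smul_smul, ← pow_succ]
        abel
      rw [e]
      refine (norm_add_le _ _).trans ?_
      rw [norm_smul]
      have h1 := (norm_mulVec_le (hA n) ((A n ^ k) *ᵥ f n - lam n ^ k • f n)).trans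
        (ih (by omega))
      have h2 := mul_le_mul_of_nonneg_right (hlamk n k (by omega))
        (norm_nonneg (A n *ᵥ f n - lam n • f n))
      push_cast
      linarith
  have hf1 : Tendsto (fun n => f n - 1) atTop (𝓝 0) := by
    refine tendsto_pi_nhds.2 fun s => ?_
    have : Tendsto (fun n : ℕ => h s * (n : ℂ)⁻¹) atTop (𝓝 (h s * 0)) :=
      (by simpa using tendsto_inv_atTop_nhds_zero_nat (𝕜 := ℂ) :
        Tendsto (fun n : ℕ => (n : ℂ)⁻¹) atTop (𝓝 0)).const_mul _
    simpa [hf, div_eq_mul_inv] using this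
  have hpow : Tendsto (fun n => lam n ^ n) atTop (𝓝 (Complex.exp m)) := by
    simpa [hlam] using Complex.tendsto_one_add_div_pow_exp m
  have hmain : Tendsto (fun n => (A n ^ n) *ᵥ (1 : S → ℂ)) atTop (𝓝 (Complex.exp m • 1)) := by
    have h1 : Tendsto (fun n => (A n ^ n) *ᵥ f n - lam n ^ n • f n) atTop (𝓝 0) := by
      refine squeeze_zero_norm (a := fun n : ℕ =>
        Real.exp ‖m‖ * ‖(n : ℂ) • (A n *ᵥ f n - lam n • f n)‖) (fun n => ?_) ?_
      · refine (htel n n le_rfl).trans (le_of_eq ?_)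
        rw [norm_smul]; simp; ring
      · simpa using hdef.const_mul (Real.exp ‖m‖)
    have h2 : Tendsto (fun n => (A n ^ n) *ᵥ (f n - 1)) atTop (𝓝 0) :=
      squeeze_zero_norm (fun n => norm_pow_mulVec_le (hA n) n _) (by simpa using hf1.norm)
    have h3 : Tendsto (fun n => lam n ^ n • (f n - 1 + 1)) atTop (𝓝 (Complex.exp m • (0 + 1))) :=
      hpow.smul (hf1.add_const 1)
    have h4 := (h1.add h3).sub h2
    simp only [zero_add, sub_zero] at h4
    refine h4.congr fun n => ?_
    rw [mulVec_sub]
    simp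
  have h5 : Tendsto (fun n => (fun s => (μ s : ℂ)) ⬝ᵥ ((A n ^ n) *ᵥ 1)) atTop
      (𝓝 ((fun s => (μ s : ℂ)) ⬝ᵥ (Complex.exp m • 1))) :=
    tendsto_finsetSum _ fun s _ => ((tendsto_pi_nhds.1 hmain) s).const_mul _
  have h6 : (fun s => (μ s : ℂ)) ⬝ᵥ (Complex.exp m • (1 : S → ℂ)) = Complex.exp m := by
    have : (∑ s, (μ s : ℂ)) = 1 := by exact_mod_cast hμ1
    simp [dotProduct, ← Finset.sum_mul, this]
  rwa [h6] at h5

/-- The second-order expansion of `μᵀ (A ε) ^ T 1` for perturbations `A ε` of a transition matrix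
with stationary distribution `μ`. -/
lemma tendsto_pow_second_order {P : Matrix S S ℝ} {μ : S → ℝ} (hμ1 : ∑ s, μ s = 1)
    (hμP : μ ᵥ* P = μ) {A : ℝ → Matrix S S ℝ} {l : Filter ℝ}
    (hAP : ∀ s s', Tendsto (fun ε => A ε s s') l (𝓝 (P s s'))) {q : S → ℝ}
    (hq : ∀ s, Tendsto (fun ε : ℝ => (∑ s', A ε s s' - 1) / ε ^ 2) l (𝓝 (q s))) (T : ℕ) :
    Tendsto (fun ε : ℝ => (μ ⬝ᵥ ((A ε ^ T) *ᵥ 1) - 1) / ε ^ 2) l (𝓝 (T * (μ ⬝ᵥ q))) := by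
  have key : ∃ w : S → ℝ, μ ⬝ᵥ w = T * (μ ⬝ᵥ q) ∧
      ∀ s, Tendsto (fun ε : ℝ => (((A ε ^ T) *ᵥ 1) s - 1) / ε ^ 2) l (𝓝 (w s)) := by
    induction T with
    | zero => exact ⟨0, by simp, fun s => by simpa using tendsto_const_nhds⟩
    | succ T ih =>
      obtain ⟨w, hw, hlim⟩ := ih
      refine ⟨P *ᵥ w + q, ?_, fun s => ?_⟩
      · rw [dotProduct_add, dotProduct_mulVec, hμP, hw]; push_cast; ring
      · have h1 : Tendsto (fun ε => ∑ s', A ε s s' * ((((A ε ^ T) *ᵥ 1) s' - 1) / ε ^ 2) +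
            (∑ s', A ε s s' - 1) / ε ^ 2) l (𝓝 ((P *ᵥ w + q) s)) :=
          (tendsto_finsetSum _ fun s' _ => (hAP s s').mul (hlim s')).add (hq s)
        refine h1.congr fun ε => ?_
        rw [pow_succ' (A ε), ← mulVec_mulVec, mulVec, dotProduct]
        simp only [← mul_div_assoc, ← Finset.sum_div, mul_sub, mul_one, Finset.sum_sub_distrib]
        ring
  obtain ⟨w, hw, hlim⟩ := key
  rw [← hw]
  have h1 : Tendsto (fun ε => ∑ s, μ s * ((((A ε ^ T) *ᵥ 1) s - 1) / ε ^ 2)) l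
      (𝓝 (μ ⬝ᵥ w)) := tendsto_finsetSum _ fun s _ => (hlim s).const_mul _
  refine h1.congr fun ε => ?_
  simp only [← mul_div_assoc, ← Finset.sum_div, mul_sub, mul_one, Finset.sum_sub_distrib, hμ1]
  rfl

end Limits

/-! ### The influence function and its variance -/

section Influence

variable {S : Type*} [Fintype S] [DecidableEq S]

/-- The sign of an arm in the treatment effect. -/
def armSign : Arm → ℝ
  | Arm.c => -1
  | Arm.t => 1

/-- The action of an arm in each state. -/
def armAct (s₁ : S) (b : Arm) (s : S) : Arm := if s = s₁ then b else Arm.c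

/-- The indicator of the state-action pairs that enter the data set of the arm `b`. -/
def share (s₁ : S) (b : Arm) (s : S) (a : Arm) : ℝ :=
  if s ≠ s₁ ∨ (s = s₁ ∧ a = b) then 1 else 0

/-- The long-run frequency of the samples from the state `s` in the data set of an arm. It is the
same for both arms. -/
def freq (s₁ : S) (μ : S → ℝ) (s : S) : ℝ := if s = s₁ then μ s / 2 else μ s

/-- The resolvent `(I - γ P^b)⁻¹` of the policy of the arm `b`. -/
def resolvent (s₁ : S) (γ : ℝ) (θ : Param S) (b : Arm) : Matrix S S ℝ :=
  (1 - γ • transMat (armPolicy s₁ b) θ)⁻¹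

/-- The value function of the policy of the arm `b`. -/
def armValue (s₁ : S) (γ : ℝ) (θ : Param S) (b : Arm) : S → ℝ := value γ (armPolicy s₁ b) θ

/-- The temporal difference error of the value function of the arm `b` at a transition, with the
reward replaced by its mean. -/
def tdMean (s₁ : S) (γ : ℝ) (θ : Param S) (b : Arm) (s : S) (a : Arm) (s' : S) : ℝ :=
  θ.2 s a + γ * armValue s₁ γ θ b s' - armValue s₁ γ θ b s

/-- The weight of the temporal difference error of the arm `b` in the influence function of
`u · Δ`. -/
def armCoef (s₁ : S) (γ : ℝ) (θ : Param S) (μ u : S → ℝ) (b : Arm) (s : S) (a : Arm) : ℝ :=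
  armSign b * (u ᵥ* resolvent s₁ γ θ b) s * (share s₁ b s a / freq s₁ μ s)

/-- The coefficient of the reward noise in the efficient influence function of `u · Δ`. -/
def inflCoef (s₁ : S) (γ : ℝ) (θ : Param S) (μ u : S → ℝ) (s : S) (a : Arm) : ℝ :=
  ∑ b, armCoef s₁ γ θ μ u b s a

/-- The part of the efficient influence function of `u · Δ` that depends on the transition. -/
def inflMean (s₁ : S) (γ : ℝ) (θ : Param S) (μ u : S → ℝ) (s : S) (a : Arm) (s' : S) : ℝ :=
  ∑ b, armCoef s₁ γ θ μ u b s a * tdMean s₁ γ θ b s a s'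

/-- The conditional variance of `c (y - r) + g`, given the state `s`, where `y` is the reward
and `r` is its mean. -/
def condVar (π : S → Arm → ℝ) (v : S → Arm → ℝ≥0) (θ : Param S) (c : S → Arm → ℝ)
    (g : S → Arm → S → ℝ) (s : S) : ℝ :=
  ∑ a, π s a * (∑ s', θ.1 s a s' * g s a s' ^ 2 + v s a * c s a ^ 2)

lemma armPolicy_eq (s₁ : S) (b : Arm) (s : S) (a : Arm) :
    armPolicy s₁ b s a = if a = armAct s₁ b s then 1 else 0 := by
  cases b <;> by_cases hs : s = s₁ <;> simp [armPolicy, armAct, piT, piC, hs]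

lemma sum_armPolicy_mul (s₁ : S) (b : Arm) (s : S) (f : Arm → ℝ) :
    ∑ a, armPolicy s₁ b s a * f a = f (armAct s₁ b s) := by
  simp [armPolicy_eq]

lemma transMat_armPolicy (s₁ : S) (θ : Param S) (b : Arm) (s s' : S) :
    transMat (armPolicy s₁ b) θ s s' = θ.1 s (armAct s₁ b s) s' :=
  sum_armPolicy_mul s₁ b s fun a => θ.1 s a s'

lemma meanReward_armPolicy (s₁ : S) (θ : Param S) (b : Arm) (s : S) :
    meanReward (armPolicy s₁ b) θ s = θ.2 s (armAct s₁ b s) :=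
  sum_armPolicy_mul s₁ b s fun a => θ.2 s a

/-- Reweighting the experimental policy to the policy of an arm. -/
lemma freq_mul_armPolicy {s₁ : S} {μ : S → ℝ} (hpos : ∀ s, 0 < μ s) (b : Arm) (s : S) (a : Arm) :
    μ s * piHalf s₁ s a * (share s₁ b s a / freq s₁ μ s) = armPolicy s₁ b s a := by
  have h := (hpos s).ne'
  have h1 := (hpos s₁).ne'
  by_cases hs : s = s₁
  · subst hs
    cases a <;> cases b <;> simp [piHalf, piT, piC, share, freq, armPolicy] <;> field_simp
  · cases a <;> cases b <;>
      simp [piHalf, piT, piC, share, freq, armPolicy, hs] <;> field_simp <;> norm_num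

lemma freq_pos {s₁ : S} {μ : S → ℝ} (hpos : ∀ s, 0 < μ s) (s : S) : 0 < freq s₁ μ s := by
  have := hpos s
  unfold freq; split_ifs <;> linarith

variable {s₁ : S} {γ : ℝ} (hγ₀ : 0 ≤ γ) (hγ₁ : γ < 1) {θ : Param S} (hθ : θ ∈ models s₁)
  {μ : S → ℝ} (hpos : ∀ s, 0 < μ s)

lemma available_armAct (b : Arm) (s : S) : Available s₁ s (armAct s₁ b s) := by
  unfold armAct Available; split_ifs with h <;> simp [h]

include hγ₀ hγ₁ hθ

lemma armValue_eq (b : Arm) (s : S) :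
    armValue s₁ γ θ b s = θ.2 s (armAct s₁ b s) +
      γ * ∑ s', θ.1 s (armAct s₁ b s) s' * armValue s₁ γ θ b s' := by
  have h := congrFun (bellman hγ₀ hγ₁ hθ (isPolicy_armPolicy s₁ b)) s
  simpa [mulVec, dotProduct, transMat_armPolicy, meanReward_armPolicy, armValue] using h

/-- On the action of the arm, the temporal difference error is centered. -/
lemma tdMean_armAct (b : Arm) (s s' : S) :
    tdMean s₁ γ θ b s (armAct s₁ b s) s' = γ * armValue s₁ γ θ b s' -
      ∑ x, θ.1 s (armAct s₁ b s) x * (γ * armValue s₁ γ θ b x) := by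
  rw [tdMean, armValue_eq hγ₀ hγ₁ hθ b s, Finset.mul_sum]
  simp only [mul_left_comm γ]
  ring

lemma sum_tdMean {b : Arm} {s : S} {a : Arm} (h : armPolicy s₁ b s a ≠ 0) :
    ∑ s', θ.1 s a s' * tdMean s₁ γ θ b s a s' = 0 := by
  obtain rfl : a = armAct s₁ b s := by
    by_contra hne; exact h (by simp [armPolicy_eq, hne])
  simp only [tdMean_armAct hγ₀ hγ₁ hθ, mul_sub, Finset.sum_sub_distrib, ← Finset.sum_mul,
    (hθ _ _ (available_armAct b s)).2, one_mul, sub_self]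

include hpos

lemma share_mul_sum_tdMean {b : Arm} {s : S} {a : Arm} (h : piHalf s₁ s a ≠ 0) :
    share s₁ b s a * ∑ s', θ.1 s a s' * tdMean s₁ γ θ b s a s' = 0 := by
  by_cases hs : share s₁ b s a = 0
  · rw [hs, zero_mul]
  · rw [sum_tdMean hγ₀ hγ₁ hθ, mul_zero]
    rw [← freq_mul_armPolicy hpos]
    exact mul_ne_zero (mul_ne_zero (hpos s).ne' h) (div_ne_zero hs (freq_pos hpos s).ne')

lemma sum_inflMean (u : S → ℝ) {s : S} {a : Arm} (h : piHalf s₁ s a ≠ 0) :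
    ∑ s', θ.1 s a s' * inflMean s₁ γ θ μ u s a s' = 0 := by
  simp only [inflMean, Finset.mul_sum]
  rw [Finset.sum_comm]
  refine Finset.sum_eq_zero fun b _ => ?_
  have := share_mul_sum_tdMean hγ₀ hγ₁ hθ hpos (b := b) h
  calc ∑ s', θ.1 s a s' * (armCoef s₁ γ θ μ u b s a * tdMean s₁ γ θ b s a s')
      = armSign b * (u ᵥ* resolvent s₁ γ θ b) s / freq s₁ μ s *
        (share s₁ b s a * ∑ s', θ.1 s a s' * tdMean s₁ γ θ b s a s') := by
        simp only [Finset.mul_sum, armCoef]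
        exact Finset.sum_congr rfl fun s' _ => by ring
    _ = 0 := by rw [this, mul_zero]

/-- The variance of the influence function is the derivative of `u · Δ` in the direction that the
influence function determines: this direction is least favourable. -/
lemma sum_condVar_infl (v : S → Arm → ℝ≥0) (u : S → ℝ) :
    ∑ s, μ s * condVar (piHalf s₁) v θ (inflCoef s₁ γ θ μ u) (inflMean s₁ γ θ μ u) s =
      ∑ b, armSign b * (u ⬝ᵥ (resolvent s₁ γ θ b *ᵥ fun s => ∑ a, armPolicy s₁ b s a *
        (v s a * inflCoef s₁ γ θ μ u s a + ∑ s', θ.1 s a s' * inflMean s₁ γ θ μ u s a s' *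
          (γ * armValue s₁ γ θ b s')))) := by
  have key : ∀ s a, μ s * (piHalf s₁ s a * (∑ s', θ.1 s a s' * inflMean s₁ γ θ μ u s a s' ^ 2 +
      v s a * inflCoef s₁ γ θ μ u s a ^ 2)) = ∑ b, armSign b * ((u ᵥ* resolvent s₁ γ θ b) s *
        (armPolicy s₁ b s a * (v s a * inflCoef s₁ γ θ μ u s a +
          ∑ s', θ.1 s a s' * inflMean s₁ γ θ μ u s a s' * (γ * armValue s₁ γ θ b s')))) := by
    intro s a
    by_cases h : piHalf s₁ s a = 0
    · simp [← freq_mul_armPolicy hpos, h]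
    have h0 := sum_inflMean hγ₀ hγ₁ hθ hpos u h
    have h1 : ∀ b, ∑ s', θ.1 s a s' * inflMean s₁ γ θ μ u s a s' * tdMean s₁ γ θ b s a s' =
        ∑ s', θ.1 s a s' * inflMean s₁ γ θ μ u s a s' * (γ * armValue s₁ γ θ b s') := by
      intro b
      have : ∀ s', θ.1 s a s' * inflMean s₁ γ θ μ u s a s' * tdMean s₁ γ θ b s a s' =
          θ.1 s a s' * inflMean s₁ γ θ μ u s a s' * (γ * armValue s₁ γ θ b s') +
          θ.1 s a s' * inflMean s₁ γ θ μ u s a s' * (θ.2 s a - armValue s₁ γ θ b s) := by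
        intro s'; rw [tdMean]; ring
      rw [Finset.sum_congr rfl fun s' _ => this s', Finset.sum_add_distrib, ← Finset.sum_mul _ _
        (θ.2 s a - _), h0, zero_mul, add_zero]
    have h2 : ∑ s', θ.1 s a s' * inflMean s₁ γ θ μ u s a s' ^ 2 = ∑ b, armCoef s₁ γ θ μ u b s a *
        ∑ s', θ.1 s a s' * inflMean s₁ γ θ μ u s a s' * tdMean s₁ γ θ b s a s' := by
      simp only [Finset.mul_sum]
      rw [Finset.sum_comm]
      refine Finset.sum_congr rfl fun s' _ => ?_
      rw [sq, ← mul_assoc]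
      nth_rw 2 [inflMean]
      rw [Finset.mul_sum]
      exact Finset.sum_congr rfl fun b _ => by ring
    have h3 : (v s a : ℝ) * inflCoef s₁ γ θ μ u s a ^ 2 =
        ∑ b, armCoef s₁ γ θ μ u b s a * (v s a * inflCoef s₁ γ θ μ u s a) := by
      rw [← Finset.sum_mul, ← inflCoef]; ring
    rw [h2, h3, ← Finset.sum_add_distrib, Finset.mul_sum, Finset.mul_sum]
    refine Finset.sum_congr rfl fun b _ => ?_
    rw [h1, ← freq_mul_armPolicy hpos, armCoef]
    ring
  simp only [condVar, Finset.mul_sum] at key ⊢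
  rw [Finset.sum_congr rfl fun s _ => Finset.sum_congr rfl fun a _ => key s a]
  simp only [dotProduct_mulVec]
  simp only [dotProduct, Finset.mul_sum]
  rw [Finset.sum_congr rfl fun s _ => Finset.sum_comm, Finset.sum_comm]

end Influence

section Sigma

variable {S : Type*} [Fintype S] [DecidableEq S]

/-- The quadratic form of `Diag(p) - p pᵀ` is the variance under `p`. -/
lemma dotProduct_diagonal_sub_vecMulVec {p : S → ℝ} (hp : ∑ s, p s = 1) (w : S → ℝ) :
    w ⬝ᵥ ((Matrix.diagonal p - Matrix.vecMulVec p p) *ᵥ w) =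
      ∑ s, p s * (w s - ∑ x, p x * w x) ^ 2 := by
  rw [sub_mulVec, vecMulVec_mulVec, dotProduct_sub]
  have h1 : w ⬝ᵥ (Matrix.diagonal p *ᵥ w) = ∑ s, p s * w s ^ 2 := by
    simp only [dotProduct, mulVec_diagonal]
    exact Finset.sum_congr rfl fun s _ => by ring
  have h2 : w ⬝ᵥ (MulOpposite.op (p ⬝ᵥ w) • p) = (∑ x, p x * w x) ^ 2 := by
    rw [dotProduct_smul, dotProduct_comm w p, op_smul_eq_mul, dotProduct, sq]
  have h3 : ∀ s, p s * (w s - ∑ x, p x * w x) ^ 2 = p s * w s ^ 2 -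
      2 * (∑ x, p x * w x) * (p s * w s) + p s * (∑ x, p x * w x) ^ 2 := fun s => by ring
  rw [h1, h2, Finset.sum_congr rfl fun s _ => h3 s, Finset.sum_add_distrib,
    Finset.sum_sub_distrib, ← Finset.mul_sum, ← Finset.sum_mul, hp]
  ring

/-- The quadratic form of a congruence. -/
lemma dotProduct_conj_mulVec (M C : Matrix S S ℝ) (u : S → ℝ) :
    u ⬝ᵥ ((M * C * Mᵀ) *ᵥ u) = (u ᵥ* M) ⬝ᵥ (C *ᵥ (u ᵥ* M)) := by
  rw [← mulVec_mulVec, ← mulVec_mulVec, mulVec_transpose, dotProduct_mulVec]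

variable {s₁ : S} {γ : ℝ} (hγ₀ : 0 ≤ γ) (hγ₁ : γ < 1) {θ : Param S} (hθ : θ ∈ models s₁)
  {μ : S → ℝ} (hpos : ∀ s, 0 < μ s)

include hγ₀ hγ₁ hθ

lemma dotProduct_visit (u : S → ℝ) (b : Arm) (s : S) :
    u ⬝ᵥ visit γ (armPolicy s₁ b) θ s = (u ᵥ* resolvent s₁ γ θ b) s := by
  simp only [vecMul, dotProduct, resolvent, visit_eq hγ₀ hγ₁ hθ (isPolicy_armPolicy s₁ b)]

include hpos

/-- In the crucial state, the action `b` enters the data set of the arm `b` only, so the influence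
function is a multiple of one temporal difference error. -/
lemma dotProduct_crucialTerm (v : S → Arm → ℝ≥0) (u : S → ℝ) (b : Arm) :
    u ⬝ᵥ (crucialTerm s₁ γ v θ μ (armPolicy s₁ b) *ᵥ u) =
      μ s₁ * (1 / 2 * (∑ s', θ.1 s₁ b s' * inflMean s₁ γ θ μ u s₁ b s' ^ 2 +
        v s₁ b * inflCoef s₁ γ θ μ u s₁ b ^ 2)) := by
  have hact : armAct s₁ b s₁ = b := by simp [armAct]
  have h0 := (hpos s₁).ne'
  rw [crucialTerm, smul_mulVec, dotProduct_smul, dotProduct_conj_mulVec, ← resolvent]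
  have hcov := dotProduct_diagonal_sub_vecMulVec
    (sum_transMat hθ (isPolicy_armPolicy s₁ b) s₁) (γ • armValue s₁ γ θ b)
  rw [← armValue, transCov, hcov]
  simp only [transMat_armPolicy, hact, Pi.smul_apply, smul_eq_mul]
  have htd : ∀ s', tdMean s₁ γ θ b s₁ b s' = γ * armValue s₁ γ θ b s' -
      ∑ x, θ.1 s₁ b x * (γ * armValue s₁ γ θ b x) := by
    intro s'
    have := tdMean_armAct hγ₀ hγ₁ hθ b s₁ s'
    rwa [hact] at this
  simp only [← htd]
  have hrv : rewardVar (armPolicy s₁ b) v s₁ = v s₁ b := by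
    have := sum_armPolicy_mul s₁ b s₁ fun a => (v s₁ a : ℝ)
    rwa [hact] at this
  have hcoef : ∀ b', armCoef s₁ γ θ μ u b' s₁ b =
      if b' = b then armSign b * (u ᵥ* resolvent s₁ γ θ b) s₁ * (2 / μ s₁) else 0 := by
    intro b'
    by_cases hb : b' = b
    · subst hb; simp [armCoef, share, freq]
    · simp [armCoef, share, hb, Ne.symm hb]
  have hsign : armSign b ^ 2 = 1 := by cases b <;> simp [armSign]
  simp only [inflMean, inflCoef, hcoef, ite_mul, zero_mul, Finset.sum_ite_eq',
    Finset.mem_univ, if_true, hrv]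
  have hq : ∀ (w : S → ℝ) (d : ℝ), w ⬝ᵥ (Matrix.single s₁ s₁ d *ᵥ w) = d * w s₁ ^ 2 := by
    intro w d
    simp [Matrix.single_mulVec, dotProduct, Function.update_apply]
    ring
  rw [hq]
  simp only [mul_pow, hsign]
  have h4 : ∀ s', θ.1 s₁ b s' * (1 * (u ᵥ* resolvent s₁ γ θ b) s₁ ^ 2 * (2 / μ s₁) ^ 2 *
      tdMean s₁ γ θ b s₁ b s' ^ 2) = ((u ᵥ* resolvent s₁ γ θ b) s₁ ^ 2 * (2 / μ s₁) ^ 2) *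
        (θ.1 s₁ b s' * tdMean s₁ γ θ b s₁ b s' ^ 2) := fun s' => by ring
  rw [Finset.sum_congr rfl fun s' _ => h4 s', ← Finset.mul_sum]
  field_simp
  ring

/-- Outside the crucial state each sample enters the data sets of both arms, and the influence
function is a difference of two temporal difference errors. -/
lemma dotProduct_regularTerm (v : S → Arm → ℝ≥0) (u : S → ℝ) {s : S} (hs : s ≠ s₁) :
    u ⬝ᵥ (((1 / μ s) • (crossMat s₁ γ θ s * transCov piC θ s * (crossMat s₁ γ θ s)ᵀ)) *ᵥ u) +
      u ⬝ᵥ (((rewardVar piC v s / μ s) •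
        Matrix.vecMulVec (visit γ (piT s₁) θ s - visit γ piC θ s)
          (visit γ (piT s₁) θ s - visit γ piC θ s)) *ᵥ u) =
      μ s * (∑ s', θ.1 s Arm.c s' * inflMean s₁ γ θ μ u s Arm.c s' ^ 2 +
        v s Arm.c * inflCoef s₁ γ θ μ u s Arm.c ^ 2) := by
  have h0 := (hpos s).ne'
  have hact : ∀ b, armAct s₁ b s = Arm.c := fun b => by simp [armAct, hs]
  have eT : piT s₁ = armPolicy s₁ Arm.t := rfl
  have eC : (piC : S → Arm → ℝ) = armPolicy s₁ Arm.c := rfl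
  set ρ : Arm → ℝ := fun b => (u ᵥ* resolvent s₁ γ θ b) s with hρ
  have hvis := dotProduct_visit hγ₀ hγ₁ hθ u (s := s)
  set W : S → ℝ := u ᵥ* crossMat s₁ γ θ s with hW
  have hWs : ∀ x, W x = ρ Arm.t * (γ * armValue s₁ γ θ Arm.t x) -
      ρ Arm.c * (γ * armValue s₁ γ θ Arm.c x) := by
    intro x
    rw [hW, crossMat, vecMul_sub, vecMul_smul, vecMul_smul, vecMul_vecMulVec, vecMul_vecMulVec,
      eT, eC, hvis, hvis, ← armValue, ← armValue]
    simp only [Pi.sub_apply, Pi.smul_apply, smul_eq_mul, hρ]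
    ring
  have hcoef : ∀ b, armCoef s₁ γ θ μ u b s Arm.c = armSign b * ρ b / μ s := by
    intro b; simp [armCoef, share, freq, hs, hρ]; ring
  have hg : ∀ s', inflMean s₁ γ θ μ u s Arm.c s' =
      (W s' - ∑ x, θ.1 s Arm.c x * W x) / μ s := by
    intro s'
    have ht := fun b => tdMean_armAct hγ₀ hγ₁ hθ b s s'
    simp only [hact] at ht
    have hsum : ∑ x, θ.1 s Arm.c x * W x =
        ρ Arm.t * ∑ x, θ.1 s Arm.c x * (γ * armValue s₁ γ θ Arm.t x) -
        ρ Arm.c * ∑ x, θ.1 s Arm.c x * (γ * armValue s₁ γ θ Arm.c x) := by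
      rw [Finset.mul_sum, Finset.mul_sum, ← Finset.sum_sub_distrib]
      exact Finset.sum_congr rfl fun x _ => by rw [hWs]; ring
    rw [inflMean, sum_arm, hcoef, hcoef, ht, ht, hsum, hWs]
    simp only [armSign]
    ring
  have hc : inflCoef s₁ γ θ μ u s Arm.c = (ρ Arm.t - ρ Arm.c) / μ s := by
    rw [inflCoef, sum_arm, hcoef, hcoef]; simp only [armSign]; ring
  have hcov := dotProduct_diagonal_sub_vecMulVec
    (sum_transMat hθ (isPolicy_armPolicy s₁ Arm.c) s) W
  have hrv : rewardVar (armPolicy s₁ Arm.c) v s = v s Arm.c := by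
    have := sum_armPolicy_mul s₁ Arm.c s fun a => (v s a : ℝ)
    rwa [hact] at this
  rw [smul_mulVec, dotProduct_smul, dotProduct_conj_mulVec, ← hW, eC, transCov, hcov,
    smul_mulVec, dotProduct_smul, vecMulVec_mulVec, dotProduct_smul, op_smul_eq_smul,
    dotProduct_comm _ u, dotProduct_sub, eT, hvis, hvis, hrv, hc]
  simp only [transMat_armPolicy, hact, hg, div_pow, smul_eq_mul]
  simp only [← mul_div_assoc, ← Finset.sum_div]
  field_simp
  ring

/-- The quadratic form of `Σ_IS` is the variance of the influence function. -/
lemma dotProduct_sigmaIS (v : S → Arm → ℝ≥0) (u : S → ℝ) :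
    u ⬝ᵥ (sigmaIS s₁ γ v θ μ *ᵥ u) =
      ∑ s, μ s * condVar (piHalf s₁) v θ (inflCoef s₁ γ θ μ u) (inflMean s₁ γ θ μ u) s := by
  have hcr := dotProduct_crucialTerm hγ₀ hγ₁ hθ hpos v u
  have hsplit : ∀ f : S → ℝ, ∑ s, f s = f s₁ + ∑ s ∈ Finset.univ.filter (fun s => s ≠ s₁), f s := by
    intro f
    rw [Finset.filter_ne', Finset.add_sum_erase _ _ (Finset.mem_univ _)]
  rw [sigmaIS, add_mulVec, add_mulVec, add_mulVec, dotProduct_add, dotProduct_add, dotProduct_add,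
    sum_mulVec, sum_mulVec, dotProduct_sum, dotProduct_sum, add_assoc, ← Finset.sum_add_distrib,
    hsplit]
  congr 1
  · have h1 := hcr Arm.t
    have h2 := hcr Arm.c
    simp only [armPolicy] at h1 h2
    rw [h1, h2, condVar, sum_arm]
    simp [piHalf, piT, piC]
    ring
  · refine Finset.sum_congr rfl fun s hs => ?_
    have hs' : s ≠ s₁ := (Finset.mem_filter.1 hs).2
    rw [dotProduct_regularTerm hγ₀ hγ₁ hθ hpos v u hs', condVar, sum_arm]
    have h1 : piHalf s₁ s Arm.c = 1 := by simp [piHalf, piT, piC, hs']; norm_num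
    have h2 : piHalf s₁ s Arm.t = 0 := by simp [piHalf, piT, piC, hs']
    rw [h1, h2]
    ring

end Sigma

section Positivity

variable {S : Type*} [Fintype S] [DecidableEq S]

lemma isHermitian_sigmaIS (s₁ : S) (γ : ℝ) (v : S → Arm → ℝ≥0) (θ : Param S) (μ : S → ℝ) :
    (sigmaIS s₁ γ v θ μ).IsHermitian := by
  have hcov : ∀ s, (transCov piC θ s)ᵀ = transCov piC θ s := by
    intro s; simp [transCov, transpose_sub, transpose_vecMulVec]
  have hcr : ∀ π, (crucialTerm s₁ γ v θ μ π)ᵀ = crucialTerm s₁ γ v θ μ π := by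
    intro π
    simp [crucialTerm, transpose_smul, transpose_mul, Matrix.mul_assoc]
  have hconj : ∀ M C : Matrix S S ℝ, Cᵀ = C → (M * C * Mᵀ)ᵀ = M * C * Mᵀ := by
    intro M C hC
    rw [transpose_mul, transpose_mul, transpose_transpose, hC, Matrix.mul_assoc]
  rw [Matrix.IsHermitian, conjTranspose_eq_transpose_of_trivial, sigmaIS]
  simp only [transpose_add, hcr, transpose_sum, transpose_smul, transpose_vecMulVec,
    hconj _ _ (hcov _)]

lemma condVar_nonneg {s₁ : S} {θ : Param S} (hθ : θ ∈ models s₁) (v : S → Arm → ℝ≥0)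
    (c : S → Arm → ℝ) (g : S → Arm → S → ℝ) (s : S) : 0 ≤ condVar (piHalf s₁) v θ c g s := by
  refine Finset.sum_nonneg fun a _ => ?_
  by_cases h : piHalf s₁ s a = 0
  · simp [h]
  · refine mul_nonneg (piHalf_nonneg _ _ _) (add_nonneg (Finset.sum_nonneg fun s' _ =>
      mul_nonneg ((hθ _ _ (available_of_piHalf_ne_zero h)).1 _) (sq_nonneg _)) ?_)
    positivity

lemma posSemidef_sigmaIS {s₁ : S} {γ : ℝ} (hγ₀ : 0 ≤ γ) (hγ₁ : γ < 1) {θ : Param S}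
    (hθ : θ ∈ models s₁) {μ : S → ℝ} (hpos : ∀ s, 0 < μ s) (v : S → Arm → ℝ≥0) :
    (sigmaIS s₁ γ v θ μ).PosSemidef := by
  refine PosSemidef.of_dotProduct_mulVec_nonneg (isHermitian_sigmaIS _ _ _ _ _) fun u => ?_
  rw [star_trivial, dotProduct_sigmaIS hγ₀ hγ₁ hθ hpos]
  exact Finset.sum_nonneg fun s _ => mul_nonneg (hpos s).le (condVar_nonneg hθ v _ _ s)

end Positivity

/-! ### Likelihood ratios and the Chapman-Robbins inequality -/

section Densities

/-- The Cauchy-Schwarz inequality for the covariance. -/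
lemma sq_covariance_le {Ω : Type*} [MeasurableSpace Ω] {μ : Measure Ω} [IsProbabilityMeasure μ]
    {X Y : Ω → ℝ} (hX : MemLp X 2 μ) (hY : MemLp Y 2 μ) :
    cov[X, Y; μ] ^ 2 ≤ Var[X; μ] * Var[Y; μ] := by
  have h : ∀ t : ℝ, 0 ≤ Var[Y; μ] * (t * t) + 2 * cov[X, Y; μ] * t + Var[X; μ] := by
    intro t
    have h1 := variance_add hX (hY.const_smul t)
    rw [covariance_smul_right, variance_smul] at h1
    have h2 := variance_nonneg (X + t • Y) μ
    rw [h1] at h2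
    linarith
  have h3 := discrim_le_zero h
  rw [discrim] at h3
  linarith

lemma pi_withDensity_ofReal {ι : Type*} [Fintype ι] {μ : ι → Measure ℝ}
    [∀ i, IsProbabilityMeasure (μ i)] {f : ι → ℝ → ℝ} (hf0 : ∀ i y, 0 ≤ f i y)
    (hint : ∀ i, Integrable (f i) (μ i)) :
    Measure.pi (fun i => (μ i).withDensity fun y => ENNReal.ofReal (f i y)) =
      (Measure.pi μ).withDensity fun y => ENNReal.ofReal (∏ i, f i (y i)) := by
  have hfin : ∀ i, IsFiniteMeasure ((μ i).withDensity fun y => ENNReal.ofReal (f i y)) :=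
    fun i => isFiniteMeasure_withDensity_ofReal (hint i).2
  refine Measure.pi_eq fun s hs => ?_
  rw [withDensity_apply _ (MeasurableSet.univ_pi hs), Measure.restrict_pi_pi,
    ← ofReal_integral_eq_lintegral_ofReal
      (Integrable.fintype_prod fun i => (hint i).integrableOn (s := s i))
      (ae_of_all _ fun y => Finset.prod_nonneg fun i _ => hf0 i _),
    integral_fintype_prod_eq_prod,
    ENNReal.ofReal_prod_of_nonneg fun i _ => integral_nonneg (hf0 i)]
  refine Finset.prod_congr rfl fun i _ => ?_
  rw [withDensity_apply _ (hs i), ofReal_integral_eq_lintegral_ofReal (hint i).integrableOn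
    (ae_of_all _ (hf0 i))]

lemma integrable_exp_gaussianReal (m : ℝ) (v : ℝ≥0) (t k : ℝ) :
    Integrable (fun y => Real.exp (t * (y - m) - k)) (gaussianReal m v) := by
  have h := (integrable_exp_mul_gaussianReal (μ := m) (v := v) t).const_mul (Real.exp (-t * m - k))
  refine h.congr (ae_of_all _ fun y => ?_)
  simp only [← Real.exp_add]
  congr 1; ring

lemma integral_exp_gaussianReal (m : ℝ) (v : ℝ≥0) (t k : ℝ) :
    ∫ y, Real.exp (t * (y - m) - k) ∂(gaussianReal m v) = Real.exp (v * t ^ 2 / 2 - k) := by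
  have h := mgf_gaussianReal (p := gaussianReal m v) (μ := m) (v := v) (X := id) Measure.map_id t
  rw [mgf] at h
  have h1 : ∀ y, Real.exp (t * (y - m) - k) = Real.exp (-t * m - k) * Real.exp (t * id y) := by
    intro y; rw [← Real.exp_add]; congr 1; simp only [id]; ring
  rw [integral_congr_ae (ae_of_all _ h1), integral_const_mul, h, ← Real.exp_add]
  congr 1; ring

/-- Shifting the mean of a Gaussian by `v c` is an exponential change of measure. For variance zero
both sides are the Dirac mass at `m`. -/
lemma gaussianReal_add_mul (m : ℝ) (v : ℝ≥0) (c : ℝ) :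
    gaussianReal (m + v * c) v = (gaussianReal m v).withDensity
      fun y => ENNReal.ofReal (Real.exp (c * (y - m) - v * c ^ 2 / 2)) := by
  rcases eq_or_ne v 0 with rfl | hv
  · have hmeas : Measurable fun y : ℝ =>
        ENNReal.ofReal (Real.exp (c * (y - m) - ((0 : ℝ≥0) : ℝ) * c ^ 2 / 2)) := by fun_prop
    simp only [gaussianReal_zero_var, NNReal.coe_zero, zero_mul, add_zero]
    ext s hs
    rw [withDensity_apply _ hs, ← lintegral_indicator hs,
      lintegral_dirac' _ (Measurable.indicator (by fun_prop) hs), Measure.dirac_apply' _ hs]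
    by_cases hm : m ∈ s <;> simp [hm]
  · rw [gaussianReal_of_var_ne_zero _ hv, gaussianReal_of_var_ne_zero _ hv,
      ← withDensity_mul _ (measurable_gaussianPDF _ _) (by fun_prop)]
    congr 1
    ext y
    have hv' : (v : ℝ) ≠ 0 := by exact_mod_cast hv
    rw [Pi.mul_apply, gaussianPDF, gaussianPDF,
      ← ENNReal.ofReal_mul (gaussianPDFReal_nonneg _ _ _), gaussianPDFReal, gaussianPDFReal,
      mul_assoc _ (Real.exp _) (Real.exp _), ← Real.exp_add]
    congr 3
    field_simp
    ring

end Densities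

section Perturbation

variable {S : Type*} [Fintype S] [DecidableEq S]

/-- The path of parameters through `θ` whose score at `ε = 0` is `c (y - r) + g`. The transition
probabilities keep their zeros and the rewards without noise keep their means, so that all the laws
on the path are absolutely continuous with respect to the law at `θ`. -/
def perturb (v : S → Arm → ℝ≥0) (θ : Param S) (c : S → Arm → ℝ) (g : S → Arm → S → ℝ) (ε : ℝ) :
    Param S :=
  (fun s a s' => θ.1 s a s' * (1 + ε * g s a s'), fun s a => θ.2 s a + ε * (v s a * c s a))

/-- The likelihood ratio of one transition and its reward under `perturb v θ c g ε` and `θ`. -/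
def likRatio (v : S → Arm → ℝ≥0) (θ : Param S) (c : S → Arm → ℝ) (g : S → Arm → S → ℝ) (ε : ℝ)
    (s : S) (a : Arm) (s' : S) (y : ℝ) : ℝ :=
  (1 + ε * g s a s') * Real.exp (ε * c s a * (y - θ.2 s a) - v s a * (ε * c s a) ^ 2 / 2)

/-- The likelihood ratio of a trajectory. -/
def trajRatio (v : S → Arm → ℝ≥0) (θ : Param S) (c : S → Arm → ℝ) (g : S → Arm → S → ℝ) (ε : ℝ)
    {T : ℕ} (τ : Traj S T) : ℝ :=
  ∏ i : Fin T, likRatio v θ c g ε (τ.1 i.castSucc) (τ.2.1 i) (τ.1 i.succ) (τ.2.2 i)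

variable {s₁ : S} {v : S → Arm → ℝ≥0} {θ : Param S} {c : S → Arm → ℝ} {g : S → Arm → S → ℝ}

lemma tendsto_perturb : Tendsto (perturb v θ c g) (𝓝 0) (𝓝 θ) := by
  have h : Continuous (perturb v θ c g) := by
    unfold perturb
    fun_prop
  have h0 : perturb v θ c g 0 = θ := by simp [perturb]
  simpa [h0] using h.tendsto 0

lemma perturb_sub (ε : ℝ) : perturb v θ c g ε - θ =
    ε • ((fun s a s' => θ.1 s a s' * g s a s', fun s a => v s a * c s a) : Param S) := by
  refine Prod.ext ?_ ?_
  · ext s a s'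
    simp [perturb]
    ring
  · ext s a
    simp [perturb]

lemma eventually_one_add_pos (g : S → Arm → S → ℝ) :
    ∀ᶠ ε in 𝓝 (0 : ℝ), ∀ s a s', 0 < 1 + ε * g s a s' := by
  simp only [eventually_all]
  intro s a s'
  have h : Continuous fun ε : ℝ => 1 + ε * g s a s' := by fun_prop
  exact (h.tendsto 0).eventually_const_lt (by simp)

lemma perturb_mem_models (hθ : θ ∈ models s₁)
    (hg : ∀ s a, Available s₁ s a → ∑ s', θ.1 s a s' * g s a s' = 0) {ε : ℝ}
    (hε : ∀ s a s', 0 < 1 + ε * g s a s') : perturb v θ c g ε ∈ models s₁ := by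
  intro s a ha
  refine ⟨fun s' => mul_nonneg ((hθ s a ha).1 s') (hε _ _ _).le, ?_⟩
  simp only [perturb, mul_add, mul_one, Finset.sum_add_distrib, (hθ s a ha).2]
  simp only [mul_left_comm _ ε, ← Finset.mul_sum, hg s a ha, mul_zero, add_zero]

lemma rewardLaw_perturb (ε : ℝ) {T : ℕ} (s : Fin (T + 1) → S) (a : Fin T → Arm) :
    rewardLaw v (perturb v θ c g ε) s a = (rewardLaw v θ s a).withDensity fun y =>
      ENNReal.ofReal (∏ i : Fin T, Real.exp (ε * c (s i.castSucc) (a i) *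
        (y i - θ.2 (s i.castSucc) (a i)) -
          v (s i.castSucc) (a i) * (ε * c (s i.castSucc) (a i)) ^ 2 / 2)) := by
  rw [rewardLaw, rewardLaw, ← pi_withDensity_ofReal
    (f := fun i y => Real.exp (ε * c (s i.castSucc) (a i) * (y - θ.2 (s i.castSucc) (a i)) -
          v (s i.castSucc) (a i) * (ε * c (s i.castSucc) (a i)) ^ 2 / 2))
    (fun i y => (Real.exp_pos _).le) fun i => integrable_exp_gaussianReal _ _ _ _]
  congr 1
  ext1 i
  rw [← gaussianReal_add_mul]
  congr 1
  simp only [perturb]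
  ring

lemma pathWeight_perturb (π : S → Arm → ℝ) (ν : S → ℝ) (ε : ℝ) {T : ℕ} (s : Fin (T + 1) → S)
    (a : Fin T → Arm) : pathWeight π ν (perturb v θ c g ε) s a =
      pathWeight π ν θ s a * ∏ i : Fin T, (1 + ε * g (s i.castSucc) (a i) (s i.succ)) := by
  rw [pathWeight, pathWeight, mul_assoc, ← Finset.prod_mul_distrib]
  congr 1
  exact Finset.prod_congr rfl fun i _ => by simp only [perturb]; ring

variable [MeasurableSpace S] [MeasurableSingletonClass S]

lemma integrable_mul_trajRatio {π : S → Arm → ℝ} {ν : S → ℝ} {ε : ℝ}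
    (hε : ∀ s a s', 0 < 1 + ε * g s a s') {T : ℕ} {X : Traj S T → ℝ}
    (hX : Integrable X (trajLaw π v ν T (perturb v θ c g ε))) :
    Integrable (fun τ => trajRatio v θ c g ε τ * X τ) (trajLaw π v ν T θ) := by
  rw [integrable_trajLaw_iff] at hX ⊢
  intro s a hsa
  have h1 := hX s a (by
    rw [pathWeight_perturb]; exact mul_pos hsa (Finset.prod_pos fun i _ => hε _ _ _))
  rw [rewardLaw_perturb, integrable_withDensity_iff_integrable_smul' (by fun_prop) (by simp)] at h1
  refine (h1.const_mul (∏ i : Fin T, (1 + ε * g (s i.castSucc) (a i) (s i.succ)))).congr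
    (ae_of_all _ fun y => ?_)
  dsimp only
  rw [ENNReal.toReal_ofReal (Finset.prod_nonneg fun i _ => (Real.exp_pos _).le), smul_eq_mul,
    ← mul_assoc, ← Finset.prod_mul_distrib]
  rfl

/-- The likelihood ratio is the density of the perturbed law. -/
lemma integral_trajLaw_perturb {ν : S → ℝ} (hν : ∀ s, 0 ≤ ν s) (hθ : θ ∈ models s₁)
    (hg : ∀ s a, Available s₁ s a → ∑ s', θ.1 s a s' * g s a s' = 0) {ε : ℝ}
    (hε : ∀ s a s', 0 < 1 + ε * g s a s') {T : ℕ} {X : Traj S T → ℝ}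
    (hX : Integrable X (trajLaw (piHalf s₁) v ν T (perturb v θ c g ε))) :
    ∫ τ, X τ ∂(trajLaw (piHalf s₁) v ν T (perturb v θ c g ε)) =
      ∫ τ, trajRatio v θ c g ε τ * X τ ∂(trajLaw (piHalf s₁) v ν T θ) := by
  rw [integral_trajLaw (pathWeight_nonneg (perturb_mem_models hθ hg hε) hν) hX,
    integral_trajLaw (pathWeight_nonneg hθ hν) (integrable_mul_trajRatio hε hX)]
  refine Finset.sum_congr rfl fun s _ => Finset.sum_congr rfl fun a _ => ?_
  rw [pathWeight_perturb, rewardLaw_perturb,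
    integral_withDensity_eq_integral_toReal_smul (by fun_prop) (by simp), smul_eq_mul, smul_eq_mul,
    mul_assoc, ← integral_const_mul]
  congr 1
  refine integral_congr_ae (ae_of_all _ fun y => ?_)
  dsimp only
  rw [ENNReal.toReal_ofReal (Finset.prod_nonneg fun i _ => (Real.exp_pos _).le), smul_eq_mul,
    ← mul_assoc, ← Finset.prod_mul_distrib]
  rfl

lemma likRatio_sq (ε : ℝ) (s : S) (a : Arm) (s' : S) (y : ℝ) :
    likRatio v θ c g ε s a s' y ^ 2 = (1 + ε * g s a s') ^ 2 *
      Real.exp (2 * (ε * c s a) * (y - θ.2 s a) - v s a * (ε * c s a) ^ 2) := by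
  rw [likRatio, mul_pow, ← Real.exp_nat_mul]
  congr 2
  push_cast
  ring

lemma memLp_trajRatio (π : S → Arm → ℝ) (ν : S → ℝ) (ε : ℝ) (T : ℕ) :
    MemLp (trajRatio v θ c g ε) 2 (trajLaw π v ν T θ) := by
  have h1 : Integrable (fun τ : Traj S T => trajRatio v θ c g ε τ) (trajLaw π v ν T θ) :=
    integrable_prod_trajLaw fun s a s' =>
      (integrable_exp_gaussianReal (θ.2 s a) (v s a) (ε * c s a) _).const_mul _
  rw [memLp_two_iff_integrable_sq h1.1]
  simp only [trajRatio, ← Finset.prod_pow]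
  refine integrable_prod_trajLaw (φ := fun s a s' y => likRatio v θ c g ε s a s' y ^ 2)
    fun s a s' => ?_
  simp only [likRatio_sq]
  exact (integrable_exp_gaussianReal (θ.2 s a) (v s a) _ _).const_mul _

lemma integral_trajRatio {ν : S → ℝ} (hν : ∀ s, 0 ≤ ν s) (hν1 : ∑ s, ν s = 1) (hθ : θ ∈ models s₁)
    (hg : ∀ s a, Available s₁ s a → ∑ s', θ.1 s a s' * g s a s' = 0) {ε : ℝ}
    (hε : ∀ s a s', 0 < 1 + ε * g s a s') (T : ℕ) :
    ∫ τ, trajRatio v θ c g ε τ ∂(trajLaw (piHalf s₁) v ν T θ) = 1 := by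
  have := isProbabilityMeasure_trajLaw (perturb_mem_models (v := v) (c := c) hθ hg hε) v hν hν1 T
  have h := integral_trajLaw_perturb (v := v) (c := c) (T := T) hν hθ hg hε
    (integrable_const (1 : ℝ))
  simpa using h.symm

/-- The Chapman-Robbins inequality. -/
lemma sq_integral_perturb_sub_le {ν : S → ℝ} (hν : ∀ s, 0 ≤ ν s) (hν1 : ∑ s, ν s = 1)
    (hθ : θ ∈ models s₁) (hg : ∀ s a, Available s₁ s a → ∑ s', θ.1 s a s' * g s a s' = 0) {ε : ℝ}
    (hε : ∀ s a s', 0 < 1 + ε * g s a s') {T : ℕ} {X : Traj S T → ℝ}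
    (hX : MemLp X 2 (trajLaw (piHalf s₁) v ν T θ))
    (hX' : Integrable X (trajLaw (piHalf s₁) v ν T (perturb v θ c g ε))) :
    (∫ τ, X τ ∂(trajLaw (piHalf s₁) v ν T (perturb v θ c g ε)) -
      ∫ τ, X τ ∂(trajLaw (piHalf s₁) v ν T θ)) ^ 2 ≤ Var[X; trajLaw (piHalf s₁) v ν T θ] *
        (∫ τ, trajRatio v θ c g ε τ ^ 2 ∂(trajLaw (piHalf s₁) v ν T θ) - 1) := by
  have := isProbabilityMeasure_trajLaw hθ v hν hν1 T
  have hL := memLp_trajRatio (v := v) (θ := θ) (c := c) (g := g) (piHalf s₁) ν ε T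
  have h1 := integral_trajRatio (v := v) (c := c) hν hν1 hθ hg hε T
  have h := sq_covariance_le hX hL
  rw [covariance_eq_sub hX hL, variance_eq_sub hL, h1] at h
  rw [integral_trajLaw_perturb hν hθ hg hε hX']
  simpa [mul_comm] using h

/-- The variance of the likelihood ratio is `ε² T` times the variance of the score, to second
order. -/
lemma tendsto_trajRatio_sq {μ : S → ℝ} (hθ : θ ∈ models s₁)
    (hμ : IsStationary (transMat (piHalf s₁) θ) μ)
    (hg : ∀ s a, Available s₁ s a → ∑ s', θ.1 s a s' * g s a s' = 0) (T : ℕ) :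
    Tendsto (fun ε : ℝ =>
        (∫ τ, trajRatio v θ c g ε τ ^ 2 ∂(trajLaw (piHalf s₁) v μ T θ) - 1) / ε ^ 2)
      (𝓝[≠] 0) (𝓝 (T * ∑ s, μ s * condVar (piHalf s₁) v θ c g s)) := by
  set A : ℝ → Matrix S S ℝ := fun ε => Matrix.of fun s s' => ∑ a, piHalf s₁ s a * θ.1 s a s' *
    ((1 + ε * g s a s') ^ 2 * Real.exp (v s a * (ε * c s a) ^ 2)) with hA
  have hint : ∀ ε, ∫ τ, trajRatio v θ c g ε τ ^ 2 ∂(trajLaw (piHalf s₁) v μ T θ) =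
      μ ⬝ᵥ ((A ε ^ T) *ᵥ 1) := by
    intro ε
    simp only [trajRatio, ← Finset.prod_pow]
    rw [integral_prod_trajLaw (φ := fun s a s' y => likRatio v θ c g ε s a s' y ^ 2)
      (pathWeight_nonneg hθ hμ.1)]
    · have : transferMat (piHalf s₁) v θ (fun s a s' y => likRatio v θ c g ε s a s' y ^ 2) =
          A ε := by
        ext s s'
        simp only [transferMat, hA, likRatio_sq, Matrix.of_apply, integral_const_mul,
          integral_exp_gaussianReal]
        refine Finset.sum_congr rfl fun a _ => ?_
        simp only [RCLike.ofReal_real_eq_id, id]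
        congr 3
        ring
      rw [this]; rfl
    · intro s a s'
      simp only [likRatio_sq]
      exact (integrable_exp_gaussianReal (θ.2 s a) (v s a) _ _).const_mul _
  simp only [hint]
  refine tendsto_pow_second_order hμ.2.1 hμ.2.2 (fun s s' => ?_) (fun s => ?_) T
  · have hc : Continuous fun ε => A ε s s' := by
      simp only [hA, Matrix.of_apply]; fun_prop
    have h0 : A 0 s s' = transMat (piHalf s₁) θ s s' := by simp [hA, transMat]
    rw [← h0]
    exact (hc.tendsto 0).mono_left nhdsWithin_le_nhds
  · have hrow : ∀ ε : ℝ, ε ≠ 0 → (∑ s', A ε s s' - 1) / ε ^ 2 = ∑ a, piHalf s₁ s a *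
        ((Real.exp (v s a * (ε * c s a) ^ 2) - 1) / ε ^ 2 +
          Real.exp (v s a * (ε * c s a) ^ 2) * ∑ s', θ.1 s a s' * g s a s' ^ 2) := by
      intro ε hε
      have h1 : ∑ s', A ε s s' - 1 = ∑ a, piHalf s₁ s a *
          ((Real.exp (v s a * (ε * c s a) ^ 2) - 1) +
            ε ^ 2 * (Real.exp (v s a * (ε * c s a) ^ 2) * ∑ s', θ.1 s a s' * g s a s' ^ 2)) := by
        have h0 : ∑ s', A ε s s' - 1 = ∑ s', A ε s s' - ∑ a, piHalf s₁ s a := by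
          rw [sum_piHalf]
        rw [h0]
        simp only [hA, Matrix.of_apply]
        rw [Finset.sum_comm, ← Finset.sum_sub_distrib]
        refine Finset.sum_congr rfl fun a _ => ?_
        by_cases h : piHalf s₁ s a = 0
        · simp [h]
        have ha := available_of_piHalf_ne_zero h
        have h2 : ∀ s', piHalf s₁ s a * θ.1 s a s' * ((1 + ε * g s a s') ^ 2 *
            Real.exp (v s a * (ε * c s a) ^ 2)) = piHalf s₁ s a *
              Real.exp (v s a * (ε * c s a) ^ 2) * (θ.1 s a s' + 2 * ε * (θ.1 s a s' * g s a s') +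
                ε ^ 2 * (θ.1 s a s' * g s a s' ^ 2)) := fun s' => by ring
        rw [Finset.sum_congr rfl fun s' _ => h2 s', ← Finset.mul_sum, Finset.sum_add_distrib,
          Finset.sum_add_distrib, ← Finset.mul_sum, ← Finset.mul_sum, hg s a ha, (hθ s a ha).2]
        ring
      rw [h1, Finset.sum_div]
      refine Finset.sum_congr rfl fun a _ => ?_
      field_simp
    have hlim : Tendsto (fun ε : ℝ => ∑ a, piHalf s₁ s a *
        ((Real.exp (v s a * (ε * c s a) ^ 2) - 1) / ε ^ 2 +
          Real.exp (v s a * (ε * c s a) ^ 2) * ∑ s', θ.1 s a s' * g s a s' ^ 2)) (𝓝[≠] 0)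
        (𝓝 (∑ a, piHalf s₁ s a * (v s a * c s a ^ 2 +
          1 * ∑ s', θ.1 s a s' * g s a s' ^ 2))) := by
      refine tendsto_finsetSum _ fun a _ => Tendsto.const_mul _ (Tendsto.add ?_ ?_)
      · have hd : HasDerivAt (fun x : ℝ => Real.exp (v s a * c s a ^ 2 * x)) (v s a * c s a ^ 2)
            0 := by
          simpa using ((hasDerivAt_id (0 : ℝ)).const_mul (v s a * c s a ^ 2 : ℝ)).exp
        have hsq : Tendsto (fun ε : ℝ => ε ^ 2) (𝓝[≠] 0) (𝓝[≠] 0) := by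
          refine tendsto_nhdsWithin_iff.2 ⟨?_, ?_⟩
          · have : Continuous fun ε : ℝ => ε ^ 2 := by fun_prop
            simpa using (this.tendsto 0).mono_left nhdsWithin_le_nhds
          · filter_upwards [self_mem_nhdsWithin] with ε hε using pow_ne_zero 2 hε
        refine ((hasDerivAt_iff_tendsto_slope.1 hd).comp hsq).congr fun ε => ?_
        simp only [Function.comp_apply, slope_def_field, mul_zero, Real.exp_zero, sub_zero]
        congr 3
        ring
      · refine Tendsto.mul_const _ ?_
        have hc : Continuous fun ε : ℝ => Real.exp (v s a * (ε * c s a) ^ 2) := by fun_prop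
        simpa using (hc.tendsto 0).mono_left nhdsWithin_le_nhds
    have hval : condVar (piHalf s₁) v θ c g s = ∑ a, piHalf s₁ s a * (v s a * c s a ^ 2 +
          1 * ∑ s', θ.1 s a s' * g s a s' ^ 2) :=
      Finset.sum_congr rfl fun a _ => by ring
    rw [hval]
    refine hlim.congr' ?_
    filter_upwards [self_mem_nhdsWithin] with ε hε using (hrow ε hε).symm

end Perturbation

/-! ### The Cramér-Rao bound -/

section Differentiation

variable {S : Type*} [Fintype S] [DecidableEq S]

lemma tendsto_matrix_inv {ι : Type*} {l : Filter ι} {A : ι → Matrix S S ℝ} {B : Matrix S S ℝ}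
    (hB : IsUnit B.det) (h : Tendsto A l (𝓝 B)) : Tendsto (fun i => (A i)⁻¹) l (𝓝 B⁻¹) := by
  have hdet : Tendsto (fun i => (A i).det) l (𝓝 B.det) := (continuous_id.matrix_det.tendsto B).comp h
  have hadj : Tendsto (fun i => (A i).adjugate) l (𝓝 B.adjugate) :=
    (continuous_id.matrix_adjugate.tendsto B).comp h
  simp only [Matrix.inv_def, Ring.inverse_eq_inv']
  exact (hdet.inv₀ hB.ne_zero).smul hadj

lemma dotProduct_ate (s₁ : S) (γ : ℝ) (θ : Param S) (u : S → ℝ) :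
    u ⬝ᵥ ate s₁ γ θ = ∑ b, armSign b * (u ⬝ᵥ armValue s₁ γ θ b) := by
  rw [sum_arm, ate, dotProduct_sub]
  simp only [armSign, armValue, armPolicy]
  ring

variable {s₁ : S} {γ : ℝ} (hγ₀ : 0 ≤ γ) (hγ₁ : γ < 1) {v : S → Arm → ℝ≥0} {θ : Param S}
  (hθ : θ ∈ models s₁) {c : S → Arm → ℝ} {g : S → Arm → S → ℝ}
  (hg : ∀ s a, Available s₁ s a → ∑ s', θ.1 s a s' * g s a s' = 0)

include hγ₀ hγ₁ hθ hg

lemma armValue_perturb_sub (b : Arm) {ε : ℝ} (hε : ∀ s a s', 0 < 1 + ε * g s a s') :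
    armValue s₁ γ (perturb v θ c g ε) b - armValue s₁ γ θ b =
      ε • (resolvent s₁ γ (perturb v θ c g ε) b *ᵥ fun s => ∑ a, armPolicy s₁ b s a *
        (v s a * c s a + ∑ s', θ.1 s a s' * g s a s' * (γ * armValue s₁ γ θ b s'))) := by
  have hθ' : perturb v θ c g ε ∈ models s₁ := perturb_mem_models hθ hg hε
  have h1 := armValue_eq hγ₀ hγ₁ hθ b
  have h2 := armValue_eq hγ₀ hγ₁ hθ' b
  have h3 : (1 - γ • transMat (armPolicy s₁ b) (perturb v θ c g ε)) *ᵥ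
      (armValue s₁ γ (perturb v θ c g ε) b - armValue s₁ γ θ b) =
      ε • fun s => ∑ a, armPolicy s₁ b s a *
        (v s a * c s a + ∑ s', θ.1 s a s' * g s a s' * (γ * armValue s₁ γ θ b s')) := by
    ext s
    rw [sub_mulVec, one_mulVec, smul_mulVec]
    simp only [Pi.sub_apply, Pi.smul_apply, smul_eq_mul, sum_armPolicy_mul, mulVec, dotProduct,
      transMat_armPolicy, mul_sub, Finset.sum_sub_distrib]
    rw [h1 s, h2 s]
    simp only [perturb, mul_add, add_mul, mul_one, Finset.sum_add_distrib, Finset.mul_sum]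
    have e : ∀ x, ε * (θ.1 s (armAct s₁ b s) x * g s (armAct s₁ b s) x *
        (γ * armValue s₁ γ θ b x)) = γ * (θ.1 s (armAct s₁ b s) x *
          (ε * g s (armAct s₁ b s) x) * armValue s₁ γ θ b x) := fun x => by ring
    rw [Finset.sum_congr rfl fun x _ => e x]
    ring
  rw [← mulVec_smul, ← h3, mulVec_mulVec, resolvent,
    Matrix.nonsing_inv_mul _ (isUnit_resolvent hγ₀ hγ₁ hθ' (isPolicy_armPolicy s₁ b)), one_mulVec]

/-- The derivative of the treatment effect along the path `perturb`. -/
lemma tendsto_ate_perturb (u : S → ℝ) :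
    Tendsto (fun ε => (u ⬝ᵥ ate s₁ γ (perturb v θ c g ε) - u ⬝ᵥ ate s₁ γ θ) / ε) (𝓝[≠] 0)
      (𝓝 (∑ b, armSign b * (u ⬝ᵥ (resolvent s₁ γ θ b *ᵥ fun s => ∑ a, armPolicy s₁ b s a *
        (v s a * c s a + ∑ s', θ.1 s a s' * g s a s' * (γ * armValue s₁ γ θ b s')))))) := by
  have hlim : Tendsto (fun ε => ∑ b, armSign b * (u ⬝ᵥ (resolvent s₁ γ (perturb v θ c g ε) b *ᵥ
      fun s => ∑ a, armPolicy s₁ b s a *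
        (v s a * c s a + ∑ s', θ.1 s a s' * g s a s' * (γ * armValue s₁ γ θ b s'))))) (𝓝[≠] 0)
      (𝓝 (∑ b, armSign b * (u ⬝ᵥ (resolvent s₁ γ θ b *ᵥ fun s => ∑ a, armPolicy s₁ b s a *
        (v s a * c s a + ∑ s', θ.1 s a s' * g s a s' * (γ * armValue s₁ γ θ b s')))))) := by
    refine tendsto_finsetSum _ fun b _ => Tendsto.const_mul _ ?_
    have hR : Tendsto (fun ε => resolvent s₁ γ (perturb v θ c g ε) b) (𝓝[≠] 0)
        (𝓝 (resolvent s₁ γ θ b)) := by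
      refine tendsto_matrix_inv (isUnit_resolvent hγ₀ hγ₁ hθ (isPolicy_armPolicy s₁ b)) ?_
      have hc : Continuous fun θ' : Param S => 1 - γ • transMat (armPolicy s₁ b) θ' := by
        have h : Continuous fun θ' : Param S => transMat (armPolicy s₁ b) θ' := by
          refine continuous_matrix fun s s' => ?_
          simp only [transMat_armPolicy]
          fun_prop
        exact continuous_const.sub (h.const_smul γ)
      exact ((hc.tendsto θ).comp tendsto_perturb).mono_left nhdsWithin_le_nhds
    have hc : Continuous fun M : Matrix S S ℝ => u ⬝ᵥ (M *ᵥ fun s => ∑ a, armPolicy s₁ b s a *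
        (v s a * c s a + ∑ s', θ.1 s a s' * g s a s' * (γ * armValue s₁ γ θ b s'))) :=
      continuous_const.dotProduct (continuous_id.matrix_mulVec continuous_const)
    exact (hc.tendsto _).comp hR
  refine hlim.congr' ?_
  filter_upwards [self_mem_nhdsWithin, nhdsWithin_le_nhds (eventually_one_add_pos g)] with ε hε0 hε
  rw [dotProduct_ate, dotProduct_ate, ← Finset.sum_sub_distrib, Finset.sum_div]
  refine Finset.sum_congr rfl fun b _ => ?_
  rw [← mul_sub, ← dotProduct_sub, armValue_perturb_sub hγ₀ hγ₁ hθ hg b hε, dotProduct_smul,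
    smul_eq_mul, mul_left_comm, mul_div_cancel_left₀ _ (show ε ≠ 0 from hε0)]

end Differentiation

section CramerRao

variable {S : Type*} [Fintype S] [DecidableEq S] [MeasurableSpace S] [MeasurableSingletonClass S]

lemma dotProduct_estCov {T : ℕ} {L : Measure (Traj S T)} [IsProbabilityMeasure L]
    {est : Traj S T → S → ℝ} (h : ∀ s, MemLp (fun τ => est τ s) 2 L) (u : S → ℝ) :
    u ⬝ᵥ (estCov L est *ᵥ u) = Var[fun τ => u ⬝ᵥ est τ; L] := by
  have hu : ∀ s, MemLp (fun τ => u s * est τ s) 2 L := fun s => (h s).const_mul (u s)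
  rw [← covariance_self (by
    have := (memLp_finsetSum (μ := L) Finset.univ fun s _ => hu s)
    exact this.1.aemeasurable)]
  simp only [dotProduct]
  rw [covariance_fun_sum_fun_sum hu hu]
  simp only [mulVec, dotProduct, estCov, Matrix.of_apply, covariance_const_mul_left,
    covariance_const_mul_right, Finset.mul_sum]
  exact Finset.sum_congr rfl fun s _ => Finset.sum_congr rfl fun s' _ => by ring

lemma dotProduct_estMean {T : ℕ} {L : Measure (Traj S T)} {est : Traj S T → S → ℝ}
    (h : ∀ s, Integrable (fun τ => est τ s) L) (u : S → ℝ) :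
    u ⬝ᵥ estMean L est = ∫ τ, u ⬝ᵥ est τ ∂L := by
  simp only [dotProduct, estMean]
  rw [integral_finsetSum _ fun s _ => (h s).const_mul (u s)]
  simp only [integral_const_mul]

variable {s₁ : S} {γ : ℝ} (hγ₀ : 0 ≤ γ) (hγ₁ : γ < 1) {v : S → Arm → ℝ≥0} {θ : Param S}
  (hθ : θ ∈ models s₁) {μ : S → ℝ} (hμ : IsStationary (transMat (piHalf s₁) θ) μ)
  (hpos : ∀ s, 0 < μ s) {T : ℕ} {est : Traj S T → S → ℝ}
  (hL2 : ∀ s, MemLp (fun τ => est τ s) 2 (trajLaw (piHalf s₁) v μ T θ))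

include hγ₀ hγ₁ hθ hμ hpos hL2

/-- The Cramér-Rao bound for `u · Δ`: the Chapman-Robbins inequality along the least favourable
path, whose score is the influence function. -/
lemma dotProduct_sigmaIS_le (hub : LocallyUnbiased s₁ γ v μ T θ est) (u : S → ℝ) :
    u ⬝ᵥ (sigmaIS s₁ γ v θ μ *ᵥ u) ≤
      T * Var[fun τ => u ⬝ᵥ est τ; trajLaw (piHalf s₁) v μ T θ] := by
  have hprob := isProbabilityMeasure_trajLaw hθ v hμ.1 hμ.2.1 T
  set c := inflCoef s₁ γ θ μ u with hc
  set g := inflMean s₁ γ θ μ u with hgdef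
  have hg : ∀ s a, Available s₁ s a → ∑ s', θ.1 s a s' * g s a s' = 0 := fun s a ha =>
    sum_inflMean hγ₀ hγ₁ hθ hpos u (piHalf_ne_zero_of_available ha)
  set D := u ⬝ᵥ (sigmaIS s₁ γ v θ μ *ᵥ u) with hD
  have hD1 : D = ∑ s, μ s * condVar (piHalf s₁) v θ c g s := dotProduct_sigmaIS hγ₀ hγ₁ hθ hpos v u
  have hD0 : 0 ≤ D := by
    rw [hD1]
    exact Finset.sum_nonneg fun s _ => mul_nonneg (hpos s).le (condVar_nonneg hθ v _ _ s)
  have hate : Tendsto (fun ε => (u ⬝ᵥ ate s₁ γ (perturb v θ c g ε) - u ⬝ᵥ ate s₁ γ θ) / ε)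
      (𝓝[≠] 0) (𝓝 D) := by
    have := tendsto_ate_perturb hγ₀ hγ₁ (v := v) hθ (c := c) hg u
    rwa [← sum_condVar_infl hγ₀ hγ₁ hθ hpos v u, ← hD1] at this
  have hpath : Tendsto (perturb v θ c g) (𝓝[≠] 0) (𝓝[models s₁] θ) := by
    refine tendsto_nhdsWithin_iff.2 ⟨tendsto_perturb.mono_left nhdsWithin_le_nhds, ?_⟩
    filter_upwards [nhdsWithin_le_nhds (eventually_one_add_pos g)] with ε hε
    exact perturb_mem_models hθ hg hε
  -- the bias vanishes at `θ`, and it is `o(ε)` along the path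
  have hb0 : estMean (trajLaw (piHalf s₁) v μ T θ) est = ate s₁ γ θ := by
    have h := (hub.2.def one_pos).self_of_nhdsWithin hθ
    simpa [sub_eq_zero] using h
  have hbias : Tendsto (fun ε => (u ⬝ᵥ (estMean (trajLaw (piHalf s₁) v μ T (perturb v θ c g ε)) est -
      ate s₁ γ (perturb v θ c g ε))) / ε) (𝓝[≠] 0) (𝓝 0) := by
    have h1 := hub.2.comp_tendsto hpath
    have h2 : ((fun θ' => θ' - θ) ∘ perturb v θ c g) =O[𝓝[≠] 0] (fun ε : ℝ => ε) := by
      refine Asymptotics.IsBigO.of_bound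
        ‖((fun s a s' => θ.1 s a s' * g s a s', fun s a => v s a * c s a) : Param S)‖
        (Eventually.of_forall fun ε => ?_)
      rw [Function.comp_apply, perturb_sub, norm_smul, mul_comm]
    have h3 := h1.trans_isBigO h2
    have h4 : (fun ε => u ⬝ᵥ (estMean (trajLaw (piHalf s₁) v μ T (perturb v θ c g ε)) est -
        ate s₁ γ (perturb v θ c g ε))) =o[𝓝[≠] 0] (fun ε : ℝ => ε) := by
      simp only [dotProduct]
      refine Asymptotics.IsLittleO.fun_sum fun s _ => Asymptotics.IsLittleO.const_mul_left ?_ _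
      exact Asymptotics.isLittleO_pi.1 h3 s
    exact h4.tendsto_div_nhds_zero
  have hmean : Tendsto (fun ε => (u ⬝ᵥ estMean (trajLaw (piHalf s₁) v μ T (perturb v θ c g ε)) est -
      u ⬝ᵥ estMean (trajLaw (piHalf s₁) v μ T θ) est) / ε) (𝓝[≠] 0) (𝓝 D) := by
    have := hbias.add hate
    rw [zero_add] at this
    refine this.congr fun ε => ?_
    rw [hb0, dotProduct_sub]
    ring
  have hratio := (tendsto_trajRatio_sq (v := v) (c := c) hθ hμ hg T).const_mul
    (Var[fun τ => u ⬝ᵥ est τ; trajLaw (piHalf s₁) v μ T θ])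
  rw [← hD1] at hratio
  have hX : MemLp (fun τ => u ⬝ᵥ est τ) 2 (trajLaw (piHalf s₁) v μ T θ) := by
    simpa only [dotProduct] using memLp_finsetSum Finset.univ fun s _ => (hL2 s).const_mul (u s)
  have hle : D ^ 2 ≤ Var[fun τ => u ⬝ᵥ est τ; trajLaw (piHalf s₁) v μ T θ] * (T * D) := by
    refine le_of_tendsto_of_tendsto (hmean.pow 2) hratio ?_
    filter_upwards [nhdsWithin_le_nhds (eventually_one_add_pos g), hpath.eventually hub.1] with
      ε hε hint
    have hint' : Integrable (fun τ => u ⬝ᵥ est τ)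
        (trajLaw (piHalf s₁) v μ T (perturb v θ c g ε)) := by
      simp only [dotProduct]
      exact integrable_finsetSum _ fun s _ => (hint s).const_mul (u s)
    have h := sq_integral_perturb_sub_le hμ.1 hμ.2.1 hθ hg hε hX hint'
    rw [dotProduct_estMean hint, dotProduct_estMean fun s => (hL2 s).integrable one_le_two,
      div_pow, ← mul_div_assoc]
    exact div_le_div_of_nonneg_right h (sq_nonneg ε)
  rcases hD0.eq_or_lt with h | h
  · rw [← h]
    exact mul_nonneg (Nat.cast_nonneg T) (variance_nonneg _ _)
  · nlinarith

lemma posSemidef_estCov_sub_sigmaIS (hub : LocallyUnbiased s₁ γ v μ T θ est) :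
    ((T : ℝ) • estCov (trajLaw (piHalf s₁) v μ T θ) est - sigmaIS s₁ γ v θ μ).PosSemidef := by
  have hprob := isProbabilityMeasure_trajLaw hθ v hμ.1 hμ.2.1 T
  refine PosSemidef.of_dotProduct_mulVec_nonneg ?_ fun u => ?_
  · refine IsHermitian.sub ?_ (isHermitian_sigmaIS _ _ _ _ _)
    ext s s'
    simp [estCov, covariance_comm]
  · rw [star_trivial, sub_mulVec, smul_mulVec, dotProduct_sub, dotProduct_smul,
      dotProduct_estCov hL2, smul_eq_mul]
    linarith [dotProduct_sigmaIS_le hγ₀ hγ₁ hθ hμ hpos hL2 hub u]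

end CramerRao

section GlobalUnbiasedness

variable {S : Type*} [Fintype S] [DecidableEq S] [MeasurableSpace S] [MeasurableSingletonClass S]

/-- The parameters for which all transitions have the distribution `ν`, and where all the mean
rewards are zero, except for the mean reward `x` of the treatment in the crucial state. -/
def iidParam (s₁ : S) (ν : S → ℝ) (x : ℝ) : Param S :=
  (fun _ _ s' => ν s', fun s a => if s = s₁ ∧ a = Arm.t then x else 0)

lemma transMat_iidParam {s₁ : S} {ν : S → ℝ} {x : ℝ} {π : S → Arm → ℝ} (hπ : IsPolicy s₁ π) :
    transMat π (iidParam s₁ ν x) = Matrix.of fun _ s' => ν s' := by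
  ext s s'
  simp [transMat, iidParam, ← Finset.sum_mul, hπ.sum_eq_one]

lemma iidParam_mem_models {s₁ : S} {ν : S → ℝ} (h0 : ∀ s, 0 ≤ ν s) (h1 : ∑ s, ν s = 1) (x : ℝ) :
    iidParam s₁ ν x ∈ models s₁ := fun _ _ _ => ⟨h0, h1⟩

lemma uniformlyErgodic_of_const_rows {ν : S → ℝ} (h0 : ∀ s, 0 ≤ ν s) (h1 : ∑ s, ν s = 1) :
    UniformlyErgodic (Matrix.of fun _ s' => ν s') ν := by
  have hP : ∀ k : ℕ, (Matrix.of fun _ s' => ν s' : Matrix S S ℝ) ^ (k + 1) =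
      Matrix.of fun _ s' => ν s' := by
    intro k
    induction k with
    | zero => simp
    | succ k ih =>
      rw [pow_succ, ih]
      ext s s'
      simp [Matrix.mul_apply, ← Finset.sum_mul, h1]
  refine ⟨⟨h0, h1, ?_⟩, ∑ s, ((1 / 2) * ∑ s', |(1 : Matrix S S ℝ) s s' - ν s'|), 0, ?_, le_rfl,
    one_pos, fun k s => ?_⟩
  · ext s'; simp [vecMul, dotProduct, ← Finset.sum_mul, h1]
  · positivity
  · cases k with
    | zero =>
      simp only [pow_zero, mul_one]
      exact Finset.single_le_sum (f := fun s => (1 / 2) * ∑ s', |(1 : Matrix S S ℝ) s s' - ν s'|)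
        (fun i _ => by positivity) (Finset.mem_univ s)
    | succ k => simp [hP]

lemma ate_iidParam_zero (s₁ : S) (γ : ℝ) (ν : S → ℝ) : ate s₁ γ (iidParam s₁ ν 0) = 0 := by
  have h : ∀ π : S → Arm → ℝ, value γ π (iidParam s₁ ν 0) = 0 := by
    intro π
    have h0 : meanReward π (iidParam s₁ ν 0) = 0 := by
      ext s; simp [meanReward, iidParam]
    ext s; simp [value, h0]
  rw [ate, h, h, sub_zero]

lemma one_le_ate_iidParam {s₁ : S} {γ : ℝ} (hγ₀ : 0 ≤ γ) (hγ₁ : γ < 1) {ν : S → ℝ}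
    (h0 : ∀ s, 0 ≤ ν s) (h1 : ∑ s, ν s = 1) : 1 ≤ ate s₁ γ (iidParam s₁ ν 1) s₁ := by
  have hθ := iidParam_mem_models (s₁ := s₁) h0 h1 1
  have hC : value γ piC (iidParam s₁ ν 1) = 0 := by
    have h0 : meanReward piC (iidParam s₁ ν 1) = 0 := by
      ext s
      rw [meanReward, sum_arm]
      simp [piC, iidParam]
    ext s; simp [value, h0]
  have hr : ∀ s, 0 ≤ meanReward (piT s₁) (iidParam s₁ ν 1) s := by
    intro s
    rw [meanReward, sum_arm]
    by_cases hs : s = s₁ <;> simp [piT, iidParam, hs]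
  have hr1 : meanReward (piT s₁) (iidParam s₁ ν 1) s₁ = 1 := by
    rw [meanReward, sum_arm]
    simp [piT, iidParam]
  have hs := value_hasSum hγ₀ hγ₁ hθ (isPolicy_armPolicy s₁ Arm.t) s₁
  have hP : ∀ (k : ℕ) (s s' : S), 0 ≤ (transMat (piT s₁) (iidParam s₁ ν 1) ^ k) s s' := by
    intro k
    induction k with
    | zero => intro s s'; rw [pow_zero, Matrix.one_apply]; split_ifs <;> norm_num
    | succ k ih =>
      intro s s'
      rw [pow_succ, Matrix.mul_apply]
      exact Finset.sum_nonneg fun x _ => mul_nonneg (ih s x)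
        (transMat_nonneg hθ (isPolicy_armPolicy s₁ Arm.t) x s')
  have hle := le_hasSum hs 0 fun i _ => mul_nonneg (pow_nonneg hγ₀ i)
    (Finset.sum_nonneg fun s' _ => mul_nonneg (hP i s₁ s') (hr s'))
  rw [← value_eq hγ₀ hγ₁ hθ (isPolicy_armPolicy s₁ Arm.t)] at hle
  rw [ate, hC, sub_zero]
  refine le_trans (le_of_eq ?_) hle
  simp [armPolicy, hr1]

/-- Unbiasedness in all ergodic models, each one started from its stationary distribution, is only
possible if there is no state other than the crucial one. Otherwise there are models that visit the
crucial state with a probability as small as one likes. The treatment reward in this state then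
hardly influences the law of the data, but it always changes the treatment effect. -/
lemma GloballyUnbiased.subsingleton {s₁ : S} {γ : ℝ} (hγ₀ : 0 ≤ γ) (hγ₁ : γ < 1)
    {v : S → Arm → ℝ≥0} {T : ℕ} {est : Traj S T → S → ℝ} (h : GloballyUnbiased s₁ γ v T est) :
    Subsingleton S := by
  by_contra hS
  rw [not_subsingleton_iff_nontrivial] at hS
  have hcard : (1 : ℝ) < Fintype.card S := by exact_mod_cast Fintype.one_lt_card
  set ν : ℝ → S → ℝ := fun δ s => if s = s₁ then δ else (1 - δ) / (Fintype.card S - 1) with hν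
  have hν1 : ∀ δ, ∑ s, ν δ s = 1 := by
    intro δ
    rw [← Finset.add_sum_erase _ _ (Finset.mem_univ s₁), Finset.sum_congr rfl fun s hs =>
      if_neg (Finset.ne_of_mem_erase hs), Finset.sum_const, Finset.card_erase_of_mem
      (Finset.mem_univ _), Finset.card_univ, nsmul_eq_mul, Nat.cast_sub Fintype.card_pos]
    rw [Nat.cast_one, mul_div_cancel₀ _ (by linarith), show ν δ s₁ = δ from if_pos rfl]
    ring
  have hνpos : ∀ δ, 0 < δ → δ < 1 → ∀ s, 0 < ν δ s := by
    intro δ h0 h1 s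
    simp only [hν]
    split_ifs
    · exact h0
    · exact div_pos (by linarith) (by linarith)
  have hνle : ∀ δ, 0 < δ → δ < 1 → ∀ s, ν δ s ≤ 1 := by
    intro δ h0 h1 s
    rw [← hν1 δ]
    exact Finset.single_le_sum (f := ν δ) (fun i _ => (hνpos δ h0 h1 i).le) (Finset.mem_univ s)
  -- the expectation of the estimator given the states and the actions
  set I : ℝ → (Fin (T + 1) → S) → (Fin T → Arm) → ℝ := fun x s a =>
    ∫ y, est (s, a, y) s₁ ∂(rewardLaw v (iidParam s₁ (ν (1 / 2)) x) s a) with hI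
  have hmean : ∀ δ, 0 < δ → δ < 1 → ∀ x, ate s₁ γ (iidParam s₁ (ν δ) x) s₁ =
      ∑ s, ∑ a, pathWeight (piHalf s₁) (ν δ) (iidParam s₁ (ν δ) 0) s a * I x s a := by
    intro δ h0 h1 x
    have hmem := iidParam_mem_models (s₁ := s₁) (fun s => (hνpos δ h0 h1 s).le) (hν1 δ) x
    have herg := uniformlyErgodic_of_const_rows (fun s => (hνpos δ h0 h1 s).le) (hν1 δ)
    rw [← transMat_iidParam (x := x) (isPolicy_piHalf s₁)] at herg
    obtain ⟨hint, hest⟩ := h _ hmem _ herg (hνpos δ h0 h1)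
    rw [← hest, estMean, integral_trajLaw (pathWeight_nonneg hmem fun s => (hνpos δ h0 h1 s).le)
      (hint s₁)]
    rfl
  -- the paths through the crucial state have small probability, the other ones carry no information
  -- about the reward there
  have hsmall : ∀ δ, 0 < δ → δ < 1 → ∀ s a,
      pathWeight (piHalf s₁) (ν δ) (iidParam s₁ (ν δ) 0) s a * (I 1 s a - I 0 s a) ≤
        δ * |I 1 s a - I 0 s a| := by
    intro δ h0 h1 s a
    by_cases hvisit : ∃ j, s j = s₁
    · obtain ⟨j, hj⟩ := hvisit
      have hmem := iidParam_mem_models (s₁ := s₁) (fun s => (hνpos δ h0 h1 s).le) (hν1 δ) 0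
      have hw0 := pathWeight_nonneg hmem (fun s => (hνpos δ h0 h1 s).le) s a
      have hw1 : pathWeight (piHalf s₁) (ν δ) (iidParam s₁ (ν δ) 0) s a ≤ δ := by
        have e : pathWeight (piHalf s₁) (ν δ) (iidParam s₁ (ν δ) 0) s a =
            (∏ i : Fin T, piHalf s₁ (s i.castSucc) (a i)) * ∏ i, ν δ (s i) := by
          rw [pathWeight, Fin.prod_univ_succ (fun i => ν δ (s i)), Finset.prod_mul_distrib]
          simp only [iidParam]
          ring
        have hprod : ∏ i, ν δ (s i) ≤ δ := by
          rw [← Finset.mul_prod_erase _ _ (Finset.mem_univ j), hj]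
          have h2 : ν δ s₁ = δ := by simp [hν]
          rw [h2]
          exact mul_le_of_le_one_right h0.le (Finset.prod_le_one
            (fun i _ => (hνpos δ h0 h1 _).le) fun i _ => hνle δ h0 h1 _)
        rw [e]
        refine (mul_le_of_le_one_left (Finset.prod_nonneg fun i _ => (hνpos δ h0 h1 _).le)
          (Finset.prod_le_one (fun i _ => piHalf_nonneg _ _ _) fun i _ => ?_)).trans hprod
        rw [← sum_piHalf s₁ (s i.castSucc)]
        exact Finset.single_le_sum (f := piHalf s₁ (s i.castSucc))
          (fun _ _ => piHalf_nonneg _ _ _) (Finset.mem_univ _)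
      exact (mul_le_mul_of_nonneg_left (le_abs_self _) hw0).trans
        (mul_le_mul_of_nonneg_right hw1 (abs_nonneg _))
    · push Not at hvisit
      have : I 1 s a = I 0 s a := by
        simp only [hI, rewardLaw, iidParam, hvisit, false_and, if_false]
      rw [this, sub_self, mul_zero, abs_zero, mul_zero]
  set C := ∑ s, ∑ a, |I 1 s a - I 0 s a| with hC
  have hC0 : 0 ≤ C := by positivity
  set δ : ℝ := 1 / (C + 2) with hδ
  have hδ0 : 0 < δ := by positivity
  have hδ1 : δ < 1 := by rw [hδ, div_lt_one (by positivity)]; linarith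
  have h1 := one_le_ate_iidParam (s₁ := s₁) hγ₀ hγ₁ (fun s => (hνpos δ hδ0 hδ1 s).le) (hν1 δ)
  have h2 := congrFun (ate_iidParam_zero s₁ γ (ν δ)) s₁
  have h3 : ate s₁ γ (iidParam s₁ (ν δ) 1) s₁ - ate s₁ γ (iidParam s₁ (ν δ) 0) s₁ ≤ δ * C := by
    rw [hmean δ hδ0 hδ1, hmean δ hδ0 hδ1, ← Finset.sum_sub_distrib, hC, Finset.mul_sum]
    refine Finset.sum_le_sum fun s _ => ?_
    rw [← Finset.sum_sub_distrib, Finset.mul_sum]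
    refine Finset.sum_le_sum fun a _ => ?_
    rw [← mul_sub]
    exact hsmall δ hδ0 hδ1 s a
  have h4 : δ * C < 1 := by
    rw [hδ, one_div, inv_mul_lt_iff₀ (by positivity)]; linarith
  rw [h2, Pi.zero_apply] at h3
  linarith

/-- With a single state, every model is ergodic with the same stationary distribution. So the global
unbiasedness implies the local one. -/
lemma GloballyUnbiased.locallyUnbiased {s₁ : S} {γ : ℝ} (hγ₀ : 0 ≤ γ) (hγ₁ : γ < 1)
    {v : S → Arm → ℝ≥0} {T : ℕ} {est : Traj S T → S → ℝ} (h : GloballyUnbiased s₁ γ v T est)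
    {μ : S → ℝ} (hμ : ∑ s, μ s = 1) (θ : Param S) :
    LocallyUnbiased s₁ γ v μ T θ est := by
  have hS := h.subsingleton hγ₀ hγ₁
  have hsum : ∀ (f : S → ℝ) (s : S), ∑ x, f x = f s := fun f s => Fintype.sum_subsingleton f s
  have hμ1 : ∀ s, μ s = 1 := fun s => by rw [← hsum μ s, hμ]
  have key : ∀ θ' ∈ models s₁, _ := fun θ' hθ' => h θ' hθ' μ (by
    have hP : transMat (piHalf s₁) θ' = Matrix.of fun _ s' => μ s' := by
      ext s s'
      rw [Matrix.of_apply, hμ1, ← sum_transMat hθ' (isPolicy_piHalf s₁) s, hsum _ s']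
    rw [hP]
    exact uniformlyErgodic_of_const_rows (fun s => by simp [hμ1]) hμ) (fun s => by simp [hμ1])
  refine ⟨?_, ?_⟩
  · filter_upwards [self_mem_nhdsWithin] with θ' hθ' using (key θ' hθ').1
  · refine (Asymptotics.isLittleO_zero _ _).congr' ?_ EventuallyEq.rfl
    filter_upwards [self_mem_nhdsWithin] with θ' hθ'
    rw [(key θ' hθ').2, sub_self]

end GlobalUnbiasedness

/-! ### Limit theorems for sums along trajectories -/

section Asymptotics

lemma tendsto_inv_sqrt_nat : Tendsto (fun n : ℕ => (√(n : ℝ))⁻¹) atTop (𝓝 0) :=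
  (Real.tendsto_sqrt_atTop.comp tendsto_natCast_atTop_atTop).inv_tendsto_atTop

lemma tendsto_inv_sqrt_nat_complex :
    Tendsto (fun n : ℕ => (((√(n : ℝ))⁻¹ : ℝ) : ℂ)) atTop (𝓝 0) := by
  simpa [Function.comp_def] using (Complex.continuous_ofReal.tendsto 0).comp tendsto_inv_sqrt_nat

/-- The second-order expansion of the characteristic function of a Gaussian at `1 / √n`. -/
lemma tendsto_exp_second_order (g k : ℝ) :
    Tendsto (fun n : ℕ => (n : ℂ) * (Complex.exp (((√(n : ℝ))⁻¹ : ℝ) * g * Complex.I -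
        k * (((√(n : ℝ))⁻¹ : ℝ) : ℂ) ^ 2 / 2) - 1 - ((√(n : ℝ))⁻¹ : ℝ) * g * Complex.I))
      atTop (𝓝 (-(g ^ 2 + k) / 2)) := by
  set τ : ℕ → ℂ := fun n => (((√(n : ℝ))⁻¹ : ℝ) : ℂ) with hτ
  have hτ0 : Tendsto τ atTop (𝓝 0) := tendsto_inv_sqrt_nat_complex
  have hτn : ∀ n : ℕ, n ≠ 0 → (n : ℂ) * τ n ^ 2 = 1 := by
    intro n hn
    have : ((√(n : ℝ))⁻¹) ^ 2 = (n : ℝ)⁻¹ := by rw [inv_pow, Real.sq_sqrt (Nat.cast_nonneg n)]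
    rw [hτ]
    simp only
    rw [← Complex.ofReal_pow, this]
    push_cast
    exact mul_inv_cancel₀ (Nat.cast_ne_zero.2 hn)
  -- the exponent is `τ w` with `w → i g`
  set w : ℕ → ℂ := fun n => g * Complex.I - k * τ n / 2 with hw
  have hw0 : Tendsto w atTop (𝓝 (g * Complex.I)) := by
    have : Tendsto w atTop (𝓝 (g * Complex.I - k * 0 / 2)) :=
      tendsto_const_nhds.sub ((hτ0.const_mul _).div_const _)
    simpa using this
  set z : ℕ → ℂ := fun n => τ n * w n with hz
  have hz0 : Tendsto z atTop (𝓝 0) := by simpa using hτ0.mul hw0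
  have hrem : Tendsto (fun n : ℕ => (n : ℂ) * (Complex.exp (z n) - (1 + z n + z n ^ 2 / 2))) atTop
      (𝓝 0) := by
    have hb : Tendsto (fun n => ‖w n‖ ^ 2 * ‖z n‖ * (4 * (6 * 3 : ℝ)⁻¹)) atTop (𝓝 0) := by
      have := ((hw0.norm.pow 2).mul hz0.norm).mul_const (4 * (6 * 3 : ℝ)⁻¹)
      simpa using this
    refine squeeze_zero_norm' ?_ hb
    filter_upwards [hz0.norm.eventually_le_const (by simp : ‖(0 : ℂ)‖ < 1), eventually_ne_atTop 0]
      with n hn hn0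
    have h1 := Complex.exp_bound hn (n := 3) (by norm_num)
    have e : ∑ m ∈ Finset.range 3, z n ^ m / (m.factorial : ℂ) = 1 + z n + z n ^ 2 / 2 := by
      simp [Finset.sum_range_succ, Nat.factorial]
    rw [e] at h1
    rw [norm_mul]
    have h2 : ‖(n : ℂ)‖ * ‖z n‖ ^ 2 = ‖w n‖ ^ 2 := by
      rw [← norm_pow, ← norm_mul, hz]
      simp only
      rw [mul_pow, ← mul_assoc, hτn n hn0, one_mul, norm_pow]
    calc ‖(n : ℂ)‖ * ‖Complex.exp (z n) - (1 + z n + z n ^ 2 / 2)‖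
        ≤ ‖(n : ℂ)‖ * (‖z n‖ ^ 3 * (4 * (6 * 3 : ℝ)⁻¹)) := by
          refine mul_le_mul_of_nonneg_left (h1.trans (le_of_eq ?_)) (norm_nonneg _)
          norm_num [Nat.factorial]
      _ = (‖(n : ℂ)‖ * ‖z n‖ ^ 2) * ‖z n‖ * (4 * (6 * 3 : ℝ)⁻¹) := by ring
      _ = _ := by rw [h2]
  have hmain : Tendsto (fun n : ℕ => (n : ℂ) * (Complex.exp (z n) - (1 + z n + z n ^ 2 / 2)) +
      (w n ^ 2 / 2 - k / 2)) atTop (𝓝 (0 + ((g * Complex.I) ^ 2 / 2 - k / 2))) :=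
    hrem.add (((hw0.pow 2).div_const _).sub_const _)
  have e : (0 : ℂ) + ((g * Complex.I) ^ 2 / 2 - k / 2) = -(g ^ 2 + k) / 2 := by
    rw [mul_pow, Complex.I_sq]; ring
  rw [e] at hmain
  refine hmain.congr' ?_
  filter_upwards [eventually_ne_atTop 0] with n hn
  have h1 := hτn n hn
  have h2 : τ n * g * Complex.I - k * τ n ^ 2 / 2 = z n := by simp only [hz, hw]; ring
  change _ = (n : ℂ) * (Complex.exp (τ n * g * Complex.I - k * τ n ^ 2 / 2) - 1 -
    τ n * g * Complex.I)
  rw [h2]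
  have h3 : (n : ℂ) * z n ^ 2 = w n ^ 2 := by
    simp only [hz]; rw [mul_pow, ← mul_assoc, h1, one_mul]
  have h4 : (n : ℂ) * z n = n * (τ n * g * Complex.I) - k / 2 := by
    rw [← h2, mul_sub, ← mul_div_assoc, mul_left_comm _ (k : ℂ), h1, mul_one]
  linear_combination (-1 / 2 : ℂ) * h3 - h4

lemma tendsto_exp_first_order (x : ℂ) :
    Tendsto (fun n : ℕ => (n : ℂ) * (Complex.exp (x * (n : ℂ)⁻¹) - 1)) atTop (𝓝 x) := by
  have hd : HasDerivAt (fun t : ℂ => Complex.exp (x * t)) x 0 := by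
    simpa using ((hasDerivAt_id (0 : ℂ)).const_mul x).cexp
  have hn : Tendsto (fun n : ℕ => (n : ℂ)⁻¹) atTop (𝓝[≠] 0) := by
    refine tendsto_nhdsWithin_iff.2 ⟨by simpa using tendsto_inv_atTop_nhds_zero_nat (𝕜 := ℂ), ?_⟩
    filter_upwards [eventually_ne_atTop 0] with n hn
    exact inv_ne_zero (Nat.cast_ne_zero.2 hn)
  refine ((hasDerivAt_iff_tendsto_slope.1 hd).comp hn).congr fun n => ?_
  simp [slope_def_field, div_eq_mul_inv, mul_comm]

end Asymptotics

section LimitTheorems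

variable {S : Type*} [Fintype S] [DecidableEq S]

lemma UniformlyErgodic.tendsto_pow {P : Matrix S S ℝ} {μ : S → ℝ} (h : UniformlyErgodic P μ)
    (s s' : S) : Tendsto (fun k => (P ^ k) s s') atTop (𝓝 (μ s')) := by
  obtain ⟨-, C, lam, -, hl0, hl1, hle⟩ := h
  rw [tendsto_iff_norm_sub_tendsto_zero]
  have hb : Tendsto (fun k : ℕ => 2 * (C * lam ^ k)) atTop (𝓝 0) := by
    simpa using ((tendsto_pow_atTop_nhds_zero_of_lt_one hl0 hl1).const_mul C).const_mul 2
  refine squeeze_zero (fun k => norm_nonneg _) (fun k => ?_) hb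
  have h1 := hle k s
  have h2 := Finset.single_le_sum (f := fun x => |(P ^ k) s x - μ x|) (fun _ _ => abs_nonneg _)
    (Finset.mem_univ s')
  rw [Real.norm_eq_abs]
  linarith

variable {s₁ : S} {θ : Param S} (hθ : θ ∈ models s₁) {μ : S → ℝ}
  (herg : UniformlyErgodic (transMat (piHalf s₁) θ) μ)

include hθ herg

/-- The perturbation argument for transfer matrices with factors `φ n` of modulus at most one. -/
lemma tendsto_pow_of_factor {φ : ℕ → S → Arm → S → ℂ} (hφ : ∀ n s a s', ‖φ n s a s'‖ ≤ 1)
    (hφ1 : ∀ s a s', Tendsto (fun n => φ n s a s') atTop (𝓝 1)) {b : S → Arm → ℂ}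
    (hb : ∀ s a, piHalf s₁ s a ≠ 0 → Tendsto (fun n : ℕ => (n : ℂ) *
      ∑ s', (θ.1 s a s' : ℂ) * (φ n s a s' - 1)) atTop (𝓝 (b s a)))
    {A : ℕ → Matrix S S ℂ}
    (hA : ∀ n s s', A n s s' = ∑ a, ((piHalf s₁ s a * θ.1 s a s' : ℝ) : ℂ) * φ n s a s') :
    Tendsto (fun n : ℕ => (fun s => (μ s : ℂ)) ⬝ᵥ ((A n ^ n) *ᵥ 1)) atTop
      (𝓝 (Complex.exp (∑ s, μ s * ∑ a, (piHalf s₁ s a : ℂ) * b s a))) := by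
  have hw : ∀ s a s', 0 ≤ piHalf s₁ s a * θ.1 s a s' := by
    intro s a s'
    by_cases h : piHalf s₁ s a = 0
    · simp [h]
    · exact mul_nonneg (piHalf_nonneg _ _ _) ((hθ _ _ (available_of_piHalf_ne_zero h)).1 _)
  refine tendsto_pow_transfer herg.1.2.1 herg.1.2.2 herg.tendsto_pow (A := A) (fun n s => ?_)
    (fun s s' => ?_) (fun s => ?_)
  · rw [← sum_transMat hθ (isPolicy_piHalf s₁) s]
    refine Finset.sum_le_sum fun s' _ => ?_
    rw [hA, transMat, Matrix.of_apply]
    refine (norm_sum_le _ _).trans (Finset.sum_le_sum fun a _ => ?_)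
    rw [norm_mul, Complex.norm_real, Real.norm_of_nonneg (hw s a s')]
    exact mul_le_of_le_one_right (hw s a s') (hφ n s a s')
  · have h1 : Tendsto (fun n => ∑ a, ((piHalf s₁ s a * θ.1 s a s' : ℝ) : ℂ) * φ n s a s') atTop
        (𝓝 (∑ a, ((piHalf s₁ s a * θ.1 s a s' : ℝ) : ℂ) * 1)) :=
      tendsto_finsetSum _ fun a _ => (hφ1 s a s').const_mul _
    simp only [hA]
    convert h1 using 2
    simp [transMat]
  · have h1 : Tendsto (fun n : ℕ => ∑ a, (piHalf s₁ s a : ℂ) * ((n : ℂ) *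
        ∑ s', (θ.1 s a s' : ℂ) * (φ n s a s' - 1))) atTop
        (𝓝 (∑ a, (piHalf s₁ s a : ℂ) * b s a)) := by
      refine tendsto_finsetSum _ fun a _ => ?_
      by_cases h : piHalf s₁ s a = 0
      · simp [h]
      · exact (hb s a h).const_mul _
    refine h1.congr fun n => ?_
    have hone : (1 : ℂ) = ∑ s', ∑ a, ((piHalf s₁ s a * θ.1 s a s' : ℝ) : ℂ) := by
      rw [← Complex.ofReal_one, ← sum_transMat hθ (isPolicy_piHalf s₁) s]
      simp [transMat]
    have hrow : ∑ s', A n s s' - 1 =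
        ∑ a, (piHalf s₁ s a : ℂ) * ∑ s', (θ.1 s a s' : ℂ) * (φ n s a s' - 1) := by
      nth_rw 1 [hone]
      rw [← Finset.sum_sub_distrib]
      simp only [Finset.mul_sum]
      rw [Finset.sum_comm]
      refine Finset.sum_congr rfl fun s' _ => ?_
      rw [hA, ← Finset.sum_sub_distrib]
      refine Finset.sum_congr rfl fun a _ => ?_
      push_cast
      ring
    rw [hrow, Finset.mul_sum]
    exact Finset.sum_congr rfl fun a _ => by ring

variable {v : S → Arm → ℝ≥0} [MeasurableSpace S] [MeasurableSingletonClass S]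

/-- The sum of `c (y - r) + g` over a trajectory. -/
def pathSum (θ : Param S) (c : S → Arm → ℝ) (g : S → Arm → S → ℝ) {T : ℕ} (τ : Traj S T) : ℝ :=
  ∑ i : Fin T, (c (τ.1 i.castSucc) (τ.2.1 i) * (τ.2.2 i - θ.2 (τ.1 i.castSucc) (τ.2.1 i)) +
    g (τ.1 i.castSucc) (τ.2.1 i) (τ.1 i.succ))

/-- The central limit theorem, in terms of characteristic functions, for sums with conditional mean
zero. -/
lemma tendsto_integral_exp_pathSum {c : S → Arm → ℝ} {g : S → Arm → S → ℝ}
    (hg : ∀ s a, piHalf s₁ s a ≠ 0 → ∑ s', θ.1 s a s' * g s a s' = 0) :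
    Tendsto (fun T : ℕ => ∫ τ, Complex.exp (((√(T : ℝ))⁻¹ * pathSum θ c g τ : ℝ) * Complex.I)
        ∂(trajLaw (piHalf s₁) v μ T θ)) atTop
      (𝓝 (Complex.exp (-(∑ s, μ s * condVar (piHalf s₁) v θ c g s : ℝ) / 2))) := by
  set φ : ℕ → S → Arm → S → ℂ := fun n s a s' => Complex.exp (((√(n : ℝ))⁻¹ : ℝ) * (g s a s' : ℝ) *
    Complex.I - ((v s a * c s a ^ 2 : ℝ) : ℂ) * (((√(n : ℝ))⁻¹ : ℝ) : ℂ) ^ 2 / 2) with hφ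
  set ψ : ℕ → S → Arm → S → ℝ → ℂ := fun n s a s' y =>
    Complex.exp (((√(n : ℝ))⁻¹ * (c s a * (y - θ.2 s a) + g s a s') : ℝ) * Complex.I) with hψ
  have hψint : ∀ n s a s', Integrable (ψ n s a s') (gaussianReal (θ.2 s a) (v s a)) := by
    intro n s a s'
    refine Integrable.of_bound (C := 1) (by fun_prop) (ae_of_all _ fun y => ?_)
    rw [hψ, Complex.norm_exp_ofReal_mul_I]
  have hψφ : ∀ n s a s', ∫ y, ψ n s a s' y ∂(gaussianReal (θ.2 s a) (v s a)) = φ n s a s' := by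
    intro n s a s'
    have h := charFun_gaussianReal (μ := θ.2 s a) (v := v s a) ((√(n : ℝ))⁻¹ * c s a)
    rw [charFun_apply_real] at h
    have e : ∀ y : ℝ, ψ n s a s' y =
        Complex.exp (((√(n : ℝ))⁻¹ * (g s a s' - c s a * θ.2 s a) : ℝ) * Complex.I) *
          Complex.exp (((√(n : ℝ))⁻¹ * c s a : ℝ) * y * Complex.I) := by
      intro y
      simp only [hψ]
      rw [← Complex.exp_add]
      congr 1
      push_cast
      ring
    rw [integral_congr_ae (ae_of_all _ e), integral_const_mul, h, ← Complex.exp_add, hφ]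
    congr 1
    push_cast
    ring
  have hlim := tendsto_pow_of_factor hθ herg (φ := φ)
    (b := fun s a => -((∑ s', θ.1 s a s' * g s a s' ^ 2 + v s a * c s a ^ 2 : ℝ) : ℂ) / 2)
    (A := fun n => transferMat (piHalf s₁) v θ (ψ n)) ?_ ?_ ?_ ?_
  · have he : Complex.exp (∑ s, μ s * ∑ a, (piHalf s₁ s a : ℂ) *
        (-((∑ s', θ.1 s a s' * g s a s' ^ 2 + v s a * c s a ^ 2 : ℝ) : ℂ) / 2)) =
        Complex.exp (-(∑ s, μ s * condVar (piHalf s₁) v θ c g s : ℝ) / 2) := by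
      congr 1
      simp only [condVar]
      push_cast
      rw [← Finset.sum_neg_distrib, Finset.sum_div]
      refine Finset.sum_congr rfl fun s _ => ?_
      rw [← mul_neg, mul_div_assoc, ← Finset.sum_neg_distrib, Finset.sum_div]
      congr 1
      exact Finset.sum_congr rfl fun a _ => by ring
    rw [he] at hlim
    refine hlim.congr fun T => ?_
    refine (integral_prod_trajLaw (𝕜 := ℂ) (pathWeight_nonneg hθ herg.1.1)
      (hψint T)).symm.trans ?_
    refine integral_congr_ae (ae_of_all _ fun τ => ?_)
    simp only [hψ, pathSum]
    rw [← Complex.exp_sum, Finset.mul_sum]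
    push_cast
    rw [Finset.sum_mul]
  · intro n s a s'
    rw [hφ, Complex.norm_exp]
    simp only [← Complex.ofReal_mul, ← Complex.ofReal_pow]
    rw [Complex.sub_re, Complex.re_ofReal_mul, Complex.I_re, mul_zero, zero_sub, Real.exp_le_one_iff,
      ← Complex.ofReal_ofNat, ← Complex.ofReal_div, Complex.ofReal_re, neg_nonpos]
    positivity
  · intro s a s'
    have h0 := tendsto_inv_sqrt_nat_complex
    have h1 : Tendsto (fun n : ℕ => (((√(n : ℝ))⁻¹ : ℝ) : ℂ) * (g s a s' : ℝ) *
        Complex.I - ((v s a * c s a ^ 2 : ℝ) : ℂ) * (((√(n : ℝ))⁻¹ : ℝ) : ℂ) ^ 2 / 2) atTop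
        (𝓝 (0 * (g s a s' : ℝ) * Complex.I - ((v s a * c s a ^ 2 : ℝ) : ℂ) * 0 ^ 2 / 2)) :=
      ((h0.mul_const _).mul_const _).sub (((h0.pow 2).const_mul _).div_const _)
    have h2 := (Complex.continuous_exp.tendsto _).comp h1
    simpa [hφ, Function.comp_def] using h2
  · intro s a ha
    have hone := (hθ _ _ (available_of_piHalf_ne_zero ha)).2
    have h0 : ∑ s', (θ.1 s a s' : ℂ) * (g s a s' : ℂ) = 0 := by exact_mod_cast hg s a ha
    have h1 := tendsto_finsetSum (Finset.univ : Finset S) fun s' _ =>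
      (tendsto_exp_second_order (g s a s') (v s a * c s a ^ 2)).const_mul (θ.1 s a s' : ℂ)
    have e : ∑ s', (θ.1 s a s' : ℂ) * (-((g s a s' : ℂ) ^ 2 + ((v s a * c s a ^ 2 : ℝ) : ℂ)) / 2) =
        -((∑ s', θ.1 s a s' * g s a s' ^ 2 + v s a * c s a ^ 2 : ℝ) : ℂ) / 2 := by
      have hone' : ∑ s', (θ.1 s a s' : ℂ) = 1 := by exact_mod_cast hone
      have : ∀ s', (θ.1 s a s' : ℂ) * (-((g s a s' : ℂ) ^ 2 + ((v s a * c s a ^ 2 : ℝ) : ℂ)) / 2) =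
          (-1 / 2) * ((θ.1 s a s' : ℂ) * (g s a s' : ℂ) ^ 2) +
            (θ.1 s a s' : ℂ) * (-((v s a * c s a ^ 2 : ℝ) : ℂ) / 2) := fun s' => by ring
      rw [Finset.sum_congr rfl fun s' _ => this s', Finset.sum_add_distrib, ← Finset.mul_sum,
        ← Finset.sum_mul, hone']
      push_cast
      ring
    rw [e] at h1
    refine h1.congr fun n => ?_
    have h2 : ∀ s', (θ.1 s a s' : ℂ) * ((n : ℂ) * (φ n s a s' - 1 -
        (((√(n : ℝ))⁻¹ : ℝ) : ℂ) * (g s a s' : ℂ) * Complex.I)) =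
        n * ((θ.1 s a s' : ℂ) * (φ n s a s' - 1)) -
        (n * (((√(n : ℝ))⁻¹ : ℝ) : ℂ) * Complex.I) * ((θ.1 s a s' : ℂ) * (g s a s' : ℂ)) :=
      fun s' => by ring
    rw [Finset.sum_congr rfl fun s' _ => h2 s', Finset.sum_sub_distrib, ← Finset.mul_sum,
      ← Finset.mul_sum, h0, mul_zero, sub_zero]
  · intro n s s'
    simp only [transferMat, Matrix.of_apply, hψφ]
    rfl

/-- The law of large numbers, in terms of characteristic functions, for functions of the
transitions. -/
lemma tendsto_integral_exp_mean (f : S → Arm → S → ℝ) :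
    Tendsto (fun T : ℕ => ∫ τ, Complex.exp (((T : ℝ)⁻¹ *
        ∑ i : Fin T, f (τ.1 i.castSucc) (τ.2.1 i) (τ.1 i.succ) : ℝ) * Complex.I)
        ∂(trajLaw (piHalf s₁) v μ T θ)) atTop
      (𝓝 (Complex.exp ((∑ s, μ s * ∑ a, piHalf s₁ s a * ∑ s', θ.1 s a s' * f s a s' : ℝ) *
        Complex.I))) := by
  set φ : ℕ → S → Arm → S → ℂ := fun n s a s' =>
    Complex.exp (((n : ℝ)⁻¹ * f s a s' : ℝ) * Complex.I) with hφ
  have hlim := tendsto_pow_of_factor hθ herg (φ := φ)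
    (b := fun s a => ((∑ s', θ.1 s a s' * f s a s' : ℝ) : ℂ) * Complex.I)
    (A := fun n => transferMat (piHalf s₁) v θ fun s a s' _ => φ n s a s') ?_ ?_ ?_ ?_
  · have he : Complex.exp (∑ s, μ s * ∑ a, (piHalf s₁ s a : ℂ) *
        (((∑ s', θ.1 s a s' * f s a s' : ℝ) : ℂ) * Complex.I)) =
        Complex.exp ((∑ s, μ s * ∑ a, piHalf s₁ s a * ∑ s', θ.1 s a s' * f s a s' : ℝ) *
          Complex.I) := by
      congr 1
      push_cast
      simp only [← mul_assoc, ← Finset.sum_mul]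
    rw [he] at hlim
    refine hlim.congr fun T => ?_
    refine (integral_prod_trajLaw (𝕜 := ℂ) (φ := fun s a s' _ => φ T s a s')
      (pathWeight_nonneg hθ herg.1.1) (fun s a s' => integrable_const _)).symm.trans ?_
    refine integral_congr_ae (ae_of_all _ fun τ => ?_)
    simp only [hφ]
    rw [← Complex.exp_sum, Finset.mul_sum]
    push_cast
    rw [Finset.sum_mul]
  · intro n s a s'
    rw [hφ, Complex.norm_exp_ofReal_mul_I]
  · intro s a s'
    have h1 : Tendsto (fun n : ℕ => (n : ℝ)⁻¹ * f s a s') atTop (𝓝 (0 * f s a s')) :=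
      (tendsto_inv_atTop_nhds_zero_nat (𝕜 := ℝ)).mul_const _
    have hc : Continuous fun x : ℝ => Complex.exp (x * Complex.I) := by fun_prop
    have h2 := (hc.tendsto _).comp h1
    simpa [hφ, Function.comp_def] using h2
  · intro s a _
    have h1 := tendsto_finsetSum (Finset.univ : Finset S) fun s' _ =>
      (tendsto_exp_first_order (f s a s' * Complex.I)).const_mul (θ.1 s a s' : ℂ)
    have e : ∑ s', (θ.1 s a s' : ℂ) * (f s a s' * Complex.I) =
        ((∑ s', θ.1 s a s' * f s a s' : ℝ) : ℂ) * Complex.I := by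
      push_cast
      simp only [← mul_assoc, ← Finset.sum_mul]
    rw [e] at h1
    refine h1.congr fun n => ?_
    rw [Finset.mul_sum]
    refine Finset.sum_congr rfl fun s' _ => ?_
    rw [mul_left_comm, hφ]
    simp only
    congr 4
    push_cast
    ring
  · intro n s s'
    simp [transferMat]

end LimitTheorems

/-! ### Convergence in probability -/

section Probability

variable {Ω : ℕ → Type*} [∀ n, MeasurableSpace (Ω n)] {P : ∀ n, Measure (Ω n)}

/-- Convergence to zero in probability, where the probability space may vary along the sequence. -/
def TendstoZeroInProb (P : ∀ n, Measure (Ω n)) (X : ∀ n, Ω n → ℝ) : Prop :=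
  ∀ ε > 0, Tendsto (fun n => P n {ω | ε ≤ |X n ω|}) atTop (𝓝 0)

/-- Boundedness in probability, where the probability space may vary along the sequence. -/
def BoundedInProb (P : ∀ n, Measure (Ω n)) (X : ∀ n, Ω n → ℝ) : Prop :=
  ∀ η > 0, ∃ M : ℝ, ∀ n, P n {ω | M < |X n ω|} ≤ η

/-- It suffices that the sequence agrees with one that converges to zero in probability, on events
with probability tending to one. -/
lemma TendstoZeroInProb.congr {X Y : ∀ n, Ω n → ℝ} (hX : TendstoZeroInProb P X)
    {B : ∀ n, Set (Ω n)} (hB : Tendsto (fun n => P n (B n)) atTop (𝓝 0))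
    (h : ∀ᶠ n in atTop, ∀ ω, ω ∉ B n → X n ω = Y n ω) : TendstoZeroInProb P Y := by
  intro ε hε
  have h1 := (hX ε hε).add hB
  rw [add_zero] at h1
  refine tendsto_of_tendsto_of_tendsto_of_le_of_le' tendsto_const_nhds h1
    (Eventually.of_forall fun n => zero_le) ?_
  filter_upwards [h] with n hn
  refine (measure_mono fun ω hω => ?_).trans (measure_union_le _ _)
  by_cases hb : ω ∈ B n
  · exact Or.inr hb
  · left
    rw [Set.mem_ofPred_eq, hn ω hb]
    exact hω

lemma TendstoZeroInProb.add {X Y : ∀ n, Ω n → ℝ} (hX : TendstoZeroInProb P X)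
    (hY : TendstoZeroInProb P Y) : TendstoZeroInProb P fun n ω => X n ω + Y n ω := by
  intro ε hε
  have h1 := (hX (ε / 2) (by positivity)).add (hY (ε / 2) (by positivity))
  rw [add_zero] at h1
  refine tendsto_of_tendsto_of_tendsto_of_le_of_le tendsto_const_nhds h1
    (fun n => zero_le) fun n => ?_
  refine (measure_mono fun ω hω => ?_).trans (measure_union_le _ _)
  by_contra hne
  simp only [Set.mem_union, Set.mem_ofPred_eq, not_or, not_le] at hne hω
  have := abs_add_le (X n ω) (Y n ω)
  linarith

lemma tendstoZeroInProb_zero : TendstoZeroInProb P fun _ _ => 0 := by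
  intro ε hε
  simp [not_le.2 hε]

lemma TendstoZeroInProb.sum {ι : Type*} {X : ι → ∀ n, Ω n → ℝ} (s : Finset ι)
    (h : ∀ i ∈ s, TendstoZeroInProb P (X i)) : TendstoZeroInProb P fun n ω => ∑ i ∈ s, X i n ω := by
  classical
  induction s using Finset.induction_on with
  | empty => simpa using tendstoZeroInProb_zero
  | insert i s hi ih =>
    simp only [Finset.sum_insert hi]
    exact (h i (Finset.mem_insert_self _ _)).add
      (ih fun j hj => h j (Finset.mem_insert_of_mem hj))

lemma TendstoZeroInProb.abs {X : ∀ n, Ω n → ℝ} (hX : TendstoZeroInProb P X) :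
    TendstoZeroInProb P fun n ω => |X n ω| := by
  intro ε hε
  simpa only [abs_abs] using hX ε hε

lemma TendstoZeroInProb.mul_bounded {X Z : ∀ n, Ω n → ℝ} (hX : TendstoZeroInProb P X)
    (hZ : BoundedInProb P Z) : TendstoZeroInProb P fun n ω => X n ω * Z n ω := by
  intro ε hε
  rw [ENNReal.tendsto_nhds_zero]
  intro η hη
  obtain ⟨M, hM⟩ := hZ (η / 2) (ENNReal.half_pos hη.ne')
  have hK : 0 < |M| + 1 := by positivity
  have h1 := ENNReal.tendsto_nhds_zero.1 (hX (ε / (|M| + 1)) (by positivity)) (η / 2)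
    (ENNReal.half_pos hη.ne')
  filter_upwards [h1] with n hn
  refine (measure_mono fun ω hω => ?_).trans ((measure_union_le _ _).trans
    ((add_le_add hn (hM n)).trans (ENNReal.add_halves η).le))
  by_contra hne
  simp only [Set.mem_union, Set.mem_ofPred_eq, not_or, not_le, not_lt, abs_mul] at hne hω
  have h2 : |Z n ω| < |M| + 1 := (hne.2.trans (le_abs_self M)).trans_lt (lt_add_one _)
  have h3 : |X n ω| * |Z n ω| < ε / (|M| + 1) * (|M| + 1) := by
    rcases (abs_nonneg (X n ω)).eq_or_lt with h0 | h0
    · rw [← h0, zero_mul]; positivity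
    · exact mul_lt_mul'' hne.1 h2 (abs_nonneg _) (abs_nonneg _)
  rw [div_mul_cancel₀ _ hK.ne'] at h3
  linarith

lemma TendstoZeroInProb.const_mul {X : ∀ n, Ω n → ℝ} (hX : TendstoZeroInProb P X) (c : ℝ) :
    TendstoZeroInProb P fun n ω => c * X n ω := by
  intro ε hε
  refine tendsto_of_tendsto_of_tendsto_of_le_of_le tendsto_const_nhds
    (hX (ε / (|c| + 1)) (by positivity)) (fun n => zero_le) fun n => measure_mono fun ω hω => ?_
  rw [Set.mem_ofPred_eq, abs_mul] at hω
  rw [Set.mem_ofPred_eq, div_le_iff₀ (by positivity)]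
  nlinarith [abs_nonneg (X n ω)]

/-- The continuous mapping theorem for limits in probability. -/
lemma tendsto_measure_notMem_nhds {ι : Type*} [Fintype ι] {K : ∀ n, Ω n → ι → ℝ} {k : ι → ℝ}
    (h : ∀ i, TendstoZeroInProb P fun n ω => K n ω i - k i) {U : Set (ι → ℝ)} (hU : U ∈ 𝓝 k) :
    Tendsto (fun n => P n {ω | K n ω ∉ U}) atTop (𝓝 0) := by
  obtain ⟨δ, hδ, hball⟩ := Metric.mem_nhds_iff.1 hU
  have h1 := tendsto_finsetSum (Finset.univ : Finset ι) fun i _ => h i δ hδ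
  rw [Finset.sum_const_zero] at h1
  refine tendsto_of_tendsto_of_tendsto_of_le_of_le tendsto_const_nhds h1
    (fun n => zero_le) fun n => ?_
  refine (measure_mono fun ω hω => ?_).trans (measure_biUnion_finset_le _ _)
  by_contra hne
  simp only [Set.mem_iUnion, Set.mem_ofPred_eq, not_exists, not_le, Finset.mem_univ,
    true_imp_iff] at hne
  refine hω (hball ?_)
  rw [Metric.mem_ball, dist_pi_lt_iff hδ]
  exact fun i => hne i

variable [∀ n, IsProbabilityMeasure (P n)]

lemma charFun_map_eq {X : ∀ n, Ω n → ℝ} (hX : ∀ n, Measurable (X n)) (n : ℕ) (t : ℝ) :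
    charFun ((P n).map (X n)) t = ∫ ω, Complex.exp ((t * X n ω : ℝ) * Complex.I) ∂(P n) := by
  rw [charFun_apply_real, integral_map (hX n).aemeasurable (by fun_prop)]
  push_cast
  rfl

/-- Lévy's continuity theorem for a constant limit. -/
lemma tendstoZeroInProb_of_charFun {X : ∀ n, Ω n → ℝ} (hX : ∀ n, Measurable (X n)) {m : ℝ}
    (h : ∀ t : ℝ, Tendsto (fun n => ∫ ω, Complex.exp ((t * X n ω : ℝ) * Complex.I) ∂(P n)) atTop
      (𝓝 (Complex.exp ((t * m : ℝ) * Complex.I)))) :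
    TendstoZeroInProb P fun n ω => X n ω - m := by
  intro ε hε
  have hp : ∀ n, IsProbabilityMeasure ((P n).map (X n)) := fun n =>
    Measure.isProbabilityMeasure_map (hX n).aemeasurable
  have hlim : Tendsto (β := ProbabilityMeasure ℝ) (fun n => ⟨(P n).map (X n), hp n⟩) atTop
      (𝓝 ⟨Measure.dirac m, inferInstance⟩) := by
    refine ProbabilityMeasure.tendsto_of_tendsto_charFun fun t => ?_
    simp only [ProbabilityMeasure.coe_mk, charFun_map_eq hX, charFun_dirac]
    convert h t using 3
    simp [mul_comm]
  have hms : MeasurableSet {x : ℝ | ε ≤ |x - m|} := measurableSet_le (by fun_prop) (by fun_prop)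
  have hfr : frontier {x : ℝ | ε ≤ |x - m|} ⊆ {x | ε = |x - m|} :=
    frontier_le_subset_eq continuous_const (by fun_prop)
  have h1 := ProbabilityMeasure.tendsto_measure_of_null_frontier_of_tendsto' hlim
    (E := {x : ℝ | ε ≤ |x - m|}) (by
      refine measure_mono_null hfr ?_
      rw [ProbabilityMeasure.coe_mk, Measure.dirac_apply' _
        (measurableSet_eq_fun (by fun_prop) (by fun_prop))]
      simp [hε.ne'])
  simp only [ProbabilityMeasure.coe_mk] at h1
  rw [Measure.dirac_apply' _ hms] at h1
  simp only [Set.indicator, Set.mem_ofPred_eq, sub_self, abs_zero, not_le.2 hε, if_false] at h1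
  refine h1.congr fun n => ?_
  rw [Measure.map_apply (hX n) hms]
  rfl

/-- Convergence of the characteristic functions implies tightness. -/
lemma boundedInProb_of_charFun {X : ∀ n, Ω n → ℝ} (hX : ∀ n, Measurable (X n)) {f : ℝ → ℂ}
    (hf : ContinuousAt f 0)
    (h : ∀ t : ℝ, Tendsto (fun n => ∫ ω, Complex.exp ((t * X n ω : ℝ) * Complex.I) ∂(P n)) atTop
      (𝓝 (f t))) : BoundedInProb P X := by
  intro η hη
  have hp : ∀ n, IsProbabilityMeasure ((P n).map (X n)) := fun n =>
    Measure.isProbabilityMeasure_map (hX n).aemeasurable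
  have ht := isTightMeasureSet_of_tendsto_charFun (μ := fun n => (P n).map (X n)) hf fun t => by
    simpa only [charFun_map_eq hX] using h t
  rw [isTightMeasureSet_iff_tendsto_measure_norm_gt, ENNReal.tendsto_nhds_zero] at ht
  obtain ⟨M, hM⟩ := (ht η hη).exists
  refine ⟨M, fun n => ?_⟩
  have h1 := (le_iSup₂ (f := fun (ν : Measure ℝ) (_ : ν ∈ Set.range fun n => (P n).map (X n)) =>
    ν {x | M < ‖x‖}) _ ⟨n, rfl⟩).trans hM
  dsimp only at h1
  rwa [Measure.map_apply (hX n) (measurableSet_lt (by fun_prop) (by fun_prop))] at h1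

/-- A sequence of random vectors whose difference from `X` converges to zero in probability has the
same weak limit as `X`. -/
lemma tendsto_integral_of_charFun {S : Type*} [Fintype S] {X Y : ∀ n, Ω n → EuclideanSpace ℝ S}
    (hX : ∀ n, Measurable (X n)) (hY : ∀ n, Measurable (Y n)) {ν : Measure (EuclideanSpace ℝ S)}
    [IsProbabilityMeasure ν]
    (hchar : ∀ t, Tendsto (fun n => charFun ((P n).map (X n)) t) atTop (𝓝 (charFun ν t)))
    (hXY : ∀ s, TendstoZeroInProb P fun n ω => Y n ω s - X n ω s)
    (f : EuclideanSpace ℝ S →ᵇ ℝ) :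
    Tendsto (fun n => ∫ ω, f (Y n ω) ∂(P n)) atTop (𝓝 (∫ x, f x ∂ν)) := by
  -- realize the whole sequence on one probability space
  set Q := Measure.infinitePi P with hQ
  have hev : ∀ n, Q.map (fun ω => ω n) = P n := fun n => Measure.infinitePi_map_eval P n
  have hme : ∀ n, Measurable fun ω : ∀ n, Ω n => ω n := fun n => measurable_pi_apply n
  have hmap : ∀ (Z : ∀ n, Ω n → EuclideanSpace ℝ S), (∀ n, Measurable (Z n)) → ∀ n,
      Q.map (fun ω => Z n (ω n)) = (P n).map (Z n) := by
    intro Z hZ n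
    rw [← hev n, Measure.map_map (hZ n) (hme n)]
    rfl
  have hdist : TendstoInDistribution (fun n ω => X n (ω n)) atTop (id : EuclideanSpace ℝ S → _)
      (fun _ => Q) ν := by
    refine ⟨fun n => ((hX n).comp (hme n)).aemeasurable, aemeasurable_id, ?_⟩
    refine ProbabilityMeasure.tendsto_of_tendsto_charFun fun t => ?_
    simp only [ProbabilityMeasure.coe_mk, Measure.map_id, hmap X hX]
    exact hchar t
  have hmeas : TendstoInMeasure Q ((fun n ω => Y n (ω n)) - fun n ω => X n (ω n)) atTop 0 := by
    rw [tendstoInMeasure_iff_norm]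
    intro ε hε
    have hsum := TendstoZeroInProb.sum (P := P) Finset.univ fun s _ => (hXY s).abs
    refine tendsto_of_tendsto_of_tendsto_of_le_of_le tendsto_const_nhds (hsum ε hε)
      (fun n => zero_le) fun n => ?_
    have hms : MeasurableSet {ω : Ω n | ε ≤ ‖Y n ω - X n ω‖} :=
      measurableSet_le measurable_const ((hY n).sub (hX n)).norm
    have h1 : Q {ω | ε ≤ ‖Y n (ω n) - X n (ω n)‖} = P n {ω : Ω n | ε ≤ ‖Y n ω - X n ω‖} := by
      conv_rhs => rw [← hev n]
      rw [Measure.map_apply (hme n) hms]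
      rfl
    simp only [Pi.sub_apply, Pi.zero_apply, sub_zero]
    rw [h1]
    refine measure_mono fun ω hω => ?_
    rw [Set.mem_ofPred_eq] at hω ⊢
    refine le_trans (le_trans hω ?_) (le_abs_self _)
    rw [EuclideanSpace.norm_eq]
    refine Real.sqrt_le_iff.2 ⟨Finset.sum_nonneg fun _ _ => abs_nonneg _, ?_⟩
    simp only [PiLp.sub_apply, Real.norm_eq_abs]
    exact Finset.sum_sq_le_sq_sum_of_nonneg fun _ _ => abs_nonneg _
  have hYm : ∀ n, AEMeasurable (fun ω : ∀ n, Ω n => Y n (ω n)) Q :=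
    fun n => ((hY n).comp (hme n)).aemeasurable
  have hfin : TendstoInDistribution (fun n ω => Y n (ω n)) atTop (id : EuclideanSpace ℝ S → _)
      (fun _ => Q) ν := tendstoInDistribution_of_tendstoInMeasure_sub _ _ hdist hmeas hYm
  have h1 := ProbabilityMeasure.tendsto_iff_forall_integral_tendsto.1 hfin.tendsto f
  have h2 : ∀ n, ∫ ω, f (Y n ω) ∂(P n) = ∫ x, f x ∂(Q.map fun ω => Y n (ω n)) := fun n => by
    rw [hmap Y hY, integral_map (hY n).aemeasurable f.continuous.aestronglyMeasurable]
  simp only [h2]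
  simpa only [ProbabilityMeasure.coe_mk, Measure.map_id] using h1

end Probability

/-! ### The information-sharing estimator -/

section Estimator

variable {S : Type*} [Fintype S] [DecidableEq S]

/-- The number of transitions from `s` to `s'` in the data set of the arm `b`. -/
def transCount (s₁ : S) (b : Arm) {T : ℕ} (τ : Traj S T) (s s' : S) : ℝ :=
  ∑ i : Fin T, share s₁ b (τ.1 i.castSucc) (τ.2.1 i) *
    (if τ.1 i.castSucc = s ∧ τ.1 i.succ = s' then 1 else 0)

/-- The sum of the temporal difference errors, with respect to the true value function, of the
samples from the state `s` in the data set of the arm `b`. -/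
def tdSum (s₁ : S) (γ : ℝ) (θ : Param S) (b : Arm) (s : S) {T : ℕ} (τ : Traj S T) : ℝ :=
  pathSum θ (fun x a => share s₁ b x a * if x = s then 1 else 0)
    (fun x a x' => share s₁ b x a * (if x = s then 1 else 0) * tdMean s₁ γ θ b x a x') τ

/-- The matrix that maps the scaled temporal difference sums to the scaled estimation error of the
value function, as a function of the transition frequencies. -/
def errorMat (γ : ℝ) (k : S × S → ℝ) : Matrix S S ℝ :=
  (1 - γ • Matrix.of fun s s' => k (s, s') / ∑ x, k (s, x))⁻¹ *
    Matrix.diagonal fun s => (∑ x, k (s, x))⁻¹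

/-- The long-run transition frequencies in the data set of the arm `b`. -/
def limitFreq (s₁ : S) (θ : Param S) (μ : S → ℝ) (b : Arm) (p : S × S) : ℝ :=
  freq s₁ μ p.1 * transMat (armPolicy s₁ b) θ p.1 p.2

lemma sum_shared (s₁ : S) (b : Arm) {T : ℕ} (τ : Traj S T) (p : Fin T → Prop) [DecidablePred p]
    (f : Fin T → ℝ) : ∑ i ∈ (sharedData s₁ b τ).filter p, f i =
      ∑ i : Fin T, share s₁ b (τ.1 i.castSucc) (τ.2.1 i) * (if p i then 1 else 0) * f i := by
  rw [sharedData, Finset.filter_filter, Finset.sum_filter]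
  refine Finset.sum_congr rfl fun i _ => ?_
  unfold share
  by_cases h1 : τ.1 i.castSucc ≠ s₁ ∨ (τ.1 i.castSucc = s₁ ∧ τ.2.1 i = b) <;> by_cases h2 : p i <;>
    simp [h1, h2]

lemma sum_transCount_mul (s₁ : S) (b : Arm) {T : ℕ} (τ : Traj S T) (s : S) (f : S → ℝ) :
    ∑ s', transCount s₁ b τ s s' * f s' =
      ∑ i ∈ (sharedData s₁ b τ).filter (fun i => τ.1 i.castSucc = s), f (τ.1 i.succ) := by
  rw [sum_shared]
  simp only [transCount, Finset.sum_mul]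
  rw [Finset.sum_comm]
  refine Finset.sum_congr rfl fun i _ => ?_
  by_cases h : τ.1 i.castSucc = s
  · simp [h]
  · simp [h]

lemma visits_eq (s₁ : S) (b : Arm) {T : ℕ} (τ : Traj S T) (s : S) :
    (visits s₁ b τ s : ℝ) = ∑ s', transCount s₁ b τ s s' := by
  have h := sum_transCount_mul s₁ b τ s fun _ => 1
  simp only [mul_one] at h
  rw [h, visits]
  simp

lemma transCount_nonneg (s₁ : S) (b : Arm) {T : ℕ} (τ : Traj S T) (s s' : S) :
    0 ≤ transCount s₁ b τ s s' := by
  refine Finset.sum_nonneg fun i _ => mul_nonneg ?_ ?_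
  · unfold share; split_ifs <;> norm_num
  · split_ifs <;> norm_num

lemma empTrans_eq (s₁ : S) (b : Arm) {T : ℕ} (τ : Traj S T) (s s' : S) :
    empTrans s₁ b τ s s' = transCount s₁ b τ s s' / ((max (visits s₁ b τ s) 1 : ℕ) : ℝ) := by
  have h := sum_shared s₁ b τ (fun i => τ.1 i.castSucc = s ∧ τ.1 i.succ = s') fun _ => 1
  simp only [mul_one] at h
  rw [empTrans, Matrix.of_apply, transCount, ← h]
  simp

lemma isUnit_one_sub_empTrans {γ : ℝ} (hγ₀ : 0 ≤ γ) (hγ₁ : γ < 1) (s₁ : S) (b : Arm) {T : ℕ}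
    (τ : Traj S T) : IsUnit (1 - γ • empTrans s₁ b τ).det := by
  refine isUnit_one_sub_smul hγ₀ hγ₁ (fun s s' => ?_) fun s => ?_
  · rw [empTrans_eq]
    exact div_nonneg (transCount_nonneg _ _ _ _ _) (Nat.cast_nonneg _)
  · have hpos : (0 : ℝ) < ((max (visits s₁ b τ s) 1 : ℕ) : ℝ) := by
      exact_mod_cast lt_of_lt_of_le one_pos (le_max_right _ _)
    simp only [empTrans_eq]
    rw [← Finset.sum_div, ← visits_eq, div_le_one hpos]
    exact_mod_cast le_max_left _ _

lemma tdSum_eq (s₁ : S) (γ : ℝ) (θ : Param S) (b : Arm) (s : S) {T : ℕ} (τ : Traj S T) :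
    tdSum s₁ γ θ b s τ = ∑ i ∈ (sharedData s₁ b τ).filter (fun i => τ.1 i.castSucc = s),
      (τ.2.2 i + γ * armValue s₁ γ θ b (τ.1 i.succ) - armValue s₁ γ θ b s) := by
  rw [sum_shared, tdSum, pathSum]
  refine Finset.sum_congr rfl fun i _ => ?_
  by_cases h : τ.1 i.castSucc = s
  · simp only [h, if_true, tdMean]; ring
  · simp [h]

/-- If every state is visited, the estimation error of the value function solves a linear system
with the temporal difference sums on the right hand side. -/
lemma valueHat_sub {γ : ℝ} (hγ₀ : 0 ≤ γ) (hγ₁ : γ < 1) (s₁ : S) (θ : Param S) (b : Arm) {T : ℕ}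
    (hT : T ≠ 0) (τ : Traj S T) (hvis : ∀ s, 0 < visits s₁ b τ s) (x : S) :
    √(T : ℝ) * (valueHat s₁ γ b τ x - armValue s₁ γ θ b x) =
      ∑ s, errorMat γ (fun p => (T : ℝ)⁻¹ * transCount s₁ b τ p.1 p.2) x s *
        ((√(T : ℝ))⁻¹ * tdSum s₁ γ θ b s τ) := by
  have hTpos : (0 : ℝ) < T := Nat.cast_pos.2 (Nat.pos_of_ne_zero hT)
  have hmax : ∀ s, ((max (visits s₁ b τ s) 1 : ℕ) : ℝ) = visits s₁ b τ s := fun s => by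
    rw [max_eq_left (hvis s)]
  have hN : ∀ s, (0 : ℝ) < visits s₁ b τ s := fun s => Nat.cast_pos.2 (hvis s)
  have hsys : (1 - γ • empTrans s₁ b τ) *ᵥ (valueHat s₁ γ b τ - armValue s₁ γ θ b) =
      fun s => tdSum s₁ γ θ b s τ / visits s₁ b τ s := by
    rw [mulVec_sub, valueHat, mulVec_mulVec,
      Matrix.mul_nonsing_inv _ (isUnit_one_sub_empTrans hγ₀ hγ₁ s₁ b τ), one_mulVec, sub_mulVec,
      one_mulVec, smul_mulVec]
    ext s
    have h1 := sum_transCount_mul s₁ b τ s (armValue s₁ γ θ b)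
    simp only [Pi.sub_apply, Pi.smul_apply, smul_eq_mul, mulVec, dotProduct, empTrans_eq, hmax,
      div_mul_eq_mul_div, ← Finset.sum_div, h1, empReward]
    rw [tdSum_eq, Finset.sum_sub_distrib, Finset.sum_add_distrib, ← Finset.mul_sum,
      Finset.sum_const, nsmul_eq_mul, ← visits]
    field_simp [(hN s).ne']
    ring
  have hsol : valueHat s₁ γ b τ - armValue s₁ γ θ b = (1 - γ • empTrans s₁ b τ)⁻¹ *ᵥ
      fun s => tdSum s₁ γ θ b s τ / visits s₁ b τ s := by
    rw [← hsys, mulVec_mulVec, Matrix.nonsing_inv_mul _ (isUnit_one_sub_empTrans hγ₀ hγ₁ s₁ b τ),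
      one_mulVec]
  have hE : ∀ s, errorMat γ (fun p => (T : ℝ)⁻¹ * transCount s₁ b τ p.1 p.2) x s =
      (1 - γ • empTrans s₁ b τ)⁻¹ x s * (T / visits s₁ b τ s) := by
    intro s
    have h1 : (Matrix.of fun s s' => (T : ℝ)⁻¹ * transCount s₁ b τ s s' /
        ∑ x, (T : ℝ)⁻¹ * transCount s₁ b τ s x) = empTrans s₁ b τ := by
      ext s s'
      rw [Matrix.of_apply, ← Finset.mul_sum, ← visits_eq, empTrans_eq, hmax,
        mul_div_mul_left _ _ (inv_ne_zero hTpos.ne')]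
    rw [errorMat]
    simp only [h1]
    rw [Matrix.mul_diagonal, ← Finset.mul_sum, ← visits_eq, mul_inv, inv_inv, div_eq_mul_inv]
  have hx := congrFun hsol x
  rw [Pi.sub_apply] at hx
  rw [hx, mulVec, dotProduct, Finset.mul_sum]
  refine Finset.sum_congr rfl fun s _ => ?_
  have hsq : √(T : ℝ) * √(T : ℝ) = T := Real.mul_self_sqrt hTpos.le
  have hs0 : √(T : ℝ) ≠ 0 := (Real.sqrt_pos.2 hTpos).ne'
  rw [hE]
  nth_rw 2 [← hsq]
  field_simp

lemma pathSum_infl (s₁ : S) (γ : ℝ) (θ : Param S) (μ u : S → ℝ) {T : ℕ} (τ : Traj S T) :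
    pathSum θ (inflCoef s₁ γ θ μ u) (inflMean s₁ γ θ μ u) τ =
      ∑ b, armSign b * ∑ s, (u ᵥ* resolvent s₁ γ θ b) s / freq s₁ μ s * tdSum s₁ γ θ b s τ := by
  simp only [pathSum, inflCoef, inflMean, Finset.sum_mul, ← Finset.sum_add_distrib]
  rw [Finset.sum_comm]
  refine Finset.sum_congr rfl fun b _ => ?_
  simp only [tdSum, pathSum, Finset.mul_sum]
  rw [Finset.sum_comm]
  refine Finset.sum_congr rfl fun i _ => ?_
  rw [Finset.sum_eq_single (τ.1 i.castSucc)]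
  · simp only [armCoef, if_true]; ring
  · intro s _ hs; simp [hs.symm]
  · simp

lemma sum_mul_pathSum_infl (s₁ : S) (γ : ℝ) (θ : Param S) (μ u : S → ℝ) {T : ℕ} (τ : Traj S T) :
    ∑ x, u x * (∑ b, armSign b * ∑ s, resolvent s₁ γ θ b x s / freq s₁ μ s *
      tdSum s₁ γ θ b s τ) = pathSum θ (inflCoef s₁ γ θ μ u) (inflMean s₁ γ θ μ u) τ := by
  rw [pathSum_infl]
  simp only [Finset.mul_sum]
  rw [Finset.sum_comm]
  refine Finset.sum_congr rfl fun b _ => ?_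
  rw [Finset.sum_comm]
  refine Finset.sum_congr rfl fun s _ => ?_
  simp only [vecMul, dotProduct, Finset.sum_div, Finset.sum_mul, Finset.mul_sum]
  exact Finset.sum_congr rfl fun x _ => by ring

lemma ate_apply (s₁ : S) (γ : ℝ) (θ : Param S) (x : S) :
    ate s₁ γ θ x = ∑ b, armSign b * armValue s₁ γ θ b x := by
  rw [sum_arm]
  simp only [ate, armSign, armValue, armPolicy, Pi.sub_apply]
  ring

lemma ateIS_apply (s₁ : S) (γ : ℝ) {T : ℕ} (τ : Traj S T) (x : S) :
    ateIS s₁ γ τ x = ∑ b, armSign b * valueHat s₁ γ b τ x := by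
  rw [sum_arm]
  simp only [ateIS, armSign, Pi.sub_apply]
  ring

variable {s₁ : S} {γ : ℝ} (hγ₀ : 0 ≤ γ) (hγ₁ : γ < 1) {θ : Param S} (hθ : θ ∈ models s₁)
  {μ : S → ℝ} (hpos : ∀ s, 0 < μ s)

include hθ in
lemma sum_limitFreq (b : Arm) (s : S) : ∑ x, limitFreq s₁ θ μ b (s, x) = freq s₁ μ s := by
  simp only [limitFreq, ← Finset.mul_sum, sum_transMat hθ (isPolicy_armPolicy s₁ b), mul_one]

include hθ hpos in
lemma errorMat_limitFreq (b : Arm) (x s : S) :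
    errorMat γ (limitFreq s₁ θ μ b) x s = resolvent s₁ γ θ b x s / freq s₁ μ s := by
  have h : (Matrix.of fun s s' => limitFreq s₁ θ μ b (s, s') /
      ∑ x, limitFreq s₁ θ μ b (s, x)) = transMat (armPolicy s₁ b) θ := by
    ext s s'
    rw [Matrix.of_apply, sum_limitFreq hθ, limitFreq, mul_div_cancel_left₀ _ (freq_pos hpos s).ne']
  rw [errorMat, h, Matrix.mul_diagonal, sum_limitFreq hθ, resolvent, div_eq_mul_inv]

include hγ₀ hγ₁ hθ hpos in
lemma continuousAt_errorMat (b : Arm) (x s : S) :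
    ContinuousAt (fun k => errorMat γ k x s) (limitFreq s₁ θ μ b) := by
  have hne : ∀ s, ∑ x, limitFreq s₁ θ μ b (s, x) ≠ 0 := fun s => by
    rw [sum_limitFreq hθ]; exact (freq_pos hpos s).ne'
  have hsum : ∀ s, Tendsto (fun k : S × S → ℝ => ∑ x, k (s, x)) (𝓝 (limitFreq s₁ θ μ b))
      (𝓝 (∑ x, limitFreq s₁ θ μ b (s, x))) := fun s =>
    (by fun_prop : Continuous fun k : S × S → ℝ => ∑ x, k (s, x)).tendsto _
  have hP : Tendsto (fun k : S × S → ℝ => 1 - γ • Matrix.of fun s s' => k (s, s') / ∑ x, k (s, x))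
      (𝓝 (limitFreq s₁ θ μ b)) (𝓝 (1 - γ • transMat (armPolicy s₁ b) θ)) := by
    refine tendsto_const_nhds.sub (Tendsto.const_smul ?_ γ)
    refine tendsto_pi_nhds.2 fun s => tendsto_pi_nhds.2 fun s' => ?_
    have h1 := (((by fun_prop : Continuous fun k : S × S → ℝ => k (s, s')).tendsto
      (limitFreq s₁ θ μ b)).div (hsum s) (hne s))
    have h2 : limitFreq s₁ θ μ b (s, s') / ∑ x, limitFreq s₁ θ μ b (s, x) =
        transMat (armPolicy s₁ b) θ s s' := by
      rw [sum_limitFreq hθ, limitFreq, mul_div_cancel_left₀ _ (freq_pos hpos s).ne']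
    rw [h2] at h1
    exact h1
  have hinv := tendsto_matrix_inv (isUnit_resolvent hγ₀ hγ₁ hθ (isPolicy_armPolicy s₁ b)) hP
  rw [ContinuousAt, errorMat_limitFreq hθ hpos, div_eq_mul_inv, ← sum_limitFreq hθ b s]
  simp only [errorMat, Matrix.mul_diagonal]
  exact ((tendsto_pi_nhds.1 (tendsto_pi_nhds.1 hinv x) s)).mul ((hsum s).inv₀ (hne s))

end Estimator

section AsymptoticNormality

variable {S : Type*} [Fintype S] [DecidableEq S] [MeasurableSpace S] [MeasurableSingletonClass S]

lemma measurable_traj {E : Type*} [MeasurableSpace E] {T : ℕ} {X : Traj S T → E}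
    (h : ∀ s a, Measurable fun y => X (s, a, y)) : Measurable X :=
  measurable_from_prod_countable_right fun s => measurable_from_prod_countable_right fun a => h s a

lemma measurable_pathSum (θ : Param S) (c : S → Arm → ℝ) (g : S → Arm → S → ℝ) (T : ℕ) :
    Measurable (pathSum θ c g : Traj S T → ℝ) :=
  measurable_traj fun s a => by unfold pathSum; fun_prop

lemma measurable_ateIS (s₁ : S) (γ : ℝ) (T : ℕ) (x : S) :
    Measurable fun τ : Traj S T => ateIS s₁ γ τ x := by
  refine measurable_traj fun s a => ?_
  simp only [ateIS_apply]
  refine Finset.measurable_sum _ fun b _ => Measurable.const_mul ?_ _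
  -- given the states and the actions, the estimator is a linear function of the rewards
  have hlin : (fun y => valueHat s₁ γ b ((s, a, y) : Traj S T) x) = fun y => ∑ s',
      (1 - γ • empTrans s₁ b ((s, a, 0) : Traj S T))⁻¹ x s' *
        ((∑ i ∈ (sharedData s₁ b ((s, a, 0) : Traj S T)).filter (fun i => s i.castSucc = s'), y i) /
          ((max (visits s₁ b ((s, a, 0) : Traj S T) s') 1 : ℕ) : ℝ)) := rfl
  rw [hlin]
  exact Finset.measurable_sum _ fun s' _ => ((Finset.measurable_sum _ fun i _ =>
    measurable_pi_apply i).div_const _).const_mul _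

variable {s₁ : S} {γ : ℝ} (hγ₀ : 0 ≤ γ) (hγ₁ : γ < 1) {v : S → Arm → ℝ≥0} {θ : Param S}
  (hθ : θ ∈ models s₁) {μ : S → ℝ} (hpos : ∀ s, 0 < μ s)
  (herg : UniformlyErgodic (transMat (piHalf s₁) θ) μ)

include hθ hpos herg

lemma tendstoZeroInProb_transCount (b : Arm) (p : S × S) :
    TendstoZeroInProb (fun T => trajLaw (piHalf s₁) v μ T θ) fun T τ =>
      (T : ℝ)⁻¹ * transCount s₁ b τ p.1 p.2 - limitFreq s₁ θ μ b p := by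
  have hprob := fun T => isProbabilityMeasure_trajLaw hθ v herg.1.1 herg.1.2.1 T
  refine tendstoZeroInProb_of_charFun (fun T => measurable_traj fun s a => ?_)
    fun t => ?_
  · exact measurable_const (a := (T : ℝ)⁻¹ * transCount s₁ b ((s, a, 0) : Traj S T) p.1 p.2)
  have h := tendsto_integral_exp_mean hθ herg (v := v) fun x a x' =>
    t * (share s₁ b x a * (if x = p.1 ∧ x' = p.2 then 1 else 0))
  have hm : ∑ x, μ x * ∑ a, piHalf s₁ x a * ∑ x', θ.1 x a x' *
      (t * (share s₁ b x a * (if x = p.1 ∧ x' = p.2 then 1 else 0))) =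
      t * limitFreq s₁ θ μ b p := by
    rw [Finset.sum_eq_single p.1 (fun x _ hx => by simp [hx]) (by simp)]
    have h1 : ∀ a, ∑ x', θ.1 p.1 a x' * (t * (share s₁ b p.1 a *
        (if p.1 = p.1 ∧ x' = p.2 then 1 else 0))) =
        t * (share s₁ b p.1 a * θ.1 p.1 a p.2) := by
      intro a
      simp
      ring
    have hf := (freq_pos (s₁ := s₁) hpos p.1).ne'
    rw [Finset.sum_congr rfl fun a _ => by rw [h1 a], limitFreq, transMat, Matrix.of_apply,
      Finset.mul_sum, Finset.mul_sum, Finset.mul_sum]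
    refine Finset.sum_congr rfl fun a _ => ?_
    rw [← freq_mul_armPolicy hpos]
    field_simp
  rw [hm] at h
  refine h.congr fun T => ?_
  refine integral_congr_ae (ae_of_all _ fun τ => ?_)
  simp only [transCount, ← Finset.mul_sum]
  congr 3
  ring

include hγ₀ hγ₁

/-- The scaled temporal difference sums are tight, since their characteristic functions converge to
that of a Gaussian. -/
lemma boundedInProb_tdSum (b : Arm) (s : S) :
    BoundedInProb (fun T => trajLaw (piHalf s₁) v μ T θ) fun T τ =>
      (√(T : ℝ))⁻¹ * tdSum s₁ γ θ b s τ := by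
  have hprob := fun T => isProbabilityMeasure_trajLaw hθ v herg.1.1 herg.1.2.1 T
  set c : S → Arm → ℝ := fun x a => share s₁ b x a * if x = s then 1 else 0 with hc
  set g : S → Arm → S → ℝ := fun x a x' =>
    share s₁ b x a * (if x = s then 1 else 0) * tdMean s₁ γ θ b x a x' with hg
  refine boundedInProb_of_charFun (fun T => (measurable_pathSum θ c g T).const_mul _)
    (f := fun t => Complex.exp (-(∑ s, μ s * condVar (piHalf s₁) v θ (fun x a => t * c x a)
      (fun x a x' => t * g x a x') s : ℝ) / 2)) ?_ fun t => ?_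
  · refine Continuous.continuousAt ?_
    unfold condVar
    fun_prop
  · have h := tendsto_integral_exp_pathSum hθ herg (v := v) (c := fun x a => t * c x a)
      (g := fun x a x' => t * g x a x') fun x a hxa => by
        have h1 := share_mul_sum_tdMean hγ₀ hγ₁ hθ hpos (b := b) hxa
        calc ∑ x', θ.1 x a x' * (t * g x a x')
            = t * (if x = s then 1 else 0) *
              (share s₁ b x a * ∑ x', θ.1 x a x' * tdMean s₁ γ θ b x a x') := by
              simp only [hg, Finset.mul_sum]
              exact Finset.sum_congr rfl fun x' _ => by ring
          _ = 0 := by rw [h1, mul_zero]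
    refine h.congr fun T => integral_congr_ae (ae_of_all _ fun τ => ?_)
    have h2 : pathSum θ (fun x a => t * c x a) (fun x a x' => t * g x a x') τ =
        t * tdSum s₁ γ θ b s τ := by
      simp only [tdSum, pathSum, Finset.mul_sum]
      exact Finset.sum_congr rfl fun i _ => by simp only [hc, hg]; ring
    dsimp only
    rw [h2, mul_left_comm]

/-- The estimation error is asymptotically equal to the sum of the influence functions. -/
lemma tendstoZeroInProb_remainder (x : S) :
    TendstoZeroInProb (fun T => trajLaw (piHalf s₁) v μ T θ) fun T τ =>
      √(T : ℝ) * (ateIS s₁ γ τ x - ate s₁ γ θ x) - (√(T : ℝ))⁻¹ *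
        ∑ b, armSign b * ∑ s, resolvent s₁ γ θ b x s / freq s₁ μ s * tdSum s₁ γ θ b s τ := by
  have hcount := fun b => tendstoZeroInProb_transCount (v := v) hθ hpos herg b
  -- the replacement of the empirical matrix by its limit
  have hdiff : ∀ b s, TendstoZeroInProb (fun T => trajLaw (piHalf s₁) v μ T θ) fun T τ =>
      errorMat γ (fun p => (T : ℝ)⁻¹ * transCount s₁ b τ p.1 p.2) x s -
        resolvent s₁ γ θ b x s / freq s₁ μ s := by
    intro b s ε hε
    have hU := (continuousAt_errorMat hγ₀ hγ₁ hθ hpos b x s).eventually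
      (Metric.ball_mem_nhds _ hε)
    refine (tendsto_measure_notMem_nhds (hcount b) hU).congr fun T => ?_
    congr 1
    ext τ
    simp only [Set.mem_ofPred_eq, not_lt, Real.dist_eq,
      errorMat_limitFreq hθ hpos]
  -- all states are visited with probability tending to one
  have hvis : ∀ b, Tendsto (fun T => trajLaw (piHalf s₁) v μ T θ
      {τ | ¬ ∀ s, 0 < visits s₁ b τ s}) atTop (𝓝 0) := by
    intro b
    have hU : {k : S × S → ℝ | ∀ s, 0 < ∑ y, k (s, y)} ∈ 𝓝 (limitFreq s₁ θ μ b) := by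
      refine eventually_all.2 fun s => ?_
      have hc : Continuous fun k : S × S → ℝ => ∑ y, k (s, y) := by fun_prop
      refine (hc.tendsto _).eventually_const_lt ?_
      rw [sum_limitFreq hθ]
      exact freq_pos hpos s
    refine tendsto_of_tendsto_of_tendsto_of_le_of_le tendsto_const_nhds
      (tendsto_measure_notMem_nhds (hcount b) hU) (fun T => zero_le) fun T => ?_
    refine measure_mono fun τ hτ hk => hτ fun s => ?_
    have h1 := hk s
    dsimp only at h1
    rw [← Finset.mul_sum, ← visits_eq] at h1
    have h2 : (visits s₁ b τ s : ℝ) ≠ 0 := fun h0 => by rw [h0, mul_zero] at h1; exact h1.false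
    exact Nat.pos_of_ne_zero (by exact_mod_cast h2)
  have hbad : Tendsto (fun T => trajLaw (piHalf s₁) v μ T θ
      {τ | ¬ ∀ b s, 0 < visits s₁ b τ s}) atTop (𝓝 0) := by
    have h1 := tendsto_finsetSum (Finset.univ : Finset Arm) fun b _ => hvis b
    rw [Finset.sum_const_zero] at h1
    refine tendsto_of_tendsto_of_tendsto_of_le_of_le tendsto_const_nhds h1
      (fun T => zero_le) fun T => ?_
    refine (measure_mono fun τ hτ => ?_).trans (measure_biUnion_finset_le _ _)
    rw [Set.mem_ofPred_eq, not_forall] at hτ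
    obtain ⟨b, hb⟩ := hτ
    exact Set.mem_biUnion (Finset.mem_univ b) hb
  have hsum := TendstoZeroInProb.sum Finset.univ fun b (_ : b ∈ (Finset.univ : Finset Arm)) =>
    TendstoZeroInProb.sum Finset.univ fun s (_ : s ∈ (Finset.univ : Finset S)) =>
      ((hdiff b s).mul_bounded
        (boundedInProb_tdSum hγ₀ hγ₁ hθ hpos herg (v := v) b s)).const_mul (armSign b)
  refine hsum.congr hbad ?_
  filter_upwards [eventually_ne_atTop 0] with T hT τ hτ
  replace hτ := not_not.1 hτ
  have hv := fun b => valueHat_sub hγ₀ hγ₁ s₁ θ b hT τ (hτ b) x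
  rw [ateIS_apply, ate_apply, ← Finset.sum_sub_distrib, Finset.mul_sum, Finset.mul_sum,
    ← Finset.sum_sub_distrib]
  refine Finset.sum_congr rfl fun b _ => ?_
  rw [← mul_sub, mul_left_comm, hv b, mul_left_comm _ (armSign b), ← mul_sub, Finset.mul_sum,
    ← Finset.sum_sub_distrib, Finset.mul_sum]
  exact Finset.sum_congr rfl fun s _ => by ring

/-- The asymptotic normality of the information-sharing estimator. -/
lemma tendsto_integral_ateIS (f : EuclideanSpace ℝ S →ᵇ ℝ) :
    Tendsto (fun T : ℕ => ∫ τ, f (WithLp.toLp 2 (√(T : ℝ) • (ateIS s₁ γ τ - ate s₁ γ θ)))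
        ∂(trajLaw (piHalf s₁) v μ T θ)) atTop
      (𝓝 (∫ x, f x ∂(multivariateGaussian 0 (sigmaIS s₁ γ v θ μ)))) := by
  have hprob := fun T => isProbabilityMeasure_trajLaw hθ v herg.1.1 herg.1.2.1 T
  set X : ∀ T : ℕ, Traj S T → EuclideanSpace ℝ S := fun T τ => WithLp.toLp 2 fun x =>
    (√(T : ℝ))⁻¹ * ∑ b, armSign b * ∑ s, resolvent s₁ γ θ b x s / freq s₁ μ s *
      tdSum s₁ γ θ b s τ with hX
  have hXm : ∀ T, Measurable (X T) := by
    intro T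
    refine (WithLp.measurable_toLp 2 _).comp (measurable_pi_lambda _ fun x => ?_)
    refine Measurable.const_mul (Finset.measurable_sum _ fun b _ => Measurable.const_mul
      (Finset.measurable_sum _ fun s _ => Measurable.const_mul (measurable_pathSum θ _ _ T) _) _) _
  refine tendsto_integral_of_charFun (X := X)
    (Y := fun T τ => WithLp.toLp 2 (√(T : ℝ) • (ateIS s₁ γ τ - ate s₁ γ θ))) hXm ?_ ?_ ?_ f
  · intro T
    refine (WithLp.measurable_toLp 2 _).comp (measurable_pi_lambda _ fun x => ?_)
    exact ((measurable_ateIS s₁ γ T x).sub_const _).const_mul _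
  · intro t
    rw [charFun_multivariateGaussian (posSemidef_sigmaIS hγ₀ hγ₁ hθ hpos v),
      dotProduct_sigmaIS hγ₀ hγ₁ hθ hpos v]
    have h := tendsto_integral_exp_pathSum hθ herg (v := v) (c := inflCoef s₁ γ θ μ t.ofLp)
      (g := inflMean s₁ γ θ μ t.ofLp) fun x a hxa => sum_inflMean hγ₀ hγ₁ hθ hpos _ hxa
    convert h using 2
    · rename_i T
      rw [charFun_apply, integral_map (hXm T).aemeasurable (by fun_prop)]
      refine integral_congr_ae (ae_of_all _ fun τ => ?_)
      have h1 : inner ℝ (X T τ) t = (√(T : ℝ))⁻¹ *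
          pathSum θ (inflCoef s₁ γ θ μ t.ofLp) (inflMean s₁ γ θ μ t.ofLp) τ := by
        rw [← sum_mul_pathSum_infl, Finset.mul_sum, PiLp.inner_apply]
        refine Finset.sum_congr rfl fun x _ => ?_
        simp [hX]
        ring
      simp only [h1]
    · simp [neg_div]
  · intro x
    exact tendstoZeroInProb_remainder hγ₀ hγ₁ hθ hpos herg x

end AsymptoticNormality

end SST

end

theorem theorem5 {S : Type*} [Fintype S] [DecidableEq S] [MeasurableSpace S]
    [MeasurableSingletonClass S] (s₁ : S) (γ : ℝ) (hγ₀ : 0 ≤ γ) (hγ₁ : γ < 1)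
    (v : S → SST.Arm → ℝ≥0) (θ : SST.Param S) (hθ : θ ∈ SST.models s₁) (μ : S → ℝ)
    (hμ : SST.IsStationary (SST.transMat (SST.piHalf s₁) θ) μ) (hpos : ∀ s, 0 < μ s) :
    (∀ (T : ℕ), 1 ≤ T → ∀ est : SST.Traj S T → S → ℝ, Measurable est →
      (∀ s, MemLp (fun τ => est τ s) 2 (SST.trajLaw (SST.piHalf s₁) v μ T θ)) →
      (SST.LocallyUnbiased s₁ γ v μ T θ est ∨ SST.GloballyUnbiased s₁ γ v T est) →
      ((T : ℝ) • SST.estCov (SST.trajLaw (SST.piHalf s₁) v μ T θ) est -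
        SST.sigmaIS s₁ γ v θ μ).PosSemidef) ∧
    (SST.UniformlyErgodic (SST.transMat (SST.piHalf s₁) θ) μ →
      (SST.sigmaIS s₁ γ v θ μ).PosSemidef ∧
      ∀ f : EuclideanSpace ℝ S →ᵇ ℝ,
        Tendsto (fun T : ℕ => ∫ τ,
            f (WithLp.toLp 2 (√(T : ℝ) • (SST.ateIS s₁ γ τ - SST.ate s₁ γ θ)))
              ∂(SST.trajLaw (SST.piHalf s₁) v μ T θ))
          atTop (𝓝 (∫ x, f x ∂(multivariateGaussian 0 (SST.sigmaIS s₁ γ v θ μ))))) := by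
  refine ⟨fun T _ est _ hL2 hub => ?_, fun herg =>
    ⟨SST.posSemidef_sigmaIS hγ₀ hγ₁ hθ hpos v,
      fun f => SST.tendsto_integral_ateIS hγ₀ hγ₁ hθ hpos herg f⟩⟩
  exact SST.posSemidef_estCov_sub_sigmaIS hγ₀ hγ₁ hθ hμ hpos hL2
    (hub.elim id fun h => h.locallyUnbiased hγ₀ hγ₁ hμ.2.1 θ)
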